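/- Let $k$ be a finite field of odd characteristic and let $\psi$ be a nontrivial additive character of $k$ with values in $\mathbb C^\times$. All representations are complex. Let $G_2(k)$ be the split group of type $G_2$, realized as the automorphism group of the split octonion algebra over $k$ and embedded in $\mathrm{SO}_7(k)=\{g\in \mathrm{GL}_7(k): {}^tgQg=Q,\ \det g=1\}$ through its action on the pure octonions; here $Q$ is the symmetric matrix with $Q_{17}=Q_{26}=1$, $Q_{35}=-1$, $Q_{44}=2$ and, apart from the symmetric entries, all others zero. The basis of the pure octonions is $e_1^+,e_2^+,e_3^+,X^0,e_3^-,e_2^-,e_1^-$, as follows. Write the split quaternions as $\langle 1,e_1,e_2,e_3=e_1e_2\rangle$ with $e_1^2=e_2^2=1$, $e_1e_2=-e_2e_1$; the octonions are pairs of quaternions with $(a,b)(c,d)=(ac+\bar d b,\ da+b\bar c)$; then $X^\pm=(\tfrac12,\pm\tfrac12)$, $X^0=X^+-X^-$, $e_i^\pm=e_iX^\pm$. Let $\alpha$ (short) and $\beta$ (long) be the simple roots of $G_2$, with root elements $x_\gamma(r)$ normalized so that, with $E_{ij}$ the matrix units, $$x_\alpha(r)=1-2rE_{24}-r^2E_{26}+rE_{46}-rE_{51}-rE_{73},\qquad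 x_\beta(r)=1+rE_{12}-rE_{67},$$ $$x_{\alpha+\beta}(r)=1-2rE_{14}-r^2E_{17}+rE_{47}+rE_{52}+rE_{63},\qquad x_{2\alpha+\beta}(r)=1-rE_{16}+rE_{27}-rE_{43}+r^2E_{53}-2rE_{54},$$ $$x_{3\alpha+\beta}(r)=1+rE_{23}+rE_{56},\qquad x_{3\alpha+2\beta}(r)=1+rE_{13}+rE_{57}.$$ Let $U$ be the subgroup generated by all positive root subgroups, and $\psi_U$ the character of $U$ with $\psi_U(x_\alpha(r))=\psi_U(x_\beta(r))=\psi(r)$ that is trivial on the other positive root subgroups. Let $U_H$ be the subgroup generated by the root subgroups of $\beta,2\alpha+\beta,3\alpha+\beta,3\alpha+2\beta$. Let $\Pi$ be an irreducible cuspidal representation of $G_2(k)$ (its Jacquet module for the unipotent radical of every proper parabolic subgroup vanishes) which is generic, i.e. $\mathrm{Hom}_U(\Pi,\psi_U)\neq 0$. Its Whittaker model $\mathcal W(\Pi,\psi)$ consists of the functions $W(g)=l(\Pi(g)v)$, $v\in\Pi$, with $0\ne l\in \mathrm{Hom}_U(\Pi,\psi_U)$. Let $\tau$ be an irreducible generic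 representation of $\mathrm{GL}_2(k)$, and let $0\neq\Lambda\in \mathrm{Hom}_N(\tau,\psi^{-1})$, where $N$ is the upper triangular unipotent subgroup and $\psi^{-1}\begin{pmatrix}1&x\\&1\end{pmatrix}=\psi(x)^{-1}$. Let $\widetilde P\subset \mathrm{SO}_7(k)$ be the block upper triangular parabolic subgroup for the block sizes $2,3,2$, with Levi subgroup $\mathrm{GL}_2(k)\times \mathrm{SO}_3(k)$ (the $\mathrm{GL}_2(k)$-factor being the upper left block) and unipotent radical $\widetilde U$. Let $I(\tau)=\mathrm{Ind}_{\widetilde P}^{\mathrm{SO}_7(k)}(\tau\otimes 1_{\mathrm{SO}_3})$, the space of functions $\xi:\mathrm{SO}_7(k)\to\tau$ with $\xi(pg)=\tau(x)\xi(g)$ for $p\in\widetilde P$ with $\mathrm{GL}_2(k)$-part $x$, and let $I(\mathcal W(\tau,\psi^{-1}))$ be the space of the functions $f(g,a)=\Lambda(\tau(a)\xi(g))$ on $\mathrm{SO}_7(k)\times \mathrm{GL}_2(k)$, $\xi\in I(\tau)$. For $W\in\mathcal W(\Pi,\psi)$ put $$\Psi(W,f)=\sum_{g\in U_H\backslash G_2(k)}W(g)f(g,\mathrm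 I_2),\qquad (M_{w_2}f)(g,a)=\sum_{u\in\widetilde U}f(w_2ug,\ d_1a^*),$$ where $d_1=\mathrm{diag}(-1,1)$, $a^*=J\,{}^ta^{-1}J$ with $J=\begin{pmatrix}&1\\1&\end{pmatrix}$, and $w_2\in \mathrm{SO}_7(k)$ is the symmetric matrix with entries $-1$ at the positions $(1,6),(2,7),(3,5),(4,4),(5,3),(6,1),(7,2)$ and $0$ elsewhere; $\Psi(W,M_{w_2}f)$ is given by the same sum. Then there is a complex number $\gamma(\Pi\times\tau,\psi)$, depending only on $\Pi$, $\tau$ and $\psi$, such that $$\Psi(W,M_{w_2}f)=\gamma(\Pi\times\tau,\psi)\,\Psi(W,f)\qquad\text{for all } W\in\mathcal W(\Pi,\psi),\ f\in I(\mathcal W(\tau,\psi^{-1})).$$ -/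

import Mathlib

open Matrix

noncomputable section

namespace G2GL2

universe u

/-! ### The split octonions -/

section Octonions

variable (k : Type u) [Field k]

/-- The split quaternion algebra, with basis `1, e₁, e₂, e₃ = e₁ e₂` (written `1, i, j, k` in
Mathlib), `e₁² = e₂² = 1`, `e₁ e₂ = - e₂ e₁`. -/
abbrev Quat : Type u := QuaternionAlgebra k 1 0 1

/-- The Cayley algebra, as a vector space. -/
abbrev Oct : Type u := Quat k × Quat k

variable {k}

/-- The product of the Cayley algebra; `star` is the conjugation of quaternions. -/
def octMul (u v : Oct k) : Oct k :=
  (u.1 * v.1 + star v.2 * u.2, v.2 * u.1 + u.2 * star v.1)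

variable (k)

/-- The elements `(e₁, 0)`, `(e₂, 0)`, `(e₃, 0)`. -/
def octE1 : Oct k := (⟨0, 1, 0, 0⟩, 0)
/-- See `octE1`. -/
def octE2 : Oct k := (⟨0, 0, 1, 0⟩, 0)
/-- See `octE1`. -/
def octE3 : Oct k := (⟨0, 0, 0, 1⟩, 0)
/-- The element `X⁺ = (1/2, 1/2)`. -/
def octXp : Oct k := (⟨1 / 2, 0, 0, 0⟩, ⟨1 / 2, 0, 0, 0⟩)
/-- The element `X⁻ = (1/2, -1/2)`. -/
def octXm : Oct k := (⟨1 / 2, 0, 0, 0⟩, ⟨-1 / 2, 0, 0, 0⟩)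

/-- The basis `e₁⁺, e₂⁺, e₃⁺, X⁰, e₃⁻, e₂⁻, e₁⁻` of the space of pure octonions, where
`eᵢ^± = eᵢ X^±` and `X⁰ = X⁺ - X⁻`. -/
def pureBasis : Fin 7 → Oct k :=
  ![octMul (octE1 k) (octXp k), octMul (octE2 k) (octXp k), octMul (octE3 k) (octXp k),
    octXp k - octXm k,
    octMul (octE3 k) (octXm k), octMul (octE2 k) (octXm k), octMul (octE1 k) (octXm k)]

variable {k}

/-- The pure octonion with a given coordinate vector. -/
def pureOct (x : Fin 7 → k) : Oct k := ∑ i, x i • pureBasis k i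

end Octonions

/-! ### The groups `SO₇` and `G₂` -/

section Groups

variable (k : Type u) [Field k]

/-- The Gram matrix of the quadratic form of the pure octonions. -/
def formQ : Matrix (Fin 7) (Fin 7) k :=
  !![0, 0, 0, 0, 0, 0, 1;
     0, 0, 0, 0, 0, 1, 0;
     0, 0, 0, 0, -1, 0, 0;
     0, 0, 0, 2, 0, 0, 0;
     0, 0, -1, 0, 0, 0, 0;
     0, 1, 0, 0, 0, 0, 0;
     1, 0, 0, 0, 0, 0, 0]

/-- The group `SO₇(k)` of matrices `g` of determinant `1` with `ᵗg Q g = Q`. -/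
def SO7 : Subgroup (GL (Fin 7) k) where
  carrier := {g | g.valᵀ * formQ k * g.val = formQ k ∧ g.val.det = 1}
  mul_mem' := by
    rintro a b ⟨ha, ha'⟩ ⟨hb, hb'⟩
    refine ⟨?_, by simp [ha', hb']⟩
    calc _ = b.valᵀ * (a.valᵀ * formQ k * a.val) * b.val := by
            simp only [Units.val_mul, transpose_mul, Matrix.mul_assoc]
      _ = _ := by rw [ha, hb]
  one_mem' := by simp
  inv_mem' := by
    rintro a ⟨ha, ha'⟩
    have h1 : a.val * a⁻¹.val = 1 := a.mul_inv
    have h2 : a⁻¹.valᵀ * a.valᵀ = 1 := by rw [← transpose_mul, h1, transpose_one]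
    refine ⟨?_, ?_⟩
    · calc a⁻¹.valᵀ * formQ k * a⁻¹.val
          = a⁻¹.valᵀ * (a.valᵀ * formQ k * a.val) * a⁻¹.val := by rw [ha]
        _ = (a⁻¹.valᵀ * a.valᵀ) * formQ k * (a.val * a⁻¹.val) := by
            simp only [Matrix.mul_assoc]
        _ = formQ k := by rw [h1, h2, Matrix.one_mul, Matrix.mul_one]
    · have h3 := congrArg Matrix.det h1
      rwa [det_mul, ha', one_mul, det_one] at h3

variable {k}

/-- The matrix of an element of `SO₇(k)`. -/
def SO7.mat (g : SO7 k) : Matrix (Fin 7) (Fin 7) k := g.val.val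

theorem SO7.mat_mul (g h : SO7 k) : SO7.mat (g * h) = SO7.mat g * SO7.mat h := by
  simp [SO7.mat]

theorem SO7.mat_one : SO7.mat (1 : SO7 k) = 1 := by
  simp [SO7.mat]

variable (k)

/-- The split group `G₂(k)`: the elements of `SO₇(k)` which are the matrices, on the pure
octonions, of automorphisms of the Cayley algebra. -/
def G2 : Subgroup (SO7 k) where
  carrier := {g | ∃ σ : Oct k ≃ₗ[k] Oct k, (∀ u v, σ (octMul u v) = octMul (σ u) (σ v)) ∧
    ∀ x : Fin 7 → k, σ (pureOct x) = pureOct (SO7.mat g *ᵥ x)}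
  mul_mem' := by
    rintro a b ⟨σ, h1, h2⟩ ⟨ρ, h3, h4⟩
    refine ⟨ρ.trans σ, fun u v => ?_, fun x => ?_⟩
    · simp [h1, h3]
    · simp [h2, h4, SO7.mat_mul]
  one_mem' := ⟨LinearEquiv.refl k _, by simp, by simp [SO7.mat_one]⟩
  inv_mem' := by
    rintro a ⟨σ, h1, h2⟩
    refine ⟨σ.symm, fun u v => ?_, fun x => ?_⟩
    · rw [LinearEquiv.symm_apply_eq]; simp [h1]
    · rw [LinearEquiv.symm_apply_eq, h2, Matrix.mulVec_mulVec, ← SO7.mat_mul]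
      simp [SO7.mat_one]

end Groups

/-! ### Root subgroups -/

section Roots

variable {k : Type u} [Field k]

/-- The matrix of `x_α(r)`, `α` the short simple root. -/
def matA (r : k) : Matrix (Fin 7) (Fin 7) k :=
  !![1, 0, 0, 0, 0, 0, 0;
     0, 1, 0, -2 * r, 0, -r ^ 2, 0;
     0, 0, 1, 0, 0, 0, 0;
     0, 0, 0, 1, 0, r, 0;
     -r, 0, 0, 0, 1, 0, 0;
     0, 0, 0, 0, 0, 1, 0;
     0, 0, -r, 0, 0, 0, 1]

/-- The matrix of `x_β(r)`, `β` the long simple root. -/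
def matB (r : k) : Matrix (Fin 7) (Fin 7) k :=
  !![1, r, 0, 0, 0, 0, 0;
     0, 1, 0, 0, 0, 0, 0;
     0, 0, 1, 0, 0, 0, 0;
     0, 0, 0, 1, 0, 0, 0;
     0, 0, 0, 0, 1, 0, 0;
     0, 0, 0, 0, 0, 1, -r;
     0, 0, 0, 0, 0, 0, 1]

/-- The matrix of `x_{α+β}(r)`. -/
def matAB (r : k) : Matrix (Fin 7) (Fin 7) k :=
  !![1, 0, 0, -2 * r, 0, 0, -r ^ 2;
     0, 1, 0, 0, 0, 0, 0;
     0, 0, 1, 0, 0, 0, 0;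
     0, 0, 0, 1, 0, 0, r;
     0, r, 0, 0, 1, 0, 0;
     0, 0, r, 0, 0, 1, 0;
     0, 0, 0, 0, 0, 0, 1]

/-- The matrix of `x_{2α+β}(r)`. -/
def mat2AB (r : k) : Matrix (Fin 7) (Fin 7) k :=
  !![1, 0, 0, 0, 0, -r, 0;
     0, 1, 0, 0, 0, 0, r;
     0, 0, 1, 0, 0, 0, 0;
     0, 0, -r, 1, 0, 0, 0;
     0, 0, r ^ 2, -2 * r, 1, 0, 0;
     0, 0, 0, 0, 0, 1, 0;
     0, 0, 0, 0, 0, 0, 1]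

/-- The matrix of `x_{3α+β}(r)`. -/
def mat3AB (r : k) : Matrix (Fin 7) (Fin 7) k :=
  !![1, 0, 0, 0, 0, 0, 0;
     0, 1, r, 0, 0, 0, 0;
     0, 0, 1, 0, 0, 0, 0;
     0, 0, 0, 1, 0, 0, 0;
     0, 0, 0, 0, 1, r, 0;
     0, 0, 0, 0, 0, 1, 0;
     0, 0, 0, 0, 0, 0, 1]

/-- The matrix of `x_{3α+2β}(r)`. -/
def mat3A2B (r : k) : Matrix (Fin 7) (Fin 7) k :=
  !![1, 0, r, 0, 0, 0, 0;
     0, 1, 0, 0, 0, 0, 0;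
     0, 0, 1, 0, 0, 0, 0;
     0, 0, 0, 1, 0, 0, 0;
     0, 0, 0, 0, 1, 0, r;
     0, 0, 0, 0, 0, 1, 0;
     0, 0, 0, 0, 0, 0, 1]

/-- The matrix of the Weyl element `w₂ = h(1,-1) w_α w_β w_α w_β⁻¹ w_α⁻¹`. -/
def matW2 : Matrix (Fin 7) (Fin 7) k :=
  !![0, 0, 0, 0, 0, -1, 0;
     0, 0, 0, 0, 0, 0, -1;
     0, 0, 0, 0, -1, 0, 0;
     0, 0, 0, -1, 0, 0, 0;
     0, 0, -1, 0, 0, 0, 0;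
     -1, 0, 0, 0, 0, 0, 0;
     0, -1, 0, 0, 0, 0, 0]

/-- The element of `SO₇(k)` with a given matrix. -/
def SO7.mk (m : Matrix (Fin 7) (Fin 7) k) (h : mᵀ * formQ k * m = formQ k) (h' : m.det = 1) :
    SO7 k :=
  ⟨GeneralLinearGroup.mkOfDetNeZero m (by rw [h']; exact one_ne_zero), h, h'⟩

theorem SO7.mat_mk (m : Matrix (Fin 7) (Fin 7) k) (h h') : SO7.mat (SO7.mk m h h') = m := rfl

end Roots

/-! ### The root elements lie in `G₂(k)` -/

section RootProofs

variable {k : Type u} [Field k]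

/-- The position of each basis vector in an order for which positive root elements are upper
triangular. -/
def rootOrd : Fin 7 → Fin 7 := ![1, 2, 6, 3, 0, 4, 5]

/-- Upper triangular unipotent matrices for the order `rootOrd`. -/
def IsUnip (m : Matrix (Fin 7) (Fin 7) k) : Prop :=
  ∀ i j, (i = j → m i j = 1) ∧ (rootOrd j < rootOrd i → m i j = 0)

theorem IsUnip.zero {m : Matrix (Fin 7) (Fin 7) k} (h : IsUnip m) (i j : Fin 7)
    (hij : rootOrd j < rootOrd i) : m i j = 0 := (h i j).2 hij

theorem rootOrd_injective : Function.Injective rootOrd := by decide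

theorem IsUnip.det {m : Matrix (Fin 7) (Fin 7) k} (h : IsUnip m) : m.det = 1 := by
  have hb : BlockTriangular m rootOrd := fun i j hij => (h i j).2 hij
  rw [hb.det_fintype]
  refine Finset.prod_eq_one fun a _ => ?_
  have hs : Subsingleton {i // rootOrd i = a} :=
    ⟨fun x y => Subtype.ext (rootOrd_injective (x.2.trans y.2.symm))⟩
  have : m.toSquareBlock rootOrd a = 1 := by
    ext i j
    obtain rfl := Subsingleton.elim i j
    simpa [toSquareBlock_def] using (h i i).1 rfl
  rw [this, det_one]

theorem unip_matA (r : k) : IsUnip (matA r) := by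
  intro i j
  fin_cases i <;> fin_cases j <;> simp [matA, rootOrd]
theorem unip_matB (r : k) : IsUnip (matB r) := by
  intro i j
  fin_cases i <;> fin_cases j <;> simp [matB, rootOrd]
theorem unip_matAB (r : k) : IsUnip (matAB r) := by
  intro i j
  fin_cases i <;> fin_cases j <;> simp [matAB, rootOrd]
theorem unip_mat2AB (r : k) : IsUnip (mat2AB r) := by
  intro i j
  fin_cases i <;> fin_cases j <;> simp [mat2AB, rootOrd]
theorem unip_mat3AB (r : k) : IsUnip (mat3AB r) := by
  intro i j
  fin_cases i <;> fin_cases j <;> simp [mat3AB, rootOrd]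
theorem unip_mat3A2B (r : k) : IsUnip (mat3A2B r) := by
  intro i j
  fin_cases i <;> fin_cases j <;> simp [mat3A2B, rootOrd]

theorem mulVec_matA (r : k) (x : Fin 7 → k) : matA r *ᵥ x =
    ![x 0, x 1 - 2 * r * x 3 - r ^ 2 * x 5, x 2, x 3 + r * x 5, x 4 - r * x 0, x 5, x 6 - r * x 2] := by
  ext i
  fin_cases i <;> simp [matA, Matrix.mulVec, dotProduct, Fin.sum_univ_succ] <;> ring

theorem mulVec_matB (r : k) (x : Fin 7 → k) : matB r *ᵥ x =
    ![x 0 + r * x 1, x 1, x 2, x 3, x 4, x 5 - r * x 6, x 6] := by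
  ext i
  fin_cases i <;> simp [matB, Matrix.mulVec, dotProduct, Fin.sum_univ_succ] <;> ring

theorem mulVec_matAB (r : k) (x : Fin 7 → k) : matAB r *ᵥ x =
    ![x 0 - 2 * r * x 3 - r ^ 2 * x 6, x 1, x 2, x 3 + r * x 6, x 4 + r * x 1, x 5 + r * x 2, x 6] := by
  ext i
  fin_cases i <;> simp [matAB, Matrix.mulVec, dotProduct, Fin.sum_univ_succ] <;> ring

theorem mulVec_mat2AB (r : k) (x : Fin 7 → k) : mat2AB r *ᵥ x =
    ![x 0 - r * x 5, x 1 + r * x 6, x 2, x 3 - r * x 2, x 4 + r ^ 2 * x 2 - 2 * r * x 3, x 5, x 6] := by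
  ext i
  fin_cases i <;> simp [mat2AB, Matrix.mulVec, dotProduct, Fin.sum_univ_succ] <;> ring

theorem mulVec_mat3AB (r : k) (x : Fin 7 → k) : mat3AB r *ᵥ x =
    ![x 0, x 1 + r * x 2, x 2, x 3, x 4 + r * x 5, x 5, x 6] := by
  ext i
  fin_cases i <;> simp [mat3AB, Matrix.mulVec, dotProduct, Fin.sum_univ_succ] <;> ring

theorem mulVec_mat3A2B (r : k) (x : Fin 7 → k) : mat3A2B r *ᵥ x =
    ![x 0 + r * x 2, x 1, x 2, x 3, x 4 + r * x 6, x 5, x 6] := by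
  ext i
  fin_cases i <;> simp [mat3A2B, Matrix.mulVec, dotProduct, Fin.sum_univ_succ] <;> ring

theorem mulVec_matW2 (x : Fin 7 → k) : matW2 *ᵥ x =
    ![-x 5, -x 6, -x 4, -x 3, -x 2, -x 0, -x 1] := by
  ext i
  fin_cases i <;> simp [matW2, Matrix.mulVec, dotProduct, Fin.sum_univ_succ]

theorem formQ_apply (x y : Fin 7 → k) : x ⬝ᵥ (formQ k *ᵥ y) =
    x 0 * y 6 + x 1 * y 5 - x 2 * y 4 + 2 * x 3 * y 3 - x 4 * y 2 + x 5 * y 1 + x 6 * y 0 := by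
  simp [formQ, Matrix.mulVec, dotProduct, Fin.sum_univ_succ]; ring

theorem form_of {m : Matrix (Fin 7) (Fin 7) k}
    (h : ∀ x y, (m *ᵥ x) ⬝ᵥ (formQ k *ᵥ (m *ᵥ y)) = x ⬝ᵥ (formQ k *ᵥ y)) :
    mᵀ * formQ k * m = formQ k := by
  ext i j
  have := h (Pi.single i 1) (Pi.single j 1)
  rw [← Matrix.vecMul_transpose, ← Matrix.dotProduct_mulVec] at this
  rw [Matrix.mulVec_mulVec, Matrix.mulVec_mulVec] at this
  simpa only [single_one_dotProduct, Matrix.mulVec_single_one, Matrix.col_apply] using this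

theorem form_matA (r : k) : (matA r)ᵀ * formQ k * matA r = formQ k := by
  refine form_of fun x y => ?_
  simp only [formQ_apply, mulVec_matA]
  simp; ring

theorem form_matB (r : k) : (matB r)ᵀ * formQ k * matB r = formQ k := by
  refine form_of fun x y => ?_
  simp only [formQ_apply, mulVec_matB]
  simp; ring

theorem form_matAB (r : k) : (matAB r)ᵀ * formQ k * matAB r = formQ k := by
  refine form_of fun x y => ?_
  simp only [formQ_apply, mulVec_matAB]
  simp; ring

theorem form_mat2AB (r : k) : (mat2AB r)ᵀ * formQ k * mat2AB r = formQ k := by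
  refine form_of fun x y => ?_
  simp only [formQ_apply, mulVec_mat2AB]
  simp; ring

theorem form_mat3AB (r : k) : (mat3AB r)ᵀ * formQ k * mat3AB r = formQ k := by
  refine form_of fun x y => ?_
  simp only [formQ_apply, mulVec_mat3AB]
  simp; ring

theorem form_mat3A2B (r : k) : (mat3A2B r)ᵀ * formQ k * mat3A2B r = formQ k := by
  refine form_of fun x y => ?_
  simp only [formQ_apply, mulVec_mat3A2B]
  simp; ring

theorem form_matW2 : (matW2 : Matrix (Fin 7) (Fin 7) k)ᵀ * formQ k * matW2 = formQ k := by
  refine form_of fun x y => ?_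
  simp only [formQ_apply, mulVec_matW2]
  simp; ring

theorem det_matW2 : (matW2 : Matrix (Fin 7) (Fin 7) k).det = 1 := by
  simp [matW2, Matrix.det_succ_row_zero, Fin.sum_univ_succ, Fin.succAbove]; ring

/-- The pure part of the product of two pure octonions, in coordinates. -/
def pureMul (x y : Fin 7 → k) : Fin 7 → k :=
  ![x 0 * y 3 - x 3 * y 0 + x 4 * y 5 - x 5 * y 4,
    x 1 * y 3 - x 3 * y 1 - x 4 * y 6 + x 6 * y 4,
    x 2 * y 3 - x 3 * y 2 - x 5 * y 6 + x 6 * y 5,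
    (x 6 * y 0 - x 0 * y 6 + x 5 * y 1 - x 1 * y 5 + x 2 * y 4 - x 4 * y 2) / 2,
    x 0 * y 1 - x 1 * y 0 + x 3 * y 4 - x 4 * y 3,
    x 0 * y 2 - x 2 * y 0 + x 3 * y 5 - x 5 * y 3,
    x 2 * y 1 - x 1 * y 2 + x 3 * y 6 - x 6 * y 3]

/-- The coordinates of the pure part of an octonion. -/
def octCoord (u : Oct k) : Fin 7 → k :=
  ![u.1.imI + u.2.imI, u.1.imJ + u.2.imJ, u.1.imK + u.2.imK, u.2.re,
    u.1.imK - u.2.imK, u.1.imJ - u.2.imJ, u.1.imI - u.2.imI]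

theorem pureOct_eq [NeZero (2 : k)] (x : Fin 7 → k) :
    pureOct x = (⟨0, (x 0 + x 6) / 2, (x 1 + x 5) / 2, (x 2 + x 4) / 2⟩,
      ⟨x 3, (x 0 - x 6) / 2, (x 1 - x 5) / 2, (x 2 - x 4) / 2⟩) := by
  have h2 : (2 : k) ≠ 0 := NeZero.ne _
  simp only [pureOct, pureBasis, octMul, octE1, octE2, octE3, octXp, octXm, Fin.sum_univ_succ]
  ext <;> simp <;> field_simp <;> ring

theorem octCoord_pureOct [NeZero (2 : k)] (x : Fin 7 → k) : octCoord (pureOct x) = x := by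
  have h2 : (2 : k) ≠ 0 := NeZero.ne _
  rw [pureOct_eq]
  ext i
  fin_cases i <;> simp [octCoord] <;> field_simp <;> ring

theorem pureOct_octCoord [NeZero (2 : k)] (u : Oct k) :
    (⟨u.1.re, 0, 0, 0⟩, 0) + pureOct (octCoord u) = u := by
  have h2 : (2 : k) ≠ 0 := NeZero.ne _
  rw [pureOct_eq]
  ext <;> simp [octCoord] <;> field_simp <;> ring

/-- The linear map of the octonions fixing `1` and given on pure octonions by a matrix. -/
def octExt (m : Matrix (Fin 7) (Fin 7) k) (u : Oct k) : Oct k :=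
  (⟨u.1.re, 0, 0, 0⟩, 0) + pureOct (m *ᵥ octCoord u)

theorem octExt_octExt [NeZero (2 : k)] (m n : Matrix (Fin 7) (Fin 7) k) (u : Oct k) :
    octExt m (octExt n u) = octExt (m * n) u := by
  have h1 : octCoord (octExt n u) = n *ᵥ octCoord u := by
    have : octCoord (octExt n u) = octCoord (pureOct (n *ᵥ octCoord u)) := by
      simp [octExt, octCoord]
    rw [this, octCoord_pureOct]
  have h2 : (octExt n u).1.re = u.1.re := by simp [octExt, pureOct_eq]
  rw [octExt, h1, h2, Matrix.mulVec_mulVec]; rfl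

theorem octExt_one [NeZero (2 : k)] (u : Oct k) : octExt 1 u = u := by
  rw [octExt, Matrix.one_mulVec, pureOct_octCoord]

theorem pureOct_add (x y : Fin 7 → k) : pureOct (x + y) = pureOct x + pureOct y := by
  simp [pureOct, add_smul, Finset.sum_add_distrib]

theorem pureOct_smul (c : k) (x : Fin 7 → k) : pureOct (c • x) = c • pureOct x := by
  simp [pureOct, mul_smul, Finset.smul_sum]

/-- `octExt` of an invertible matrix as a linear equivalence. -/
def octExtEquiv [NeZero (2 : k)] (g : GL (Fin 7) k) : Oct k ≃ₗ[k] Oct k where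
  toFun := octExt g.val
  invFun := octExt g⁻¹.val
  left_inv u := by rw [octExt_octExt, g.inv_mul, octExt_one]
  right_inv u := by rw [octExt_octExt, g.mul_inv, octExt_one]
  map_add' u v := by
    have : octCoord (u + v) = octCoord u + octCoord v := by
      ext i; fin_cases i <;> simp [octCoord] <;> ring
    simp only [octExt, this, Matrix.mulVec_add, pureOct_add]
    have h : ((⟨(u + v).1.re, 0, 0, 0⟩, 0) : Oct k)
        = (⟨u.1.re, 0, 0, 0⟩, 0) + (⟨v.1.re, 0, 0, 0⟩, 0) := by
      ext <;> simp
    rw [h]; abel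
  map_smul' c u := by
    have : octCoord (c • u) = c • octCoord u := by
      ext i; fin_cases i <;> simp [octCoord] <;> ring
    simp only [octExt, this, Matrix.mulVec_smul, pureOct_smul, RingHom.id_apply, smul_add]
    congr 1
    ext <;> simp

theorem octMul_eq [NeZero (2 : k)] (s t : k) (x y : Fin 7 → k) :
    octMul ((⟨s, 0, 0, 0⟩, 0) + pureOct x) ((⟨t, 0, 0, 0⟩, 0) + pureOct y)
      = (⟨s * t + (x ⬝ᵥ (formQ k *ᵥ y)) / 2, 0, 0, 0⟩, 0)
        + pureOct (s • y + t • x + pureMul x y) := by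
  have h2 : (2 : k) ≠ 0 := NeZero.ne _
  simp only [pureOct_eq, octMul]
  ext <;> simp [pureMul, formQ, dotProduct, Matrix.mulVec, Fin.sum_univ_succ] <;> field_simp <;>
    ring

theorem mem_G2_of [NeZero (2 : k)] (g : SO7 k)
    (h : ∀ x y, pureMul (SO7.mat g *ᵥ x) (SO7.mat g *ᵥ y) = SO7.mat g *ᵥ pureMul x y) :
    g ∈ G2 k := by
  have key : ∀ (s : k) (x : Fin 7 → k), octExt (SO7.mat g) ((⟨s, 0, 0, 0⟩, 0) + pureOct x)
      = (⟨s, 0, 0, 0⟩, 0) + pureOct (SO7.mat g *ᵥ x) := by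
    intro s x
    have h1 : octCoord ((⟨s, 0, 0, 0⟩, 0) + pureOct x) = x := by
      have : octCoord ((⟨s, 0, 0, 0⟩, 0) + pureOct x) = octCoord (pureOct x) := by
        simp [octCoord]
      rw [this, octCoord_pureOct]
    rw [octExt, h1]
    simp [pureOct_eq]
  refine ⟨octExtEquiv g.val, fun u v => ?_, fun x => ?_⟩
  · change octExt (SO7.mat g) _ = octMul (octExt (SO7.mat g) _) (octExt (SO7.mat g) _)
    rw [← pureOct_octCoord u, ← pureOct_octCoord v, octMul_eq, key, key, key, octMul_eq]
    have hq : (SO7.mat g *ᵥ octCoord u) ⬝ᵥ (formQ k *ᵥ (SO7.mat g *ᵥ octCoord v))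
        = octCoord u ⬝ᵥ (formQ k *ᵥ octCoord v) := by
      have hg : (SO7.mat g)ᵀ * formQ k * SO7.mat g = formQ k := g.2.1
      conv_rhs => rw [← hg]
      simp only [← Matrix.mulVec_mulVec]
      rw [Matrix.dotProduct_mulVec _ (SO7.mat g)ᵀ, Matrix.vecMul_transpose]
    rw [hq, h]
    simp only [Matrix.mulVec_add, Matrix.mulVec_smul]
  · change octExt (SO7.mat g) _ = _
    have := key 0 x
    have h0 : ((⟨0, 0, 0, 0⟩, 0) : Oct k) = 0 := rfl
    simpa only [h0, zero_add] using this

end RootProofs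

section RootElements

variable {k : Type u} [Field k] [NeZero (2 : k)]

/-- The root element `x_α(r)` of `G₂(k)`. -/
def xA (r : k) : G2 k := ⟨SO7.mk (matA r) (form_matA r) (unip_matA r).det, by
  have h2 : (2 : k) ≠ 0 := NeZero.ne _
  refine mem_G2_of _ fun x y => ?_
  rw [SO7.mat_mk, mulVec_matA, mulVec_matA, mulVec_matA]
  ext i
  fin_cases i <;> simp [pureMul] <;> field_simp <;> ring⟩

/-- The root element `x_β(r)` of `G₂(k)`. -/
def xB (r : k) : G2 k := ⟨SO7.mk (matB r) (form_matB r) (unip_matB r).det, by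
  have h2 : (2 : k) ≠ 0 := NeZero.ne _
  refine mem_G2_of _ fun x y => ?_
  rw [SO7.mat_mk, mulVec_matB, mulVec_matB, mulVec_matB]
  ext i
  fin_cases i <;> simp [pureMul] <;> field_simp <;> ring⟩

/-- The root element `x_{α+β}(r)` of `G₂(k)`. -/
def xAB (r : k) : G2 k := ⟨SO7.mk (matAB r) (form_matAB r) (unip_matAB r).det, by
  have h2 : (2 : k) ≠ 0 := NeZero.ne _
  refine mem_G2_of _ fun x y => ?_
  rw [SO7.mat_mk, mulVec_matAB, mulVec_matAB, mulVec_matAB]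
  ext i
  fin_cases i <;> simp [pureMul] <;> field_simp <;> ring⟩

/-- The root element `x_{2α+β}(r)` of `G₂(k)`. -/
def x2AB (r : k) : G2 k := ⟨SO7.mk (mat2AB r) (form_mat2AB r) (unip_mat2AB r).det, by
  have h2 : (2 : k) ≠ 0 := NeZero.ne _
  refine mem_G2_of _ fun x y => ?_
  rw [SO7.mat_mk, mulVec_mat2AB, mulVec_mat2AB, mulVec_mat2AB]
  ext i
  fin_cases i <;> simp [pureMul] <;> field_simp <;> ring⟩

/-- The root element `x_{3α+β}(r)` of `G₂(k)`. -/
def x3AB (r : k) : G2 k := ⟨SO7.mk (mat3AB r) (form_mat3AB r) (unip_mat3AB r).det, by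
  have h2 : (2 : k) ≠ 0 := NeZero.ne _
  refine mem_G2_of _ fun x y => ?_
  rw [SO7.mat_mk, mulVec_mat3AB, mulVec_mat3AB, mulVec_mat3AB]
  ext i
  fin_cases i <;> simp [pureMul] <;> field_simp <;> ring⟩

/-- The root element `x_{3α+2β}(r)` of `G₂(k)`. -/
def x3A2B (r : k) : G2 k := ⟨SO7.mk (mat3A2B r) (form_mat3A2B r) (unip_mat3A2B r).det, by
  have h2 : (2 : k) ≠ 0 := NeZero.ne _
  refine mem_G2_of _ fun x y => ?_
  rw [SO7.mat_mk, mulVec_mat3A2B, mulVec_mat3A2B, mulVec_mat3A2B]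
  ext i
  fin_cases i <;> simp [pureMul] <;> field_simp <;> ring⟩

end RootElements

/-! ### Unipotent subgroups of `G₂(k)` and the generic character -/

section Unipotent

variable (k : Type u) [Field k] [NeZero (2 : k)]

/-- The maximal unipotent subgroup `U`, generated by all positive root subgroups. -/
def U : Subgroup (G2 k) :=
  Subgroup.closure (Set.range xA ∪ Set.range xB ∪ Set.range xAB ∪ Set.range x2AB ∪
    Set.range x3AB ∪ Set.range x3A2B)

/-- The unipotent radical `V` of the maximal parabolic subgroup `P` whose Levi subgroup contains
the root subgroup of `β`. -/
def V : Subgroup (G2 k) :=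
  Subgroup.closure (Set.range xA ∪ Set.range xAB ∪ Set.range x2AB ∪ Set.range x3AB ∪
    Set.range x3A2B)

/-- The unipotent radical `V'` of the maximal parabolic subgroup `P'` whose Levi subgroup contains
the root subgroup of `α`. -/
def V' : Subgroup (G2 k) :=
  Subgroup.closure (Set.range xB ∪ Set.range xAB ∪ Set.range x2AB ∪ Set.range x3AB ∪
    Set.range x3A2B)

/-- The subgroup `U_H`, generated by the root subgroups of `β, 2α+β, 3α+β, 3α+2β`. -/
def UH : Subgroup (G2 k) :=
  Subgroup.closure (Set.range xB ∪ Set.range x2AB ∪ Set.range x3AB ∪ Set.range x3A2B)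

variable {k}

/-- The matrix of an element of `G₂(k)`. -/
def G2.mat (g : G2 k) : Matrix (Fin 7) (Fin 7) k := SO7.mat g.val

theorem G2.mat_mul (g h : G2 k) : G2.mat (g * h) = G2.mat g * G2.mat h := SO7.mat_mul _ _

theorem IsUnip.mul {m n : Matrix (Fin 7) (Fin 7) k} (hm : IsUnip m) (hn : IsUnip n) :
    IsUnip (m * n) := by
  have hb : BlockTriangular (m * n) rootOrd :=
    BlockTriangular.mul (fun i j h => (hm i j).2 h) (fun i j h => (hn i j).2 h)
  refine fun i j => ⟨?_, fun h => hb h⟩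
  rintro rfl
  rw [Matrix.mul_apply, Finset.sum_eq_single i, (hm i i).1 rfl, (hn i i).1 rfl, one_mul]
  · intro l _ hl
    rcases lt_or_gt_of_ne (rootOrd_injective.ne hl) with h | h
    · rw [(hm i l).2 h, zero_mul]
    · rw [(hn l i).2 h, mul_zero]
  · simp

theorem IsUnip.of_mul_eq_one {m n : Matrix (Fin 7) (Fin 7) k} (hm : IsUnip m) (h : m * n = 1) :
    IsUnip n := by
  have hb : BlockTriangular n rootOrd := by
    haveI : Invertible m := invertibleOfRightInverse m n h
    have := blockTriangular_inv_of_blockTriangular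
      (show BlockTriangular m rootOrd from fun i j h => (hm i j).2 h)
    rwa [inv_eq_right_inv h] at this
  refine fun i j => ⟨?_, fun h => hb h⟩
  rintro rfl
  have h1 := congrFun (congrFun h i) i
  rw [Matrix.mul_apply, Finset.sum_eq_single i, (hm i i).1 rfl, one_mul, one_apply_eq] at h1
  · exact h1
  · intro l _ hl
    rcases lt_or_gt_of_ne (rootOrd_injective.ne hl) with h | h
    · rw [(hm i l).2 h, zero_mul]
    · rw [hb h, mul_zero]
  · simp

theorem isUnip_of_mem_U {g : G2 k} (hg : g ∈ U k) : IsUnip (G2.mat g) := by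
  induction hg using Subgroup.closure_induction with
  | mem x hx =>
    rcases hx with ((((⟨r, rfl⟩ | ⟨r, rfl⟩) | ⟨r, rfl⟩) | ⟨r, rfl⟩) | ⟨r, rfl⟩) | ⟨r, rfl⟩
    exacts [unip_matA r, unip_matB r, unip_matAB r, unip_mat2AB r, unip_mat3AB r, unip_mat3A2B r]
  | one =>
    intro i j
    have : G2.mat (1 : G2 k) = 1 := SO7.mat_one
    rw [this]
    refine ⟨fun h => h ▸ one_apply_eq i, fun h => one_apply_ne ?_⟩
    rintro rfl
    exact lt_irrefl _ h
  | mul x y _ _ hx hy => rw [G2.mat_mul]; exact hx.mul hy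
  | inv x _ hx =>
    refine hx.of_mul_eq_one ?_
    rw [← G2.mat_mul, mul_inv_cancel]; exact SO7.mat_one

/-- The character `ψ_U` of `U` with `ψ_U(x_α(r)) = ψ_U(x_β(r)) = ψ(r)` which is trivial on the
other positive root subgroups (see the lemmas below). -/
def psiU (ψ : AddChar k ℂ) : U k →* ℂ where
  toFun u := ψ (G2.mat u.val 3 5 + G2.mat u.val 0 1)
  map_one' := by
    have h : G2.mat ((1 : U k) : G2 k) = 1 := SO7.mat_one
    rw [h, one_apply_ne (by decide), one_apply_ne (by decide), add_zero, AddChar.map_zero_eq_one]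
  map_mul' u v := by
    rw [← AddChar.map_add_eq_mul, Subgroup.coe_mul, G2.mat_mul]
    have hu := isUnip_of_mem_U u.2
    have hv := isUnip_of_mem_U v.2
    generalize G2.mat u.val = m at *
    generalize G2.mat v.val = n at *
    have h1 : (m * n) 3 5 = m 3 5 + n 3 5 := by
      rw [Matrix.mul_apply, Fin.sum_univ_seven, (hu.zero 3 0 (by decide)),
        (hu.zero 3 1 (by decide)), (hu.zero 3 4 (by decide)),
        (hv.zero 2 5 (by decide)), (hv.zero 6 5 (by decide)),
        (hu 3 3).1 rfl, (hv 5 5).1 rfl]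
      ring
    have h2 : (m * n) 0 1 = m 0 1 + n 0 1 := by
      rw [Matrix.mul_apply, Fin.sum_univ_seven, (hu.zero 0 4 (by decide)),
        (hv.zero 2 1 (by decide)), (hv.zero 3 1 (by decide)),
        (hv.zero 5 1 (by decide)), (hv.zero 6 1 (by decide)),
        (hu 0 0).1 rfl, (hv 1 1).1 rfl]
      ring
    rw [h1, h2]
    congr 1
    ring

theorem psiU_xA (ψ : AddChar k ℂ) (r : k) (h : xA r ∈ U k) : psiU ψ ⟨xA r, h⟩ = ψ r := by
  change ψ (matA r 3 5 + matA r 0 1) = _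
  simp [matA]
theorem psiU_xB (ψ : AddChar k ℂ) (r : k) (h : xB r ∈ U k) : psiU ψ ⟨xB r, h⟩ = ψ r := by
  change ψ (matB r 3 5 + matB r 0 1) = _
  simp [matB]
theorem psiU_xAB (ψ : AddChar k ℂ) (r : k) (h : xAB r ∈ U k) : psiU ψ ⟨xAB r, h⟩ = 1 := by
  change ψ (matAB r 3 5 + matAB r 0 1) = _
  simp [matAB]
theorem psiU_x2AB (ψ : AddChar k ℂ) (r : k) (h : x2AB r ∈ U k) : psiU ψ ⟨x2AB r, h⟩ = 1 := by
  change ψ (mat2AB r 3 5 + mat2AB r 0 1) = _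
  simp [mat2AB]
theorem psiU_x3AB (ψ : AddChar k ℂ) (r : k) (h : x3AB r ∈ U k) : psiU ψ ⟨x3AB r, h⟩ = 1 := by
  change ψ (mat3AB r 3 5 + mat3AB r 0 1) = _
  simp [mat3AB]
theorem psiU_x3A2B (ψ : AddChar k ℂ) (r : k) (h : x3A2B r ∈ U k) :
    psiU ψ ⟨x3A2B r, h⟩ = 1 := by
  change ψ (mat3A2B r 3 5 + mat3A2B r 0 1) = _
  simp [mat3A2B]

end Unipotent

/-! ### Generic and cuspidal representations, Whittaker models -/

section Representations

variable {k : Type u} [Field k] [NeZero (2 : k)]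
variable {X : Type*} [AddCommGroup X] [Module ℂ X]

/-- `l` belongs to `Hom_U(ρ, ψ_U)`. -/
def IsWhittaker (ρ : Representation ℂ (G2 k) X) (ψ : AddChar k ℂ) (l : X →ₗ[ℂ] ℂ) : Prop :=
  ∀ (u : U k) (v : X), l (ρ u.val v) = psiU ψ u * l v

/-- `ρ` is `ψ`-generic: `Hom_U(ρ, ψ_U) ≠ 0`. -/
def IsGeneric (ρ : Representation ℂ (G2 k) X) (ψ : AddChar k ℂ) : Prop :=
  ∃ l : X →ₗ[ℂ] ℂ, l ≠ 0 ∧ IsWhittaker ρ ψ l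

/-- The Whittaker model of `ρ`: the functions `g ↦ l(ρ(g) v)`, where `l` is a nonzero Whittaker
functional (which is unique up to a scalar when `ρ` is irreducible). -/
def whittakerModel (ρ : Representation ℂ (G2 k) X) (ψ : AddChar k ℂ) : Set (G2 k → ℂ) :=
  {W | ∃ l : X →ₗ[ℂ] ℂ, l ≠ 0 ∧ IsWhittaker ρ ψ l ∧ ∃ v, W = fun g => l (ρ g v)}

/-- `ρ` is cuspidal: its Jacquet modules for the unipotent radicals of the three standard proper
parabolic subgroups vanish (every proper parabolic subgroup is conjugate to one of them). -/
def IsCuspidal (ρ : Representation ℂ (G2 k) X) : Prop :=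
  ∀ N : Subgroup (G2 k), N = V k ∨ N = V' k ∨ N = U k →
    Subsingleton (Representation.Coinvariants (ρ.comp N.subtype))

end Representations

section GL2

variable {k : Type u} [Field k]

/-- The upper triangular unipotent element of `GL₂(k)` with entry `x`. -/
def nGL2 (x : k) : GL (Fin 2) k :=
  GeneralLinearGroup.mkOfDetNeZero !![1, x; 0, 1] (by simp)

/-- The element `d₁ = diag(-1, 1)` of `GL₂(k)`. -/
def d1 : GL (Fin 2) k :=
  GeneralLinearGroup.mkOfDetNeZero !![-1, 0; 0, 1] (by simp)

variable (k) in
/-- The antidiagonal matrix with entries `1`. -/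
def antidiag2 : Matrix (Fin 2) (Fin 2) k := !![0, 1; 1, 0]

theorem antidiag2_mul_self : antidiag2 k * antidiag2 k = 1 := by
  ext i j; fin_cases i <;> fin_cases j <;> simp [antidiag2]

/-- `a* = w ᵗa⁻¹ w`, `w` the antidiagonal matrix. -/
def glStar (a : GL (Fin 2) k) : GL (Fin 2) k where
  val := antidiag2 k * a⁻¹.valᵀ * antidiag2 k
  inv := antidiag2 k * a.valᵀ * antidiag2 k
  val_inv := by
    calc _ = antidiag2 k * a⁻¹.valᵀ * (antidiag2 k * antidiag2 k) * a.valᵀ * antidiag2 k := by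
          simp only [Matrix.mul_assoc]
      _ = antidiag2 k * (a⁻¹.valᵀ * a.valᵀ) * antidiag2 k := by
          rw [antidiag2_mul_self]; simp only [Matrix.mul_assoc, Matrix.mul_one, Matrix.one_mul]
      _ = 1 := by
          rw [← transpose_mul, a.mul_inv, transpose_one, Matrix.mul_one, antidiag2_mul_self]
  inv_val := by
    calc _ = antidiag2 k * a.valᵀ * (antidiag2 k * antidiag2 k) * a⁻¹.valᵀ * antidiag2 k := by
          simp only [Matrix.mul_assoc]
      _ = antidiag2 k * (a.valᵀ * a⁻¹.valᵀ) * antidiag2 k := by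
          rw [antidiag2_mul_self]; simp only [Matrix.mul_assoc, Matrix.mul_one, Matrix.one_mul]
      _ = 1 := by
          rw [← transpose_mul, a.inv_mul, transpose_one, Matrix.mul_one, antidiag2_mul_self]

variable {Y : Type*} [AddCommGroup Y] [Module ℂ Y]

/-- `Λ` belongs to `Hom_N(τ, ψ)`, `N` the upper triangular unipotent subgroup of `GL₂(k)`. -/
def IsWhittakerGL2 (τ : Representation ℂ (GL (Fin 2) k) Y) (ψ : AddChar k ℂ)
    (Λ : Y →ₗ[ℂ] ℂ) : Prop :=
  ∀ (x : k) (v : Y), Λ (τ (nGL2 x) v) = ψ x * Λ v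

/-- `τ` is `ψ`-generic: `Hom_N(τ, ψ) ≠ 0`. -/
def IsGenericGL2 (τ : Representation ℂ (GL (Fin 2) k) Y) (ψ : AddChar k ℂ) : Prop :=
  ∃ Λ : Y →ₗ[ℂ] ℂ, Λ ≠ 0 ∧ IsWhittakerGL2 τ ψ Λ

end GL2

/-! ### The induced representation, the intertwining operator and the zeta sum -/

section Zeta

variable {k : Type u} [Field k]

/-- The block of each row or column, for the block sizes `2, 3, 2`. -/
def blk : Fin 7 → Fin 3 := ![0, 0, 1, 1, 1, 2, 2]

variable (k) in
/-- The parabolic subgroup of `SO₇(k)` with Levi subgroup `GL₂(k) × SO₃(k)`: the block upper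
triangular elements. -/
def Ptilde : Set (SO7 k) := {p | BlockTriangular (SO7.mat p) blk}

variable (k) in
/-- The unipotent radical of `Ptilde`: block upper triangular with identity diagonal blocks. -/
def Utilde : Set (SO7 k) :=
  {u | BlockTriangular (SO7.mat u) blk ∧
    ∀ i j, blk i = blk j → SO7.mat u i j = (1 : Matrix (Fin 7) (Fin 7) k) i j}

/-- The `GL₂(k)`-part of an element of `Ptilde`, as a matrix. -/
def gl2Block (p : SO7 k) : Matrix (Fin 2) (Fin 2) k := (SO7.mat p).submatrix ![0, 1] ![0, 1]

variable {Y : Type*} [AddCommGroup Y] [Module ℂ Y]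

/-- `ξ` is a section of `I(τ)`, the representation of `SO₇(k)` induced from the representation
`τ ⊗ 1` of `Ptilde`, on which the `SO₃(k)`-part and the unipotent radical act trivially. -/
def IsSection (τ : Representation ℂ (GL (Fin 2) k) Y) (ξ : SO7 k → Y) : Prop :=
  ∀ p ∈ Ptilde k, ∀ x : GL (Fin 2) k, gl2Block p = x.val → ∀ g, ξ (p * g) = τ x (ξ g)

/-- The space `I(𝒲(τ, ψ))` of functions `f_ξ(g, a) = Λ(τ(a) ξ(g))`, for sections `ξ` of `I(τ)`,
where `Λ` is a nonzero Whittaker functional (unique up to a scalar when `τ` is irreducible). -/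
def inducedWhittaker (τ : Representation ℂ (GL (Fin 2) k) Y) (ψ : AddChar k ℂ) :
    Set (SO7 k → GL (Fin 2) k → ℂ) :=
  {f | ∃ Λ : Y →ₗ[ℂ] ℂ, Λ ≠ 0 ∧ IsWhittakerGL2 τ ψ Λ ∧
    ∃ ξ : SO7 k → Y, IsSection τ ξ ∧ f = fun g a => Λ (τ a (ξ g))}

/-- The Weyl element `w₂` as an element of `SO₇(k)`. -/
def w2 : SO7 k := SO7.mk matW2 form_matW2 det_matW2

/-- The intertwining operator: `(M f)(g, a) = ∑_u f(w₂ u g, d₁ a*)`, `u` in the unipotent radical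
of `Ptilde`. -/
def intertwine (f : SO7 k → GL (Fin 2) k → ℂ) : SO7 k → GL (Fin 2) k → ℂ :=
  fun g a => ∑ᶠ u : Utilde k, f (w2 * u.val * g) (d1 * glStar a)

variable [NeZero (2 : k)]

/-- The zeta sum `Ψ(W, f) = ∑_{g ∈ U_H \ G₂(k)} W(g) f(g, 1)`. It does not depend on the choice
of representatives, see `zeta_term_invariant`. -/
def zeta (W : G2 k → ℂ) (f : SO7 k → GL (Fin 2) k → ℂ) : ℂ :=
  ∑ᶠ c : Quotient (QuotientGroup.rightRel (UH k)), W c.out * f c.out.val 1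

theorem zeta_term_invariant {X : Type*} [AddCommGroup X] [Module ℂ X]
    {ρ : Representation ℂ (G2 k) X} {τ : Representation ℂ (GL (Fin 2) k) Y} {ψ : AddChar k ℂ}
    {W : G2 k → ℂ} (hW : W ∈ whittakerModel ρ ψ) {f : SO7 k → GL (Fin 2) k → ℂ}
    (hf : f ∈ inducedWhittaker τ ψ⁻¹) {u : G2 k} (hu : u ∈ UH k) (g : G2 k) :
    W (u * g) * f (u * g).val 1 = W g * f g.val 1 := by
  obtain ⟨l, -, hl, v, rfl⟩ := hW
  obtain ⟨Λ, -, hΛ, ξ, hξ, rfl⟩ := hf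
  have triv : ∀ (x : G2 k) (hx : x ∈ U k), psiU ψ ⟨x, hx⟩ = 1 →
      BlockTriangular (G2.mat x) blk → gl2Block x.val = 1 → ∀ g : G2 k,
      l (ρ (x * g) v) * Λ (τ 1 (ξ (x * g).val)) = l (ρ g v) * Λ (τ 1 (ξ g.val)) := by
    intro x hx h1 h2 h3 g
    have e1 := hl ⟨x, hx⟩ (ρ g v)
    have e2 := hξ x.val h2 1 h3 g.val
    rw [map_mul, Module.End.mul_apply, e1, h1, one_mul, Subgroup.coe_mul, e2]
    simp
  induction hu using Subgroup.closure_induction generalizing g with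
  | mem x hx =>
    rcases hx with ((⟨r, rfl⟩ | ⟨r, rfl⟩) | ⟨r, rfl⟩) | ⟨r, rfl⟩
    · have hx : xB r ∈ U k := Subgroup.subset_closure (by simp)
      have e1 := hl ⟨xB r, hx⟩ (ρ g v)
      have e2 := hξ (xB r).val (by
        change BlockTriangular (matB r) blk
        intro i j
        fin_cases i <;> fin_cases j <;> simp [matB, blk]) (nGL2 r) (by
        change (matB r).submatrix ![0, 1] ![0, 1] = !![1, r; 0, 1]
        ext i j
        fin_cases i <;> fin_cases j <;> simp [matB]) g.val
      have e3 := hΛ r (ξ g.val)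
      simp only [map_mul, Module.End.mul_apply, Subgroup.coe_mul, map_one, Module.End.one_apply]
      rw [e1, e2, e3, psiU_xB]
      have : ψ r * ψ⁻¹ r = 1 := by
        rw [AddChar.inv_apply, ← AddChar.map_add_eq_mul]; simp
      linear_combination (l (ρ g v) * Λ (ξ g.val)) * this
    · refine triv _ (Subgroup.subset_closure (by simp)) (psiU_x2AB _ _ _) ?_ ?_ g
      · change BlockTriangular (mat2AB r) blk
        intro i j
        fin_cases i <;> fin_cases j <;> simp [mat2AB, blk]
      · change (mat2AB r).submatrix ![0, 1] ![0, 1] = 1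
        ext i j
        fin_cases i <;> fin_cases j <;> simp [mat2AB]
    · refine triv _ (Subgroup.subset_closure (by simp)) (psiU_x3AB _ _ _) ?_ ?_ g
      · change BlockTriangular (mat3AB r) blk
        intro i j
        fin_cases i <;> fin_cases j <;> simp [mat3AB, blk]
      · change (mat3AB r).submatrix ![0, 1] ![0, 1] = 1
        ext i j
        fin_cases i <;> fin_cases j <;> simp [mat3AB]
    · refine triv _ (Subgroup.subset_closure (by simp)) (psiU_x3A2B _ _ _) ?_ ?_ g
      · change BlockTriangular (mat3A2B r) blk
        intro i j
        fin_cases i <;> fin_cases j <;> simp [mat3A2B, blk]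
      · change (mat3A2B r).submatrix ![0, 1] ![0, 1] = 1
        ext i j
        fin_cases i <;> fin_cases j <;> simp [mat3A2B]
  | one => simp
  | mul x y _ _ hx hy => rw [mul_assoc, hx, hy]
  | inv x _ hx => rw [← hx (x⁻¹ * g), mul_inv_cancel_left]

end Zeta

end G2GL2

end

open Matrix

noncomputable section

namespace G2GL2

universe u

/-! ### Uniqueness of equivariant functionals by an anti-automorphism -/

section Gelfand

/-! Both zeta sums are bilinear forms in a vector of `Π` and a section of `I(τ)`, invariant under
`G₂(k)`: summing over all of `G₂(k)` instead of `U_H \ G₂(k)` only multiplies them by `|U_H|`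
(`sum_eq_card_mul_zeta`). It is therefore enough that such forms are proportional on sections and
that the one given by `Ψ(W, f)` is not zero.

Sections are combinations of `basicSection g y`, supported on one coset `P̃ g`. Since `P̃` is the
stabilizer of the isotropic plane `⟨e₁⁺, e₂⁺⟩`, the double cosets `P̃ \ SO₇ / G₂` are the orbits of
`G₂(k)` on isotropic planes. There are two (`SO7.open_or_closed`): the open one of `⟨e₁⁺, e₂⁺⟩`,
where the octonion product does not vanish, and the closed one of `⟨e₁⁺, e₃⁻⟩`, where it does. The
unipotent radical `V'` fixes `⟨e₁⁺, e₃⁻⟩` pointwise, so cuspidality kills an invariant form `D` on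
the closed orbit.

On the open orbit, `v ↦ D v (basicSection τ 1 y)` is invariant under the pointwise stabilizer of
`⟨e₁⁺, e₂⁺⟩`. Fourier expansion along `V`, then along the root subgroup of `β`, with the degenerate
terms removed by cuspidality along `V` and `V'`, shows that such a functional, if nonzero, has a
translate by the Levi subgroup that is nonzero on the `ψ_U`-isotypic part
(`FixInvariant.exists_whittakerSum`). Hence `D` is determined by its values on this part over the
coset of `1` (`IsInvariantForm.eq_zero`), and these are `c * (l v * Λ y)` by uniqueness of Whittaker
functionals (`IsInvariantForm.exists_eq_mul`). For `Ψ(W, f)` the constant is computed and is not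
zero (`IsWhittaker.exists_pairing_eq`); `γ` is the quotient of the two constants.

Uniqueness of Whittaker functionals, for `G₂(k)` and `GL₂(k)`, is the Gelfand–Kazhdan method
(`exists_eq_smul_of_anti`): an anti-automorphism that preserves the character and fixes a
representative of every relevant double coset makes the compressions of `ρ(g)` to the isotypic part
commute. For `G₂(k)` the representatives come from a Bruhat decomposition, found by moving an
isotropic vector with root elements (`bruhat`, `theta_or_kill`). -/

theorem character_ne_zero {S : Type*} [Group S] {χ : S →* ℂ} (s : S) : χ s ≠ 0 := fun h => by
  have := map_mul χ s s⁻¹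
  rw [mul_inv_cancel, map_one, h, zero_mul] at this
  exact one_ne_zero this

variable {G : Type*} [Group G] {X : Type*} [AddCommGroup X] [Module ℂ X]

theorem span_orbit_eq_top {ρ : Representation ℂ G X} (hρ : ρ.IsIrreducible) {v : X} (hv : v ≠ 0) :
    Submodule.span ℂ (Set.range fun g => ρ g v) = ⊤ := by
  let S : Subrepresentation ρ :=
    { toSubmodule := Submodule.span ℂ (Set.range fun g => ρ g v)
      apply_mem_toSubmodule := by
        intro g x hx
        induction hx using Submodule.span_induction with
        | mem x hx =>
          obtain ⟨h, rfl⟩ := hx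
          refine Submodule.subset_span ⟨g * h, ?_⟩
          simp
        | zero => simp
        | add x y _ _ hx hy => rw [map_add]; exact Submodule.add_mem _ hx hy
        | smul c x _ hx => rw [map_smul]; exact Submodule.smul_mem _ _ hx }
  have hvS : v ∈ S.toSubmodule := Submodule.subset_span ⟨1, by simp⟩
  rcases eq_bot_or_eq_top S with h | h
  · rw [h] at hvS
    exact absurd hvS hv
  · have := congrArg Subrepresentation.toSubmodule h
    exact this

/-- The orbit of a nonzero vector is finite and spans. Eigenvalues are available only because of
this. -/
theorem finiteDimensional_of_isIrreducible [Finite G] {ρ : Representation ℂ G X}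
    (hρ : ρ.IsIrreducible) : FiniteDimensional ℂ X := by
  by_cases h : ∃ v : X, v ≠ 0
  · obtain ⟨v, hv⟩ := h
    refine ⟨?_⟩
    rw [← span_orbit_eq_top hρ hv]
    exact Submodule.fg_span (Set.finite_range _)
  · push Not at h
    have : Subsingleton X := ⟨fun a b => by rw [h a, h b]⟩
    infer_instance

variable {S : Type*} [Group S] [Fintype S] (ι : S →* G) (χ : S →* ℂ) (ρ : Representation ℂ G X)

/-- The operator `∑ χ(s)⁻¹ ρ(s)` projecting, up to a scalar, to the `χ`-isotypic part. -/
def isotypicSum : X →ₗ[ℂ] X := ∑ s, (χ s)⁻¹ • ρ (ι s)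

variable {ι χ ρ}

theorem isotypicSum_mul (s : S) : isotypicSum ι χ ρ * ρ (ι s) = χ s • isotypicSum ι χ ρ := by
  rw [isotypicSum, Finset.sum_mul, Finset.smul_sum]
  refine Fintype.sum_equiv (Equiv.mulRight s) _ _ fun t => ?_
  have := character_ne_zero (χ := χ) s
  simp [smul_smul, this]

theorem mul_isotypicSum (s : S) : ρ (ι s) * isotypicSum ι χ ρ = χ s • isotypicSum ι χ ρ := by
  rw [isotypicSum, Finset.mul_sum, Finset.smul_sum]
  refine Fintype.sum_equiv (Equiv.mulLeft s) _ _ fun t => ?_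
  have := character_ne_zero (χ := χ) s
  simp only [Equiv.coe_mulLeft, map_mul, mul_inv, smul_smul, mul_smul_comm,
    mul_inv_cancel_left₀ this]

theorem isotypicSum_mul_self :
    isotypicSum ι χ ρ * isotypicSum ι χ ρ = (Fintype.card S : ℂ) • isotypicSum ι χ ρ := by
  conv_lhs => enter [1]; rw [isotypicSum]
  rw [Finset.sum_mul]
  simp only [smul_mul_assoc, mul_isotypicSum, smul_smul, inv_mul_cancel₀ (character_ne_zero _),
    one_smul, Finset.sum_const, Finset.card_univ, Nat.cast_smul_eq_nsmul]

theorem apply_isotypicSum {l : X →ₗ[ℂ] ℂ} (hl : ∀ s v, l (ρ (ι s) v) = χ s * l v) (v : X) :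
    l (isotypicSum ι χ ρ v) = Fintype.card S * l v := by
  simp only [isotypicSum, LinearMap.sum_apply, LinearMap.smul_apply, map_sum, map_smul, hl,
    smul_eq_mul, inv_mul_cancel_left₀ (character_ne_zero _), Finset.sum_const, Finset.card_univ,
    nsmul_eq_mul]

variable (ι χ ρ) in
/-- The compression of `ρ(g)` to the `χ`-isotypic part. -/
def heckeOp (g : G) : X →ₗ[ℂ] X := isotypicSum ι χ ρ * ρ g * isotypicSum ι χ ρ

theorem heckeOp_left (s : S) (g : G) : heckeOp ι χ ρ (ι s * g) = χ s • heckeOp ι χ ρ g := by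
  simp only [heckeOp, map_mul, ← mul_assoc, isotypicSum_mul, smul_mul_assoc]

theorem heckeOp_right (s : S) (g : G) : heckeOp ι χ ρ (g * ι s) = χ s • heckeOp ι χ ρ g := by
  simp only [heckeOp, map_mul, mul_assoc, mul_isotypicSum, mul_smul_comm]

/-- Taking `a` out on the right yields the factor `χ a`, taking `b` out on the left yields `χ b`,
and the operator is the same. -/
theorem heckeOp_eq_zero {g : G} {a b : S} (h : g * ι a = ι b * g) (hab : χ a ≠ χ b) :
    heckeOp ι χ ρ g = 0 := by
  have h1 := heckeOp_right (ι := ι) (χ := χ) (ρ := ρ) a g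
  rw [h, heckeOp_left, ← sub_eq_zero, ← sub_smul] at h1
  exact (smul_eq_zero.1 h1).resolve_left (sub_ne_zero.2 hab.symm)

/-- The two inner projections merge into `|S|` times one of them, which is then expanded. -/
theorem heckeOp_mul (g h : G) : heckeOp ι χ ρ g * heckeOp ι χ ρ h =
    (Fintype.card S : ℂ) • ∑ s, (χ s)⁻¹ • heckeOp ι χ ρ (g * ι s * h) := by
  have : heckeOp ι χ ρ g * heckeOp ι χ ρ h = isotypicSum ι χ ρ * ρ g *
      (isotypicSum ι χ ρ * isotypicSum ι χ ρ) * ρ h * isotypicSum ι χ ρ := by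
    simp only [heckeOp, mul_assoc]
  rw [this, isotypicSum_mul_self, mul_smul_comm, smul_mul_assoc, smul_mul_assoc]
  congr 1
  conv_lhs => enter [1, 1, 2]; rw [isotypicSum]
  simp only [Finset.mul_sum, Finset.sum_mul, heckeOp, map_mul, mul_assoc, mul_smul_comm,
    smul_mul_assoc]

/-- Equivariance on both sides reduces this to the representative `n`. If `n` is not fixed by `θ`,
its operator is zero, and `θ` applied to `n a = b n` shows that the operator of `θ n` is zero too.
-/
theorem heckeOp_anti {θ : G → G} (hθ : ∀ g h, θ (g * h) = θ h * θ g) {σ : S ≃ S}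
    (hσ : ∀ s, θ (ι s) = ι (σ s)) (hχ : ∀ s, χ (σ s) = χ s)
    {g : G} (H : ∃ s s' n, g = ι s * n * ι s' ∧
      (θ n = n ∨ ∃ a b, n * ι a = ι b * n ∧ χ a ≠ χ b)) :
    heckeOp ι χ ρ (θ g) = heckeOp ι χ ρ g := by
  obtain ⟨s, s', n, rfl, h⟩ := H
  have key : heckeOp ι χ ρ (θ n) = heckeOp ι χ ρ n := by
    rcases h with h | ⟨a, b, h1, h2⟩
    · rw [h]
    · rw [heckeOp_eq_zero h1 h2]
      have h3 := congrArg θ h1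
      rw [hθ, hθ, hσ, hσ] at h3
      exact heckeOp_eq_zero h3.symm (by rw [hχ, hχ]; exact h2.symm)
  rw [hθ, hθ, hσ, hσ, heckeOp_left, heckeOp_right, hχ, hχ, heckeOp_right, heckeOp_left, key]

/-- Gelfand's trick: in the expansion of the product over `s`, each operator is unchanged by `θ`,
which reverses the order of the factors. -/
theorem heckeOp_comm {θ : G → G} (hθ : ∀ g h, θ (g * h) = θ h * θ g) {σ : S ≃ S}
    (hσ : ∀ s, θ (ι s) = ι (σ s)) (hχ : ∀ s, χ (σ s) = χ s)
    (H : ∀ g, ∃ s s' n, g = ι s * n * ι s' ∧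
      (θ n = n ∨ ∃ a b, n * ι a = ι b * n ∧ χ a ≠ χ b)) (g h : G) :
    heckeOp ι χ ρ g * heckeOp ι χ ρ h = heckeOp ι χ ρ h * heckeOp ι χ ρ g := by
  have key : ∀ g, heckeOp ι χ ρ (θ g) = heckeOp ι χ ρ g := fun g => heckeOp_anti hθ hσ hχ (H g)
  conv_rhs => rw [← key g, ← key h]
  rw [heckeOp_mul, heckeOp_mul]
  congr 1
  refine Fintype.sum_equiv σ _ _ fun s => ?_
  rw [← key, hθ, hθ, hσ, hχ, mul_assoc]

/-- Write `E` for the isotypic sum. An eigenvector of one compression in the image of `E` generates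
`X`, and the compressions commute, so each of them is a scalar on the image of `E`. That image is
then a line. Equivariant functionals satisfy `l ∘ E = |S| l`, so they are determined by their values
on this line. -/
theorem exists_eq_smul_of_anti [Finite G] (hρ : ρ.IsIrreducible) {θ : G → G}
    (hθ : ∀ g h, θ (g * h) = θ h * θ g) {σ : S ≃ S}
    (hσ : ∀ s, θ (ι s) = ι (σ s)) (hχ : ∀ s, χ (σ s) = χ s)
    (H : ∀ g, ∃ s s' n, g = ι s * n * ι s' ∧
      (θ n = n ∨ ∃ a b, n * ι a = ι b * n ∧ χ a ≠ χ b))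
    {l l' : X →ₗ[ℂ] ℂ} (hl : ∀ s v, l (ρ (ι s) v) = χ s * l v)
    (hl' : ∀ s v, l' (ρ (ι s) v) = χ s * l' v) (h0 : l ≠ 0) : ∃ c : ℂ, l' = c • l := by
  have := finiteDimensional_of_isIrreducible hρ
  have hcard : (Fintype.card S : ℂ) ≠ 0 := Nat.cast_ne_zero.2 Fintype.card_ne_zero
  set E := isotypicSum ι χ ρ with hE
  have hEE : ∀ x, E (E x) = (Fintype.card S : ℂ) • E x := fun x =>
    LinearMap.congr_fun isotypicSum_mul_self x
  obtain ⟨x₀, hx₀⟩ : ∃ x, l x ≠ 0 := by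
    by_contra! h
    exact h0 (LinearMap.ext h)
  have hEx₀ : E x₀ ≠ 0 := fun h => by
    have h1 := apply_isotypicSum (ι := ι) (χ := χ) (ρ := ρ) hl x₀
    rw [← hE, h, map_zero] at h1
    exact (mul_ne_zero hcard hx₀) h1.symm
  have hhecke : ∀ g x, heckeOp ι χ ρ g x = E (ρ g (E x)) := fun g x => rfl
  have hEρ : ∀ g v, E v = (Fintype.card S : ℂ) • v →
      E (ρ g v) = (Fintype.card S : ℂ)⁻¹ • heckeOp ι χ ρ g v := by
    intro g v hv
    rw [hhecke, hv, map_smul, map_smul, inv_smul_smul₀ hcard]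
  have scalar : ∀ g, ∃ μ : ℂ, ∀ x, heckeOp ι χ ρ g (E x) = μ • E x := by
    intro g
    let T : LinearMap.range E →ₗ[ℂ] LinearMap.range E :=
      (heckeOp ι χ ρ g).restrict fun x _ => ⟨ρ g (E x), (hhecke g x).symm⟩
    have : Nontrivial (LinearMap.range E) := ⟨⟨⟨E x₀, x₀, rfl⟩, 0, fun h => hEx₀ (congrArg Subtype.val h)⟩⟩
    obtain ⟨μ, hμ⟩ := Module.End.exists_eigenvalue T
    obtain ⟨⟨v, w, rfl⟩, hv⟩ := hμ.exists_hasEigenvector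
    have hTv : heckeOp ι χ ρ g (E w) = μ • E w := congrArg Subtype.val hv.apply_eq_smul
    have hv0 : E w ≠ 0 := fun h => hv.2 (Subtype.ext h)
    refine ⟨μ, fun x => ?_⟩
    have hx : x ∈ Submodule.span ℂ (Set.range fun g => ρ g (E w)) := by
      rw [span_orbit_eq_top hρ hv0]; trivial
    induction hx using Submodule.span_induction with
    | mem x hx =>
      obtain ⟨h, rfl⟩ := hx
      simp only
      rw [hEρ h _ (hEE w), map_smul, smul_comm μ]
      congr 1
      have := LinearMap.congr_fun (heckeOp_comm (ρ := ρ) hθ hσ hχ H g h) (E w)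
      rw [Module.End.mul_apply, Module.End.mul_apply] at this
      rw [this, hTv, map_smul]
    | zero => simp
    | add x y _ _ hx hy => rw [map_add, map_add, hx, hy, smul_add]
    | smul c x _ hx => rw [map_smul, map_smul, hx, smul_comm]
  choose μ hμ using scalar
  have line : ∀ x, ∃ a : ℂ, E x = a • E x₀ := by
    intro x
    have hx : x ∈ Submodule.span ℂ (Set.range fun g => ρ g (E x₀)) := by
      rw [span_orbit_eq_top hρ hEx₀]; trivial
    induction hx using Submodule.span_induction with
    | mem x hx =>
      obtain ⟨h, rfl⟩ := hx
      exact ⟨(Fintype.card S : ℂ)⁻¹ * μ h, by rw [hEρ h _ (hEE x₀), hμ, smul_smul]⟩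
    | zero => exact ⟨0, by simp⟩
    | add x y _ _ hx hy =>
      obtain ⟨a, ha⟩ := hx
      obtain ⟨b, hb⟩ := hy
      exact ⟨a + b, by rw [map_add, ha, hb, add_smul]⟩
    | smul c x _ hx =>
      obtain ⟨a, ha⟩ := hx
      exact ⟨c * a, by rw [map_smul, ha, smul_smul]⟩
  refine ⟨l' x₀ / l x₀, LinearMap.ext fun x => ?_⟩
  obtain ⟨a, ha⟩ := line x
  have e1 := apply_isotypicSum (ι := ι) (χ := χ) (ρ := ρ) hl x
  have e2 := apply_isotypicSum (ι := ι) (χ := χ) (ρ := ρ) hl' x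
  rw [← hE, ha, map_smul, hE, apply_isotypicSum hl, smul_eq_mul, mul_left_comm] at e1
  rw [← hE, ha, map_smul, hE, apply_isotypicSum hl', smul_eq_mul, mul_left_comm] at e2
  rw [LinearMap.smul_apply, smul_eq_mul, ← mul_left_cancel₀ hcard e1, ← mul_left_cancel₀ hcard e2]
  field_simp

end Gelfand

/-! ### The group `GL₂(k)` -/

section GL2

variable {k : Type u} [Field k]

theorem GL2_det_mul_inv (a : GL (Fin 2) k) : a.val.det * (a.val.det)⁻¹ = 1 :=
  mul_inv_cancel₀ (((Matrix.isUnit_iff_isUnit_det _).1 a.isUnit).ne_zero)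

theorem GL2_det_eq (a : GL (Fin 2) k) :
    a.val 0 0 * a.val 1 1 - a.val 0 1 * a.val 1 0 = a.val.det := (Matrix.det_fin_two _).symm

/-- The element of `GL₂(k)` with given entries. -/
def gl2 (p q s w : k) (h : p * w - q * s ≠ 0) : GL (Fin 2) k :=
  GeneralLinearGroup.mkOfDetNeZero !![p, q; s, w] (by rwa [Matrix.det_fin_two_of])

theorem gl2_val (p q s w : k) (h : p * w - q * s ≠ 0) : (gl2 p q s w h).val = !![p, q; s, w] := rfl

theorem gl2_ext {a b : GL (Fin 2) k} (h00 : a.val 0 0 = b.val 0 0) (h01 : a.val 0 1 = b.val 0 1)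
    (h10 : a.val 1 0 = b.val 1 0) (h11 : a.val 1 1 = b.val 1 1) : a = b := by
  refine Units.ext ?_
  ext i j
  fin_cases i <;> fin_cases j
  exacts [h00, h01, h10, h11]

theorem nGL2_val (x : k) : (nGL2 x).val = !![1, x; 0, 1] := rfl

theorem gl2_bruhat (a : GL (Fin 2) k) :
    (∃ (p w : kˣ) (y : k), a = gl2 (p : k) 0 0 w (by simp) * nGL2 y) ∨
    ∃ (x : k) (s b : kˣ) (y : k),
      a = nGL2 x * gl2 0 1 1 0 (by simp) * gl2 (s : k) 0 0 b (by simp) * nGL2 y := by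
  have hd : a.val.det ≠ 0 := left_ne_zero_of_mul_eq_one (GL2_det_mul_inv a)
  rw [← GL2_det_eq] at hd
  by_cases h : a.val 1 0 = 0
  · left
    rw [h, mul_zero, sub_zero] at hd
    have hp := left_ne_zero_of_mul hd
    have hw := right_ne_zero_of_mul hd
    refine ⟨Units.mk0 _ hp, Units.mk0 _ hw, a.val 0 1 / a.val 0 0, gl2_ext ?_ ?_ ?_ ?_⟩ <;>
    simp [gl2_val, nGL2_val, h, mul_div_cancel₀, hp]
  · right
    have hb : -(a.val 0 0 * a.val 1 1 - a.val 0 1 * a.val 1 0) / a.val 1 0 ≠ 0 :=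
      div_ne_zero (neg_ne_zero.2 hd) h
    -- The product to be matched has rows `(x s, x s y + b)` and `(s, s y)`, which determines `s`,
    -- `x`, `y` and then `b`.
    refine ⟨a.val 0 0 / a.val 1 0, Units.mk0 _ h, Units.mk0 _ hb, a.val 1 1 / a.val 1 0,
      gl2_ext ?_ ?_ ?_ ?_⟩ <;>
    simp [gl2_val, nGL2_val, h] <;> field_simp <;> ring

/-- This rules out torus elements that scale a simple root subgroup by `c ≠ 1`; the case `c = 0`
expresses that `ψ` is nontrivial. The witness solves `(1 - c) r = s` with `ψ s ≠ 1`. -/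
theorem exists_apply_ne_apply_mul {ψ : AddChar k ℂ} (hψ : ψ ≠ 1) {c : k} (hc : c ≠ 1) :
    ∃ r, ψ r ≠ ψ (c * r) := by
  obtain ⟨s, hs⟩ : ∃ s, ψ s ≠ 1 := by
    by_contra! h
    exact hψ (DFunLike.ext _ _ h)
  have hc' : 1 - c ≠ 0 := sub_ne_zero.2 hc.symm
  refine ⟨s / (1 - c), fun h => hs ?_⟩
  have : s = s / (1 - c) - c * (s / (1 - c)) := by field_simp
  rw [this, sub_eq_add_neg, AddChar.map_add_eq_mul, h, ← AddChar.map_add_eq_mul, add_neg_cancel,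
    AddChar.map_zero_eq_one]

end GL2

/-! ### The action on pure octonions in coordinates -/

theorem vec7_eta {R : Type*} (x : Fin 7 → R) : x = ![x 0, x 1, x 2, x 3, x 4, x 5, x 6] := by
  ext i
  fin_cases i <;> rfl

section Action

variable {k : Type u} [Field k]

/-- The action of `SO₇(k)` on coordinate vectors. -/
def act (g : SO7 k) (x : Fin 7 → k) : Fin 7 → k := SO7.mat g *ᵥ x

theorem act_mul (g h : SO7 k) (x : Fin 7 → k) : act (g * h) x = act g (act h x) := by
  rw [act, act, act, SO7.mat_mul, Matrix.mulVec_mulVec]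

theorem act_one (x : Fin 7 → k) : act 1 x = x := by
  rw [act, SO7.mat_one, Matrix.one_mulVec]

theorem act_add (g : SO7 k) (x y : Fin 7 → k) : act g (x + y) = act g x + act g y :=
  Matrix.mulVec_add _ _ _

theorem act_smul (g : SO7 k) (c : k) (x : Fin 7 → k) : act g (c • x) = c • act g x :=
  Matrix.mulVec_smul _ _ _

theorem act_inv_act (g : SO7 k) (x : Fin 7 → k) : act g⁻¹ (act g x) = x := by
  rw [← act_mul, inv_mul_cancel, act_one]

theorem act_act_inv (g : SO7 k) (x : Fin 7 → k) : act g (act g⁻¹ x) = x := by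
  rw [← act_mul, mul_inv_cancel, act_one]

theorem act_injective (g : SO7 k) : Function.Injective (act g) :=
  Function.LeftInverse.injective (act_inv_act g)

theorem act_zero (g : SO7 k) : act g 0 = 0 := Matrix.mulVec_zero _

theorem mat_apply (g : SO7 k) (i j : Fin 7) : SO7.mat g i j = act g (Pi.single j 1) i := by
  rw [act, Matrix.mulVec_single_one, Matrix.col_apply]

theorem SO7.ext_act {g h : SO7 k} (H : ∀ x, act g x = act h x) : g = h := by
  refine Subtype.ext (Units.ext ?_)
  ext i j
  change SO7.mat g i j = SO7.mat h i j
  rw [mat_apply, mat_apply, H]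

theorem G2.ext_act {g h : G2 k} (H : ∀ x, act g.val x = act h.val x) : g = h :=
  Subtype.ext (SO7.ext_act H)

/-- The bilinear form of the pure octonions. -/
def bil (x y : Fin 7 → k) : k :=
  x 0 * y 6 + x 1 * y 5 - x 2 * y 4 + 2 * x 3 * y 3 - x 4 * y 2 + x 5 * y 1 + x 6 * y 0

theorem bil_act (g : SO7 k) (x y : Fin 7 → k) : bil (act g x) (act g y) = bil x y := by
  have hg : (SO7.mat g)ᵀ * formQ k * SO7.mat g = formQ k := g.2.1
  rw [bil, ← formQ_apply, bil, ← formQ_apply]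
  conv_rhs => rw [← hg]
  simp only [← Matrix.mulVec_mulVec]
  rw [Matrix.dotProduct_mulVec _ (SO7.mat g)ᵀ, Matrix.vecMul_transpose]
  rfl

variable [NeZero (2 : k)]

/-- A product of pure octonions is `bil x y / 2` times `1` plus the pure octonion of `pureMul x y`.
An automorphism coming from `G₂(k)` fixes `1`, because `1` is the square of `X⁰` and also of its
image, a pure octonion of the same length. The pure parts can then be compared. -/
theorem pureMul_act (g : G2 k) (x y : Fin 7 → k) :
    pureMul (act g.val x) (act g.val y) = act g.val (pureMul x y) := by
  have h2 : (2 : k) ≠ 0 := NeZero.ne _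
  obtain ⟨σ, h1, h3⟩ := g.2
  have hmul : ∀ x y : Fin 7 → k, octMul (pureOct x) (pureOct y) =
      (bil x y / 2) • ((⟨1, 0, 0, 0⟩, 0) : Oct k) + pureOct (pureMul x y) := by
    intro x y
    have h0 : ((⟨0, 0, 0, 0⟩, 0) : Oct k) = 0 := rfl
    have := octMul_eq 0 0 x y
    simp only [h0, zero_add, zero_smul, zero_mul, formQ_apply] at this
    rw [this, bil]
    congr 1
    ext <;> simp
  have hself : ∀ x : Fin 7 → k, pureMul x x = 0 := by
    intro x
    ext i
    fin_cases i <;> simp [pureMul, h2] <;> ring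
  have hp0 : pureOct (0 : Fin 7 → k) = 0 := by simp [pureOct]
  have hone : σ ((⟨1, 0, 0, 0⟩, 0) : Oct k) = ((⟨1, 0, 0, 0⟩, 0) : Oct k) := by
    have e := hmul ![0, 0, 0, 1, 0, 0, 0] ![0, 0, 0, 1, 0, 0, 0]
    have e' := hmul (act g.val ![0, 0, 0, 1, 0, 0, 0]) (act g.val ![0, 0, 0, 1, 0, 0, 0])
    have e2 : bil ![0, 0, 0, 1, 0, 0, 0] ![0, 0, 0, 1, 0, 0, 0] / 2 = (1 : k) := by
      simp [bil, h2]
    rw [hself, hp0, add_zero, e2, one_smul] at e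
    rw [hself, hp0, add_zero, bil_act, e2, one_smul] at e'
    rw [← e, h1, h3]
    exact e'.trans e.symm
  have key := h1 (pureOct x) (pureOct y)
  rw [h3, h3, hmul, map_add, map_smul, hone, h3] at key
  have := hmul (act g.val x) (act g.val y)
  rw [bil_act] at this
  have h4 := add_left_cancel (key.trans this)
  rw [← octCoord_pureOct (pureMul (act g.val x) (act g.val y)), ← h4, octCoord_pureOct]
  rfl

/-- An element of `G₂(k)` is determined by its action on the generators `e₁⁺, e₂⁺, e₃⁺`. -/
theorem G2.eq_one_of_fix {g : G2 k}
    (h0 : act g.val ![1, 0, 0, 0, 0, 0, 0] = ![1, 0, 0, 0, 0, 0, 0])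
    (h1 : act g.val ![0, 1, 0, 0, 0, 0, 0] = ![0, 1, 0, 0, 0, 0, 0])
    (h2 : act g.val ![0, 0, 1, 0, 0, 0, 0] = ![0, 0, 1, 0, 0, 0, 0]) : g = 1 := by
  have h2' : (2 : k) ≠ 0 := NeZero.ne _
  -- The other basis vectors are products: `e₁⁺e₂⁺ = e₃⁻`, `e₁⁺e₃⁺ = e₂⁻`, `e₃⁺e₂⁺ = e₁⁻`, and `X⁰`
  -- is the pure part of `2 e₁⁻e₁⁺`.
  have h4 : act g.val ![0, 0, 0, 0, 1, 0, 0] = ![0, 0, 0, 0, 1, 0, 0] := by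
    have e : pureMul (![1, 0, 0, 0, 0, 0, 0] : Fin 7 → k) ![0, 1, 0, 0, 0, 0, 0] =
      ![0, 0, 0, 0, 1, 0, 0] := by simp [pureMul]
    rw [← e, ← pureMul_act, h0, h1]
  have h5 : act g.val ![0, 0, 0, 0, 0, 1, 0] = ![0, 0, 0, 0, 0, 1, 0] := by
    have e : pureMul (![1, 0, 0, 0, 0, 0, 0] : Fin 7 → k) ![0, 0, 1, 0, 0, 0, 0] =
      ![0, 0, 0, 0, 0, 1, 0] := by simp [pureMul]
    rw [← e, ← pureMul_act, h0, h2]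
  have h6 : act g.val ![0, 0, 0, 0, 0, 0, 1] = ![0, 0, 0, 0, 0, 0, 1] := by
    have e : pureMul (![0, 0, 1, 0, 0, 0, 0] : Fin 7 → k) ![0, 1, 0, 0, 0, 0, 0] =
      ![0, 0, 0, 0, 0, 0, 1] := by simp [pureMul]
    rw [← e, ← pureMul_act, h1, h2]
  have h3 : act g.val ![0, 0, 0, 1, 0, 0, 0] = ![0, 0, 0, 1, 0, 0, 0] := by
    have e : pureMul (![0, 0, 0, 0, 0, 0, 1] : Fin 7 → k) ![2, 0, 0, 0, 0, 0, 0] =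
      ![0, 0, 0, 1, 0, 0, 0] := by simp [pureMul, h2']
    have h0' : act g.val ![2, 0, 0, 0, 0, 0, 0] = ![2, 0, 0, 0, 0, 0, 0] := by
      have e : (![2, 0, 0, 0, 0, 0, 0] : Fin 7 → k) = (2 : k) • ![1, 0, 0, 0, 0, 0, 0] := by simp
      rw [e, act_smul, h0]
    rw [← e, ← pureMul_act, h6, h0']
  refine G2.ext_act fun x => ?_
  have hx : x = x 0 • ![1, 0, 0, 0, 0, 0, 0] + x 1 • ![0, 1, 0, 0, 0, 0, 0] +
      x 2 • ![0, 0, 1, 0, 0, 0, 0] + x 3 • ![0, 0, 0, 1, 0, 0, 0] +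
      x 4 • ![0, 0, 0, 0, 1, 0, 0] + x 5 • ![0, 0, 0, 0, 0, 1, 0] +
      x 6 • ![0, 0, 0, 0, 0, 0, 1] := by
    ext i
    fin_cases i <;> simp
  rw [hx]
  simp only [act_add, act_smul, h0, h1, h2, h3, h4, h5, h6, OneMemClass.coe_one, act_one]

theorem act_xA (r : k) (x : Fin 7 → k) : act (xA r).val x =
    ![x 0, x 1 - 2 * r * x 3 - r ^ 2 * x 5, x 2, x 3 + r * x 5, x 4 - r * x 0, x 5, x 6 - r * x 2] :=
  mulVec_matA r x

theorem act_xB (r : k) (x : Fin 7 → k) : act (xB r).val x =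
    ![x 0 + r * x 1, x 1, x 2, x 3, x 4, x 5 - r * x 6, x 6] :=
  mulVec_matB r x

theorem act_xAB (r : k) (x : Fin 7 → k) : act (xAB r).val x =
    ![x 0 - 2 * r * x 3 - r ^ 2 * x 6, x 1, x 2, x 3 + r * x 6, x 4 + r * x 1, x 5 + r * x 2, x 6] :=
  mulVec_matAB r x

theorem act_x2AB (r : k) (x : Fin 7 → k) : act (x2AB r).val x =
    ![x 0 - r * x 5, x 1 + r * x 6, x 2, x 3 - r * x 2, x 4 + r ^ 2 * x 2 - 2 * r * x 3, x 5, x 6] :=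
  mulVec_mat2AB r x

theorem act_x3AB (r : k) (x : Fin 7 → k) : act (x3AB r).val x =
    ![x 0, x 1 + r * x 2, x 2, x 3, x 4 + r * x 5, x 5, x 6] :=
  mulVec_mat3AB r x

theorem act_x3A2B (r : k) (x : Fin 7 → k) : act (x3A2B r).val x =
    ![x 0 + r * x 2, x 1, x 2, x 3, x 4 + r * x 6, x 5, x 6] :=
  mulVec_mat3A2B r x

end Action

/-! ### Levi elements and Weyl elements -/

section Levi

variable {k : Type u} [Field k]

/-- The matrix of a representative of the reflection in `α`. -/
def matNA : Matrix (Fin 7) (Fin 7) k :=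
  !![0, 0, 0, 0, 1, 0, 0;
     0, 0, 0, 0, 0, 1, 0;
     0, 0, 0, 0, 0, 0, -1;
     0, 0, 0, -1, 0, 0, 0;
     1, 0, 0, 0, 0, 0, 0;
     0, 1, 0, 0, 0, 0, 0;
     0, 0, -1, 0, 0, 0, 0]

/-- The matrix of an element of the Levi subgroup `GL₂(k)` containing the root subgroup of `β`. -/
def matLevi (p q s w d D : k) : Matrix (Fin 7) (Fin 7) k :=
  !![p, q, 0, 0, 0, 0, 0;
     s, w, 0, 0, 0, 0, 0;
     0, 0, D, 0, 0, 0, 0;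
     0, 0, 0, 1, 0, 0, 0;
     0, 0, 0, 0, d, 0, 0;
     0, 0, 0, 0, 0, D * p, -(D * q);
     0, 0, 0, 0, 0, -(D * s), D * w]

theorem mulVec_matNA (x : Fin 7 → k) :
    matNA *ᵥ x = ![x 4, x 5, -x 6, -x 3, x 0, x 1, -x 2] := by
  ext i
  fin_cases i <;> simp [matNA, Matrix.mulVec, dotProduct, Fin.sum_univ_succ]

theorem mulVec_matLevi (p q s w d D : k) (x : Fin 7 → k) :
    matLevi p q s w d D *ᵥ x = ![p * x 0 + q * x 1, s * x 0 + w * x 1, D * x 2, x 3, d * x 4,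
      D * (p * x 5 - q * x 6), D * (w * x 6 - s * x 5)] := by
  ext i
  fin_cases i <;> simp [matLevi, Matrix.mulVec, dotProduct, Fin.sum_univ_succ] <;> ring

theorem det_matNA : (matNA : Matrix (Fin 7) (Fin 7) k).det = 1 := by
  simp [matNA, Matrix.det_succ_row_zero, Fin.sum_univ_succ, Fin.succAbove]; try ring

theorem det_matLevi {p q s w d D : k} (h : p * w - q * s = d) (h' : d * D = 1) :
    (matLevi p q s w d D).det = 1 := by
  have : (matLevi p q s w d D).det = (p * w - q * s) ^ 2 * D ^ 3 * d := by
    simp [matLevi, Matrix.det_succ_row_zero, Fin.sum_univ_succ, Fin.succAbove]; ring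
  rw [this, h]
  linear_combination (d ^ 2 * D ^ 2 + d * D + 1) * h'

theorem form_matNA : (matNA : Matrix (Fin 7) (Fin 7) k)ᵀ * formQ k * matNA = formQ k := by
  refine form_of fun x y => ?_
  simp only [formQ_apply, mulVec_matNA]
  simp; ring

theorem form_matLevi {p q s w d D : k} (h : p * w - q * s = d) (h' : d * D = 1) :
    (matLevi p q s w d D)ᵀ * formQ k * matLevi p q s w d D = formQ k := by
  refine form_of fun x y => ?_
  simp only [formQ_apply, mulVec_matLevi]
  simp only [cons_val]
  have h2 : D * (p * w - q * s) = 1 := by rw [h, mul_comm, h']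
  linear_combination (x 0 * y 6 + x 1 * y 5 + x 5 * y 1 + x 6 * y 0) * h2
    - (x 2 * y 4 + x 4 * y 2) * h'

variable [NeZero (2 : k)]

variable (k) in
/-- A representative of the reflection in `α`. -/
def nA : G2 k := ⟨SO7.mk matNA form_matNA det_matNA, by
  have h2 : (2 : k) ≠ 0 := NeZero.ne _
  refine mem_G2_of _ fun x y => ?_
  rw [SO7.mat_mk, mulVec_matNA, mulVec_matNA, mulVec_matNA]
  ext i
  fin_cases i <;> simp [pureMul] <;> field_simp <;> ring⟩

/-- The element of the Levi subgroup `GL₂(k)` with a given upper left block. -/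
def levi (a : GL (Fin 2) k) : G2 k :=
  ⟨SO7.mk (matLevi (a.val 0 0) (a.val 0 1) (a.val 1 0) (a.val 1 1) a.val.det (a.val.det)⁻¹)
    (form_matLevi (GL2_det_eq a) (GL2_det_mul_inv a))
    (det_matLevi (GL2_det_eq a) (GL2_det_mul_inv a)), by
  have h2 : (2 : k) ≠ 0 := NeZero.ne _
  have hd := GL2_det_eq a
  have hD := GL2_det_mul_inv a
  refine mem_G2_of _ fun x y => ?_
  rw [SO7.mat_mk, mulVec_matLevi, mulVec_matLevi, mulVec_matLevi]
  -- With the inverse determinant a free variable `D` subject to `d * D = 1`, the identities become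
  -- polynomial.
  generalize a.val.det = d at *
  generalize d⁻¹ = D at *
  generalize a.val 0 0 = p at *
  generalize a.val 0 1 = q at *
  generalize a.val 1 0 = s at *
  generalize a.val 1 1 = w at *
  have hd' : D * (p * w - q * s) = 1 := by rw [hd, mul_comm, hD]
  ext i
  fin_cases i <;> simp [pureMul]
  · linear_combination (p * (x 4 * y 5 - x 5 * y 4) - q * (x 4 * y 6 - x 6 * y 4)) * hD
  · linear_combination (s * (x 4 * y 5 - x 5 * y 4) - w * (x 4 * y 6 - x 6 * y 4)) * hD
  · linear_combination (-D * (x 5 * y 6 - x 6 * y 5)) * hd'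
  · field_simp
    linear_combination (x 6 * y 0 - x 0 * y 6 + x 5 * y 1 - x 1 * y 5) * hd' +
      (x 2 * y 4 - x 4 * y 2) * hD
  · linear_combination (x 0 * y 1 - x 1 * y 0) * hd
  · ring
  · ring⟩

theorem act_nA (x : Fin 7 → k) : act (nA k).val x = ![x 4, x 5, -x 6, -x 3, x 0, x 1, -x 2] :=
  mulVec_matNA x

theorem act_levi (a : GL (Fin 2) k) (x : Fin 7 → k) : act (levi a).val x =
    ![a.val 0 0 * x 0 + a.val 0 1 * x 1, a.val 1 0 * x 0 + a.val 1 1 * x 1, (a.val.det)⁻¹ * x 2,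
      x 3, a.val.det * x 4, (a.val.det)⁻¹ * (a.val 0 0 * x 5 - a.val 0 1 * x 6),
      (a.val.det)⁻¹ * (a.val 1 1 * x 6 - a.val 1 0 * x 5)] :=
  mulVec_matLevi _ _ _ _ _ _ x

theorem levi_mul (a b : GL (Fin 2) k) : levi (a * b) = levi a * levi b := by
  refine G2.ext_act fun x => ?_
  rw [Subgroup.coe_mul, act_mul, act_levi, act_levi, act_levi]
  ext i
  fin_cases i <;> simp [Matrix.mul_apply, Fin.sum_univ_two] <;> ring

theorem levi_one : levi (1 : GL (Fin 2) k) = 1 := by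
  refine G2.ext_act fun x => ?_
  rw [act_levi, OneMemClass.coe_one, act_one]
  ext i
  fin_cases i <;> simp

theorem levi_inv (a : GL (Fin 2) k) : levi a⁻¹ = (levi a)⁻¹ := by
  rw [eq_inv_iff_mul_eq_one, ← levi_mul, inv_mul_cancel, levi_one]

theorem levi_nGL2 (r : k) : levi (nGL2 r) = xB r := by
  refine G2.ext_act fun x => ?_
  rw [act_levi, act_xB]
  have h : (nGL2 r : GL (Fin 2) k).val = !![1, r; 0, 1] := rfl
  rw [h]
  ext i
  fin_cases i <;> simp

end Levi

/-! ### Parabolic subgroups and the Bruhat decomposition -/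

section Bruhat

variable {k : Type u} [Field k] [NeZero (2 : k)]

theorem xA_mem_U (r : k) : xA r ∈ U k := Subgroup.subset_closure (by simp)
theorem xB_mem_U (r : k) : xB r ∈ U k := Subgroup.subset_closure (by simp)
theorem xAB_mem_U (r : k) : xAB r ∈ U k := Subgroup.subset_closure (by simp)
theorem x2AB_mem_U (r : k) : x2AB r ∈ U k := Subgroup.subset_closure (by simp)
theorem x3AB_mem_U (r : k) : x3AB r ∈ U k := Subgroup.subset_closure (by simp)
theorem x3A2B_mem_U (r : k) : x3A2B r ∈ U k := Subgroup.subset_closure (by simp)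

theorem V_le_U : V k ≤ U k := by
  refine Subgroup.closure_mono ?_
  simp only [Set.union_subset_iff]
  refine ⟨⟨⟨⟨?_, ?_⟩, ?_⟩, ?_⟩, ?_⟩ <;> rintro _ ⟨r, rfl⟩ <;> simp

theorem G2.eq_of_agree {g h : G2 k}
    (h0 : act g.val ![1, 0, 0, 0, 0, 0, 0] = act h.val ![1, 0, 0, 0, 0, 0, 0])
    (h1 : act g.val ![0, 1, 0, 0, 0, 0, 0] = act h.val ![0, 1, 0, 0, 0, 0, 0])
    (h2 : act g.val ![0, 0, 1, 0, 0, 0, 0] = act h.val ![0, 0, 1, 0, 0, 0, 0]) : g = h := by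
  have : h⁻¹ * g = 1 := by
    refine G2.eq_one_of_fix ?_ ?_ ?_ <;>
    simp only [Subgroup.coe_mul, Subgroup.coe_inv, act_mul, h0, h1, h2, act_inv_act]
  rw [← mul_one h, ← this, mul_inv_cancel_left]

/-- An element of `G₂(k)` fixing `e₁⁺` and `e₂⁺` is a product of elements of the root subgroups of
`3α+β`, `3α+2β` and `2α+β`. -/
theorem G2.exists_of_fix {g : G2 k}
    (h0 : act g.val ![1, 0, 0, 0, 0, 0, 0] = ![1, 0, 0, 0, 0, 0, 0])
    (h1 : act g.val ![0, 1, 0, 0, 0, 0, 0] = ![0, 1, 0, 0, 0, 0, 0]) :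
    ∃ r s t, g = x3AB r * x3A2B s * x2AB t := by
  have h2' : (2 : k) ≠ 0 := NeZero.ne _
  have h4 : act g.val ![0, 0, 0, 0, 1, 0, 0] = ![0, 0, 0, 0, 1, 0, 0] := by
    have e : pureMul (![1, 0, 0, 0, 0, 0, 0] : Fin 7 → k) ![0, 1, 0, 0, 0, 0, 0] =
      ![0, 0, 0, 0, 1, 0, 0] := by simp [pureMul]
    rw [← e, ← pureMul_act, h0, h1]
  obtain ⟨y, hy⟩ : ∃ y, act g.val ![0, 0, 1, 0, 0, 0, 0] = y := ⟨_, rfl⟩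
  -- Pairing `y`, the image of `e₃⁺`, with the fixed vectors `e₁⁺, e₂⁺, e₃⁻` gives `y 6 = y 5 = 0`
  -- and `y 2 = 1`; isotropy gives `y 4 = y 3 ^ 2`. The remaining `y 0, y 1, y 3` are the parameters
  -- of the three root elements.
  have b0 := bil_act g.val ![0, 0, 1, 0, 0, 0, 0] ![1, 0, 0, 0, 0, 0, 0]
  have b1 := bil_act g.val ![0, 0, 1, 0, 0, 0, 0] ![0, 1, 0, 0, 0, 0, 0]
  have b4 := bil_act g.val ![0, 0, 1, 0, 0, 0, 0] ![0, 0, 0, 0, 1, 0, 0]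
  have b2 := bil_act g.val ![0, 0, 1, 0, 0, 0, 0] ![0, 0, 1, 0, 0, 0, 0]
  rw [h0, hy] at b0
  rw [h1, hy] at b1
  rw [h4, hy] at b4
  rw [hy] at b2
  simp [bil] at b0 b1 b4 b2
  rw [b0, b1, b4] at b2
  have b4' : y 4 = y 3 ^ 2 := mul_left_cancel₀ h2' (by linear_combination -b2)
  refine ⟨y 1, y 0, - y 3, G2.eq_of_agree ?_ ?_ ?_⟩
  · rw [h0]; simp [Subgroup.coe_mul, act_mul, act_x3AB, act_x3A2B, act_x2AB]
  · rw [h1]; simp [Subgroup.coe_mul, act_mul, act_x3AB, act_x3A2B, act_x2AB]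
  · rw [hy]; simp [Subgroup.coe_mul, act_mul, act_x3AB, act_x3A2B, act_x2AB]
    conv_lhs => rw [vec7_eta y]
    rw [b0, b1, b4, b4']

/-- Since `e₃⁻ = e₁⁺e₂⁺`, it is multiplied by `p * w - q * s`, which therefore is not zero. After
division by the Levi factor, `x_α` and `x_{α+β}` remove the components along `e₃⁻`, and what is left
fixes `e₁⁺` and `e₂⁺`. -/
theorem parabolic_decomp {g : G2 k} {p s m q w n : k}
    (h0 : act g.val ![1, 0, 0, 0, 0, 0, 0] = ![p, s, 0, 0, m, 0, 0])
    (h1 : act g.val ![0, 1, 0, 0, 0, 0, 0] = ![q, w, 0, 0, n, 0, 0]) :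
    ∃ h : p * w - q * s ≠ 0, ∃ v ∈ V k, g = levi (gl2 p q s w h) * v := by
  have h4 : act g.val ![0, 0, 0, 0, 1, 0, 0] = ![0, 0, 0, 0, p * w - q * s, 0, 0] := by
    have e : pureMul (![1, 0, 0, 0, 0, 0, 0] : Fin 7 → k) ![0, 1, 0, 0, 0, 0, 0] =
      ![0, 0, 0, 0, 1, 0, 0] := by simp [pureMul]
    rw [← e, ← pureMul_act, h0, h1]
    simp [pureMul, mul_comm]
  have hd : p * w - q * s ≠ 0 := by
    intro h
    rw [h] at h4
    have h5 : (![0, 0, 0, 0, 1, 0, 0] : Fin 7 → k) = 0 := by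
      refine act_injective g.val ?_
      rw [h4, act_zero]
      simp
    simpa using congrFun h5 4
  refine ⟨hd, (levi (gl2 p q s w hd))⁻¹ * g, ?_, by rw [mul_inv_cancel_left]⟩
  have hinv : ∀ x y m' : k, act (levi (gl2 p q s w hd))⁻¹.val
      ![p * x + q * y, s * x + w * y, 0, 0, m', 0, 0] =
        ![x, y, 0, 0, (p * w - q * s)⁻¹ * m', 0, 0] := by
    intro x y m'
    refine act_injective (levi (gl2 p q s w hd)).val ?_
    rw [Subgroup.coe_inv, act_act_inv, act_levi]
    simp [gl2_val, hd]
  have g0 : act ((levi (gl2 p q s w hd))⁻¹ * g).val ![1, 0, 0, 0, 0, 0, 0] =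
      ![1, 0, 0, 0, (p * w - q * s)⁻¹ * m, 0, 0] := by
    have := hinv 1 0 m
    simp only [mul_one, mul_zero, add_zero] at this
    rw [Subgroup.coe_mul, act_mul, h0, this]
  have g1 : act ((levi (gl2 p q s w hd))⁻¹ * g).val ![0, 1, 0, 0, 0, 0, 0] =
      ![0, 1, 0, 0, (p * w - q * s)⁻¹ * n, 0, 0] := by
    have := hinv 0 1 n
    simp only [mul_one, mul_zero, zero_add] at this
    rw [Subgroup.coe_mul, act_mul, h1, this]
  generalize (levi (gl2 p q s w hd))⁻¹ * g = g' at *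
  generalize (p * w - q * s)⁻¹ * m = m' at *
  generalize (p * w - q * s)⁻¹ * n = n' at *
  obtain ⟨r, s', t, h⟩ := G2.exists_of_fix (g := xAB (-n') * xA m' * g')
    (by rw [Subgroup.coe_mul, Subgroup.coe_mul, act_mul, act_mul, g0, act_xA, act_xAB]; simp)
    (by rw [Subgroup.coe_mul, Subgroup.coe_mul, act_mul, act_mul, g1, act_xA, act_xAB]; simp)
  have : g' = (xAB (-n') * xA m')⁻¹ * (x3AB r * x3A2B s' * x2AB t) := by
    rw [← h, inv_mul_cancel_left]
  rw [this]
  refine mul_mem (inv_mem (mul_mem ?_ ?_)) (mul_mem (mul_mem ?_ ?_) ?_) <;>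
  exact Subgroup.subset_closure (by simp)

/-- The vectors `x` with `pureMul e₃⁻ x = 0` form `⟨e₁⁺, e₂⁺, e₃⁻⟩`, so the stabilizer of the line
of `e₃⁻` preserves this space. -/
theorem parabolic_decomp_of_line {g : G2 k} {c : k}
    (h4 : act g.val ![0, 0, 0, 0, 1, 0, 0] = ![0, 0, 0, 0, c, 0, 0]) :
    ∃ a, ∃ v ∈ V k, g = levi a * v := by
  have h2' : (2 : k) ≠ 0 := NeZero.ne _
  have hc : c ≠ 0 := by
    rintro rfl
    have h5 : (![0, 0, 0, 0, 1, 0, 0] : Fin 7 → k) = 0 := by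
      refine act_injective g.val ?_
      rw [h4, act_zero]
      simp
    simpa using congrFun h5 4
  have key : ∀ x : Fin 7 → k, pureMul ![0, 0, 0, 0, 1, 0, 0] x = 0 →
      act g.val x = ![act g.val x 0, act g.val x 1, 0, 0, act g.val x 4, 0, 0] := by
    intro x hx
    have e := pureMul_act g ![0, 0, 0, 0, 1, 0, 0] x
    rw [hx, act_zero, h4] at e
    have e0 := congrFun e 0
    have e1 := congrFun e 1
    have e3 := congrFun e 3
    have e4 := congrFun e 4
    simp [pureMul, hc, h2'] at e0 e1 e3 e4
    conv_lhs => rw [vec7_eta (act g.val x)]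
    rw [e0, e1, e3, e4]
  obtain ⟨h, v, hv, e⟩ := parabolic_decomp (key ![1, 0, 0, 0, 0, 0, 0] (by simp [pureMul]))
    (key ![0, 1, 0, 0, 0, 0, 0] (by simp [pureMul]))
  exact ⟨_, v, hv, e⟩

/-- The torus elements of `G₂(k)`. -/
def tor (a b : kˣ) : G2 k := levi (gl2 a 0 0 b (by simp))

theorem act_tor (a b : kˣ) (x : Fin 7 → k) : act (tor a b).val x =
    ![a * x 0, b * x 1, (b⁻¹ * a⁻¹ : kˣ) * x 2, x 3, a * b * x 4, (b⁻¹ : kˣ) * x 5,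
      (a⁻¹ : kˣ) * x 6] := by
  rw [tor, act_levi]
  ext i
  fin_cases i <;> simp [gl2_val] <;> field_simp

variable (k) in
/-- A representative of the reflection in `β`. -/
def nB : G2 k := levi (gl2 0 1 1 0 (by simp))

theorem act_nB (x : Fin 7 → k) : act (nB k).val x = ![x 1, x 0, -x 2, x 3, -x 4, x 6, x 5] := by
  rw [nB, act_levi]
  ext i
  fin_cases i <;> simp [gl2_val]

/-- The conjugation relations from here on serve to follow root elements through words in `nA` and
`nB`. Missing are `nA` on `x_α` and `nB` on `x_β`, where the root becomes negative. -/
theorem nA_xB (r : k) : SemiconjBy (nA k) (xB r) (x3AB r) := by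
  refine G2.ext_act fun x => ?_
  ext i
  fin_cases i <;> simp [act_mul, act_nA, act_xB, act_x3AB] <;> ring

theorem nA_x3AB (r : k) : SemiconjBy (nA k) (x3AB r) (xB r) := by
  refine G2.ext_act fun x => ?_
  ext i
  fin_cases i <;> simp [act_mul, act_nA, act_xB, act_x3AB] <;> ring

theorem nA_xAB (r : k) : SemiconjBy (nA k) (xAB r) (x2AB (-r)) := by
  refine G2.ext_act fun x => ?_
  ext i
  fin_cases i <;> simp [act_mul, act_nA, act_xAB, act_x2AB] <;> ring

theorem nA_x2AB (r : k) : SemiconjBy (nA k) (x2AB r) (xAB (-r)) := by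
  refine G2.ext_act fun x => ?_
  ext i
  fin_cases i <;> simp [act_mul, act_nA, act_xAB, act_x2AB] <;> ring

theorem nA_x3A2B (r : k) : SemiconjBy (nA k) (x3A2B r) (x3A2B (-r)) := by
  refine G2.ext_act fun x => ?_
  ext i
  fin_cases i <;> simp [act_mul, act_nA, act_x3A2B] <;> ring

theorem nB_xA (r : k) : SemiconjBy (nB k) (xA r) (xAB r) := by
  refine G2.ext_act fun x => ?_
  ext i
  fin_cases i <;> simp [act_mul, act_nB, act_xA, act_xAB] <;> ring

theorem nB_xAB (r : k) : SemiconjBy (nB k) (xAB r) (xA r) := by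
  refine G2.ext_act fun x => ?_
  ext i
  fin_cases i <;> simp [act_mul, act_nB, act_xA, act_xAB] <;> ring

theorem nB_x2AB (r : k) : SemiconjBy (nB k) (x2AB r) (x2AB (-r)) := by
  refine G2.ext_act fun x => ?_
  ext i
  fin_cases i <;> simp [act_mul, act_nB, act_x2AB] <;> ring

theorem nB_x3AB (r : k) : SemiconjBy (nB k) (x3AB r) (x3A2B (-r)) := by
  refine G2.ext_act fun x => ?_
  ext i
  fin_cases i <;> simp [act_mul, act_nB, act_x3AB, act_x3A2B] <;> ring

theorem nB_x3A2B (r : k) : SemiconjBy (nB k) (x3A2B r) (x3AB (-r)) := by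
  refine G2.ext_act fun x => ?_
  ext i
  fin_cases i <;> simp [act_mul, act_nB, act_x3AB, act_x3A2B] <;> ring

theorem tor_xA (a b : kˣ) (r : k) : SemiconjBy (tor a b) (xA r) (xA (b * r)) := by
  refine G2.ext_act fun x => ?_
  ext i
  fin_cases i <;> simp [act_mul, act_tor, act_xA] <;> field_simp

theorem tor_xB (a b : kˣ) (r : k) : SemiconjBy (tor a b) (xB r) (xB (a * (b⁻¹ : kˣ) * r)) := by
  refine G2.ext_act fun x => ?_
  ext i
  fin_cases i <;> simp [act_mul, act_tor, act_xB] <;> field_simp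

end Bruhat

/-! ### Reduction of isotropic vectors by the maximal unipotent subgroup -/

section BruhatDecomposition

variable {k : Type u} [Field k] [NeZero (2 : k)]

variable (k) in
/-- Representatives of the cosets of the reflection in `β` in the Weyl group, of minimal length. -/
def weylReps : List (G2 k) :=
  [1, nA k, nB k * nA k, nA k * nB k * nA k, nB k * nA k * nB k * nA k,
    nA k * nB k * nA k * nB k * nA k]

/-- The vectors carried by `U` to a multiple of a basis vector other than `X⁰`. -/
def Reachable (v : Fin 7 → k) : Prop :=
  ∃ u ∈ U k, ∃ w ∈ weylReps k, ∃ c : k, act u.val v = act w.val ![0, 0, 0, 0, c, 0, 0]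

theorem Reachable.of_act {v : Fin 7 → k} {u : G2 k} (hu : u ∈ U k)
    (h : Reachable (act u.val v)) : Reachable v := by
  obtain ⟨u', hu', w, hw, c, e⟩ := h
  exact ⟨u' * u, mul_mem hu' hu, w, hw, c, by rw [Subgroup.coe_mul, act_mul, e]⟩

theorem Reachable.of_eq {v : Fin 7 → k} {w : G2 k} {c : k} (hw : w ∈ weylReps k)
    (h : v = act w.val ![0, 0, 0, 0, c, 0, 0]) : Reachable v :=
  ⟨1, one_mem _, w, hw, c, by rw [OneMemClass.coe_one, act_one, h]⟩

/-- This lemma and the next four are named after the position, in the order `rootOrd`, of the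
leading nonzero coordinate. Root elements clear the coordinates below it one at a time, in an order
that does not spoil those already cleared. When the coordinate paired with the leading one by `bil`
lies below it, that coordinate is zero by isotropy at the end. -/
theorem Reachable.of_coord_six {v : Fin 7 → k} (hiso : bil v v = 0) (hp : v 2 ≠ 0) :
    Reachable v := by
  have s5 : ∀ v : Fin 7 → k, bil v v = 0 → v 2 ≠ 0 → v 6 = 0 → v 5 = 0 → v 3 = 0 → v 1 = 0 → v 0 = 0 → Reachable v := by
    intro v hiso hp h6 h5 h3 h1 h0
    have h4 : v 4 = 0 := by
      refine mul_left_cancel₀ (mul_ne_zero (NeZero.ne (2 : k)) hp) ?_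
      simp only [bil, h6, h5, h3, h1, h0] at hiso
      linear_combination -1 * hiso
    refine Reachable.of_eq (w := nA k * nB k * nA k * nB k * nA k) (c := -v 2) (by simp [weylReps]) ?_
    conv_lhs => rw [vec7_eta v]
    simp [act_mul, act_nA, act_nB, h6, h5, h3, h1, h0, h4]
  have s4 : ∀ v : Fin 7 → k, bil v v = 0 → v 2 ≠ 0 → v 6 = 0 → v 5 = 0 → v 3 = 0 → v 1 = 0 → Reachable v := by
    intro v hiso hp h6 h5 h3 h1
    refine .of_act (x3A2B_mem_U (-(v 0 / v 2))) (s5 _ (by rwa [bil_act]) ?_ ?_ ?_ ?_ ?_ ?_)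
    all_goals simp [act_x3A2B, hp, h6, h5, h3, h1]
  have s3 : ∀ v : Fin 7 → k, bil v v = 0 → v 2 ≠ 0 → v 6 = 0 → v 5 = 0 → v 3 = 0 → Reachable v := by
    intro v hiso hp h6 h5 h3
    refine .of_act (x3AB_mem_U (-(v 1 / v 2))) (s4 _ (by rwa [bil_act]) ?_ ?_ ?_ ?_ ?_)
    all_goals simp [act_x3AB, hp, h6, h5, h3]
  have s2 : ∀ v : Fin 7 → k, bil v v = 0 → v 2 ≠ 0 → v 6 = 0 → v 5 = 0 → Reachable v := by
    intro v hiso hp h6 h5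
    refine .of_act (x2AB_mem_U (v 3 / v 2)) (s3 _ (by rwa [bil_act]) ?_ ?_ ?_ ?_)
    all_goals simp [act_x2AB, hp, h6, h5]
  have s1 : ∀ v : Fin 7 → k, bil v v = 0 → v 2 ≠ 0 → v 6 = 0 → Reachable v := by
    intro v hiso hp h6
    refine .of_act (xAB_mem_U (-(v 5 / v 2))) (s2 _ (by rwa [bil_act]) ?_ ?_ ?_)
    all_goals simp [act_xAB, hp, h6]
  refine .of_act (xA_mem_U (v 6 / v 2)) (s1 _ (by rwa [bil_act]) ?_ ?_)
  all_goals simp [act_xA, hp]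

theorem Reachable.of_coord_five {v : Fin 7 → k} (hiso : bil v v = 0) (hp : v 6 ≠ 0) (h2 : v 2 = 0) :
    Reachable v := by
  have s4 : ∀ v : Fin 7 → k, bil v v = 0 → v 6 ≠ 0 → v 2 = 0 → v 5 = 0 → v 3 = 0 → v 1 = 0 → v 4 = 0 → Reachable v := by
    intro v hiso hp h2 h5 h3 h1 h4
    have h0 : v 0 = 0 := by
      refine mul_left_cancel₀ (mul_ne_zero (NeZero.ne (2 : k)) hp) ?_
      simp only [bil, h2, h5, h3, h1, h4] at hiso
      linear_combination hiso
    refine Reachable.of_eq (w := nB k * nA k * nB k * nA k) (c := v 6) (by simp [weylReps]) ?_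
    conv_lhs => rw [vec7_eta v]
    simp [act_mul, act_nA, act_nB, h2, h5, h3, h1, h4, h0]
  have s3 : ∀ v : Fin 7 → k, bil v v = 0 → v 6 ≠ 0 → v 2 = 0 → v 5 = 0 → v 3 = 0 → v 1 = 0 → Reachable v := by
    intro v hiso hp h2 h5 h3 h1
    refine .of_act (x3A2B_mem_U (-(v 4 / v 6))) (s4 _ (by rwa [bil_act]) ?_ ?_ ?_ ?_ ?_ ?_)
    all_goals simp [act_x3A2B, hp, h2, h5, h3, h1]
  have s2 : ∀ v : Fin 7 → k, bil v v = 0 → v 6 ≠ 0 → v 2 = 0 → v 5 = 0 → v 3 = 0 → Reachable v := by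
    intro v hiso hp h2 h5 h3
    refine .of_act (x2AB_mem_U (-(v 1 / v 6))) (s3 _ (by rwa [bil_act]) ?_ ?_ ?_ ?_ ?_)
    all_goals simp [act_x2AB, hp, h2, h5, h3]
  have s1 : ∀ v : Fin 7 → k, bil v v = 0 → v 6 ≠ 0 → v 2 = 0 → v 5 = 0 → Reachable v := by
    intro v hiso hp h2 h5
    refine .of_act (xAB_mem_U (-(v 3 / v 6))) (s2 _ (by rwa [bil_act]) ?_ ?_ ?_ ?_)
    all_goals simp [act_xAB, hp, h2, h5]
  refine .of_act (xB_mem_U (v 5 / v 6)) (s1 _ (by rwa [bil_act]) ?_ ?_ ?_)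
  all_goals simp [act_xB, hp, h2]

theorem Reachable.of_coord_four {v : Fin 7 → k} (hiso : bil v v = 0) (hp : v 5 ≠ 0) (h2 : v 2 = 0) (h6 : v 6 = 0) :
    Reachable v := by
  have s3 : ∀ v : Fin 7 → k, bil v v = 0 → v 5 ≠ 0 → v 2 = 0 → v 6 = 0 → v 3 = 0 → v 0 = 0 → v 4 = 0 → Reachable v := by
    intro v hiso hp h2 h6 h3 h0 h4
    have h1 : v 1 = 0 := by
      refine mul_left_cancel₀ (mul_ne_zero (NeZero.ne (2 : k)) hp) ?_
      simp only [bil, h2, h6, h3, h0, h4] at hiso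
      linear_combination hiso
    refine Reachable.of_eq (w := nA k * nB k * nA k) (c := v 5) (by simp [weylReps]) ?_
    conv_lhs => rw [vec7_eta v]
    simp [act_mul, act_nA, act_nB, h2, h6, h3, h0, h4, h1]
  have s2 : ∀ v : Fin 7 → k, bil v v = 0 → v 5 ≠ 0 → v 2 = 0 → v 6 = 0 → v 3 = 0 → v 0 = 0 → Reachable v := by
    intro v hiso hp h2 h6 h3 h0
    refine .of_act (x3AB_mem_U (-(v 4 / v 5))) (s3 _ (by rwa [bil_act]) ?_ ?_ ?_ ?_ ?_ ?_)
    all_goals simp [act_x3AB, hp, h2, h6, h3, h0]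
  have s1 : ∀ v : Fin 7 → k, bil v v = 0 → v 5 ≠ 0 → v 2 = 0 → v 6 = 0 → v 3 = 0 → Reachable v := by
    intro v hiso hp h2 h6 h3
    refine .of_act (x2AB_mem_U (v 0 / v 5)) (s2 _ (by rwa [bil_act]) ?_ ?_ ?_ ?_ ?_)
    all_goals simp [act_x2AB, hp, h2, h6, h3]
  refine .of_act (xA_mem_U (-(v 3 / v 5))) (s1 _ (by rwa [bil_act]) ?_ ?_ ?_ ?_)
  all_goals simp [act_xA, hp, h2, h6]

theorem Reachable.of_coord_two {v : Fin 7 → k} (hiso : bil v v = 0) (hp : v 1 ≠ 0) (h2 : v 2 = 0) (h6 : v 6 = 0) (h5 : v 5 = 0) (h3 : v 3 = 0) :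
    Reachable v := by
  have s2 : ∀ v : Fin 7 → k, bil v v = 0 → v 1 ≠ 0 → v 2 = 0 → v 6 = 0 → v 5 = 0 → v 3 = 0 → v 0 = 0 → v 4 = 0 → Reachable v := by
    intro v hiso hp h2 h6 h5 h3 h0 h4
    refine Reachable.of_eq (w := nB k * nA k) (c := v 1) (by simp [weylReps]) ?_
    conv_lhs => rw [vec7_eta v]
    simp [act_mul, act_nA, act_nB, h2, h6, h5, h3, h0, h4]
  have s1 : ∀ v : Fin 7 → k, bil v v = 0 → v 1 ≠ 0 → v 2 = 0 → v 6 = 0 → v 5 = 0 → v 3 = 0 → v 0 = 0 → Reachable v := by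
    intro v hiso hp h2 h6 h5 h3 h0
    refine .of_act (xAB_mem_U (-(v 4 / v 1))) (s2 _ (by rwa [bil_act]) ?_ ?_ ?_ ?_ ?_ ?_ ?_)
    all_goals simp [act_xAB, hp, h2, h6, h5, h3, h0]
  refine .of_act (xB_mem_U (-(v 0 / v 1))) (s1 _ (by rwa [bil_act]) ?_ ?_ ?_ ?_ ?_ ?_)
  all_goals simp [act_xB, hp, h2, h6, h5, h3]

theorem Reachable.of_coord_one {v : Fin 7 → k} (hiso : bil v v = 0) (hp : v 0 ≠ 0) (h2 : v 2 = 0) (h6 : v 6 = 0) (h5 : v 5 = 0) (h3 : v 3 = 0) (h1 : v 1 = 0) :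
    Reachable v := by
  have s1 : ∀ v : Fin 7 → k, bil v v = 0 → v 0 ≠ 0 → v 2 = 0 → v 6 = 0 → v 5 = 0 → v 3 = 0 → v 1 = 0 → v 4 = 0 → Reachable v := by
    intro v hiso hp h2 h6 h5 h3 h1 h4
    refine Reachable.of_eq (w := nA k) (c := v 0) (by simp [weylReps]) ?_
    conv_lhs => rw [vec7_eta v]
    simp [act_nA, h2, h6, h5, h3, h1, h4]
  refine .of_act (xA_mem_U (v 4 / v 0)) (s1 _ (by rwa [bil_act]) ?_ ?_ ?_ ?_ ?_ ?_ ?_)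
  all_goals simp [act_xA, hp, h2, h6, h5, h3, h1]
-- The coordinate of `X⁰`, in position three, cannot lead: if those above it vanish, isotropy gives
-- `2 * v 3 ^ 2 = 0`. The six other positions correspond to the six elements of `weylReps`.
theorem reachable_of_isotropic {v : Fin 7 → k} (hiso : bil v v = 0) : Reachable v := by
  have h2' : (2 : k) ≠ 0 := NeZero.ne _
  by_cases h2 : v 2 = 0
  swap; · exact .of_coord_six hiso h2
  by_cases h6 : v 6 = 0
  swap; · exact .of_coord_five hiso h6 h2
  by_cases h5 : v 5 = 0
  swap; · exact .of_coord_four hiso h5 h2 h6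
  have h3 : v 3 = 0 := by simpa [bil, h2, h6, h5, h2'] using hiso
  by_cases h1 : v 1 = 0
  swap; · exact .of_coord_two hiso h1 h2 h6 h5 h3
  by_cases h0 : v 0 = 0
  swap; · exact .of_coord_one hiso h0 h2 h6 h5 h3 h1
  refine Reachable.of_eq (w := 1) (c := v 4) (by simp [weylReps]) ?_
  conv_lhs => rw [vec7_eta v]
  simp [act_one, h0, h1, h2, h3, h5, h6]

end BruhatDecomposition

/-! ### Bruhat decomposition and uniqueness of Whittaker functionals for `G₂(k)` -/

section WhittakerUniqueness

variable {k : Type u} [Field k] [NeZero (2 : k)]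

/-- In these chains a simple root is moved one reflection at a time, `β` through long roots and `α`
through short ones. The longest word of each chain returns to the same simple root with the sign
`-1`, the source of the conditions in `theta_long` and `theta_short`. -/
theorem nBnA_xB (r : k) : SemiconjBy (nB k * nA k) (xB r) (x3A2B (-r)) :=
  (nB_x3AB r).mul_left (nA_xB r)

theorem nAnBnA_xB (r : k) : SemiconjBy (nA k * nB k * nA k) (xB r) (x3A2B r) := by
  simpa [mul_assoc] using (nA_x3A2B (-r)).mul_left (nBnA_xB r)

theorem nBnAnBnA_xB (r : k) : SemiconjBy (nB k * nA k * nB k * nA k) (xB r) (x3AB (-r)) := by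
  simpa [mul_assoc] using (nB_x3A2B r).mul_left (nAnBnA_xB r)

theorem nAnBnAnBnA_xB (r : k) :
    SemiconjBy (nA k * nB k * nA k * nB k * nA k) (xB r) (xB (-r)) := by
  simpa [mul_assoc] using (nA_x3AB (-r)).mul_left (nBnAnBnA_xB r)

theorem nAnB_xA (r : k) : SemiconjBy (nA k * nB k) (xA r) (x2AB (-r)) :=
  (nA_xAB r).mul_left (nB_xA r)

theorem nBnAnB_xA (r : k) : SemiconjBy (nB k * nA k * nB k) (xA r) (x2AB r) := by
  simpa [mul_assoc] using (nB_x2AB (-r)).mul_left (nAnB_xA r)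

theorem nAnBnAnB_xA (r : k) : SemiconjBy (nA k * nB k * nA k * nB k) (xA r) (xAB (-r)) := by
  simpa [mul_assoc] using (nA_x2AB r).mul_left (nBnAnB_xA r)

theorem nBnAnBnAnB_xA (r : k) :
    SemiconjBy (nB k * nA k * nB k * nA k * nB k) (xA r) (xA (-r)) := by
  simpa [mul_assoc] using (nB_xAB (-r)).mul_left (nAnBnAnB_xA r)

/-- A representative of minimal length in its coset of the reflection in `β` keeps `β` positive. -/
theorem weylReps_xB {w : G2 k} (hw : w ∈ weylReps k) (r : k) :
    ∃ u ∈ U k, SemiconjBy w (xB r) u := by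
  simp only [weylReps, List.mem_cons, List.not_mem_nil, or_false] at hw
  rcases hw with rfl | rfl | rfl | rfl | rfl | rfl
  · exact ⟨_, xB_mem_U r, SemiconjBy.one_left _⟩
  · exact ⟨_, x3AB_mem_U _, nA_xB r⟩
  · exact ⟨_, x3A2B_mem_U _, nBnA_xB r⟩
  · exact ⟨_, x3A2B_mem_U _, nAnBnA_xB r⟩
  · exact ⟨_, x3AB_mem_U _, nBnAnBnA_xB r⟩
  · exact ⟨_, xB_mem_U _, nAnBnAnBnA_xB r⟩

/-- The Bruhat decomposition of `G₂(k)`. -/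
theorem bruhat (g : G2 k) : ∃ u ∈ U k, ∃ u' ∈ U k, ∃ w ∈ weylReps k, ∃ e, (e = 1 ∨ e = nB k) ∧
    ∃ a b, g = u * (w * e * tor a b) * u' := by
  -- The stabilizer of the line of `e₃⁻` is the parabolic subgroup with unipotent radical `V`;
  -- moving `g e₃⁻` to `w (c e₃⁻)` puts `w⁻¹ u g` into it, and the decomposition of `GL₂(k)`
  -- finishes.
  obtain ⟨u, hu, w, hw, c, h⟩ := reachable_of_isotropic
    (v := act g.val ![0, 0, 0, 0, 1, 0, 0]) (by rw [bil_act]; simp [bil])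
  obtain ⟨a, v, hv, e⟩ := parabolic_decomp_of_line (g := w⁻¹ * u * g) (c := c) (by
    rw [Subgroup.coe_mul, Subgroup.coe_mul, act_mul, act_mul, h, Subgroup.coe_inv, act_inv_act])
  have hg : g = u⁻¹ * w * levi a * v := by
    rw [mul_assoc, ← e]
    group
  rw [hg]
  rcases gl2_bruhat a with ⟨p, q, y, rfl⟩ | ⟨x, s, b, y, rfl⟩
  · refine ⟨u⁻¹, inv_mem hu, xB y * v, mul_mem (xB_mem_U _) (V_le_U hv), w, hw, 1, .inl rfl,
      p, q, ?_⟩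
    rw [levi_mul, levi_nGL2, tor]
    group
  · obtain ⟨u₁, hu₁, hr⟩ := weylReps_xB hw x
    refine ⟨u⁻¹ * u₁, mul_mem (inv_mem hu) hu₁, xB y * v, mul_mem (xB_mem_U _) (V_le_U hv), w, hw,
      nB k, .inr rfl, s, b, ?_⟩
    rw [levi_mul, levi_mul, levi_mul, levi_nGL2, levi_nGL2, tor, nB]
    calc _ = u⁻¹ * (w * xB x) * levi (gl2 0 1 1 0 (by simp)) * levi (gl2 (s : k) 0 0 b (by simp)) *
          xB y * v := by group
      _ = _ := by rw [hr.eq]; group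

/-- The anti-automorphism `g ↦ t₀ g⁻¹ t₀⁻¹` of `G₂(k)`, where `α(t₀) = β(t₀) = -1`. -/
def theta (g : G2 k) : G2 k := tor 1 (-1) * g⁻¹ * (tor 1 (-1))⁻¹

theorem theta_mul (g h : G2 k) : theta (g * h) = theta h * theta g := by
  simp only [theta]
  group

theorem theta_inv (g : G2 k) : theta g⁻¹ = (theta g)⁻¹ := by
  simp only [theta]
  group

theorem theta_one : theta (1 : G2 k) = 1 := by
  simp [theta]

/-- Clears the inverses in `theta`, so that its values are checked by computing in coordinates. -/
theorem theta_eq {g h : G2 k} (H : h * tor 1 (-1) * g = tor 1 (-1)) : theta g = h := by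
  rw [theta, mul_inv_eq_iff_eq_mul, mul_inv_eq_iff_eq_mul, H]

theorem theta_theta (g : G2 k) : theta (theta g) = g := by
  have h : tor 1 (-1) * tor 1 (-1) = (1 : G2 k) := by
    refine G2.ext_act fun x => ?_
    ext i
    fin_cases i <;> simp [act_mul, act_tor, act_one]
  rw [theta, theta]
  calc _ = (tor 1 (-1) * tor 1 (-1)) * g * (tor 1 (-1) * tor 1 (-1))⁻¹ := by group
    _ = g := by rw [h]; group

theorem theta_xA (r : k) : theta (xA r) = xA r := by
  refine theta_eq (G2.ext_act fun x => ?_)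
  ext i
  fin_cases i <;> simp [act_mul, act_tor, act_xA] <;> ring

theorem theta_xB (r : k) : theta (xB r) = xB r := by
  refine theta_eq (G2.ext_act fun x => ?_)
  ext i
  fin_cases i <;> simp [act_mul, act_tor, act_xB]

theorem theta_xAB (r : k) : theta (xAB r) = xAB (-r) := by
  refine theta_eq (G2.ext_act fun x => ?_)
  ext i
  fin_cases i <;> simp [act_mul, act_tor, act_xAB] <;> ring

theorem theta_x2AB (r : k) : theta (x2AB r) = x2AB r := by
  refine theta_eq (G2.ext_act fun x => ?_)
  ext i
  fin_cases i <;> simp [act_mul, act_tor, act_x2AB] <;> ring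

theorem theta_x3AB (r : k) : theta (x3AB r) = x3AB (-r) := by
  refine theta_eq (G2.ext_act fun x => ?_)
  ext i
  fin_cases i <;> simp [act_mul, act_tor, act_x3AB]

theorem theta_x3A2B (r : k) : theta (x3A2B r) = x3A2B r := by
  refine theta_eq (G2.ext_act fun x => ?_)
  ext i
  fin_cases i <;> simp [act_mul, act_tor, act_x3A2B]

theorem psiU_mul (ψ : AddChar k ℂ) {u v : G2 k} (hu : u ∈ U k) (hv : v ∈ U k)
    (h : u * v ∈ U k) : psiU ψ ⟨u * v, h⟩ = psiU ψ ⟨u, hu⟩ * psiU ψ ⟨v, hv⟩ :=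
  map_mul (psiU ψ) ⟨u, hu⟩ ⟨v, hv⟩

theorem psiU_inv (ψ : AddChar k ℂ) {u : G2 k} (hu : u ∈ U k) (h : u⁻¹ ∈ U k) :
    psiU ψ ⟨u⁻¹, h⟩ = (psiU ψ ⟨u, hu⟩)⁻¹ := by
  refine eq_inv_of_mul_eq_one_left ?_
  rw [← map_mul, ← map_one (psiU ψ)]
  congr 1
  exact Subtype.ext (inv_mul_cancel u)

/-- On the simple root subgroups the sign `-1` of `t₀` undoes the inversion, so `theta` fixes them
pointwise. On the others a sign may remain, but the character is trivial there. -/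
theorem theta_mem_U (ψ : AddChar k ℂ) {u : G2 k} (hu : u ∈ U k) :
    ∃ h : theta u ∈ U k, psiU ψ ⟨theta u, h⟩ = psiU ψ ⟨u, hu⟩ := by
  have key : ∀ {x y : G2 k} (hx : x ∈ U k) (hy : y ∈ U k), theta x = y →
      psiU ψ ⟨y, hy⟩ = psiU ψ ⟨x, hx⟩ → ∃ h, psiU ψ ⟨theta x, h⟩ = psiU ψ ⟨x, hx⟩ := by
    rintro x y hx hy rfl h
    exact ⟨hy, h⟩
  induction hu using Subgroup.closure_induction with
  | mem x hx =>
    rcases hx with ((((⟨r, rfl⟩ | ⟨r, rfl⟩) | ⟨r, rfl⟩) | ⟨r, rfl⟩) | ⟨r, rfl⟩) | ⟨r, rfl⟩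
    · exact key _ (xA_mem_U r) (theta_xA r) rfl
    · exact key _ (xB_mem_U r) (theta_xB r) rfl
    · exact key _ (xAB_mem_U _) (theta_xAB r) ((psiU_xAB ψ _ _).trans (psiU_xAB ψ r _).symm)
    · exact key _ (x2AB_mem_U r) (theta_x2AB r) rfl
    · exact key _ (x3AB_mem_U _) (theta_x3AB r) ((psiU_x3AB ψ _ _).trans (psiU_x3AB ψ r _).symm)
    · exact key _ (x3A2B_mem_U r) (theta_x3A2B r) rfl
  | one => exact key _ (one_mem _) theta_one rfl
  | mul x y hx hy ihx ihy =>
    obtain ⟨h1, e1⟩ := ihx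
    obtain ⟨h2, e2⟩ := ihy
    refine key (mul_mem hx hy) (mul_mem h2 h1) (theta_mul x y) ?_
    rw [psiU_mul ψ h2 h1, psiU_mul ψ hx hy, mul_comm, ← e1, ← e2]
  | inv x hx ih =>
    obtain ⟨h1, e1⟩ := ih
    refine key (inv_mem hx) (inv_mem h1) (theta_inv x) ?_
    rw [psiU_inv ψ h1, psiU_inv ψ hx, ← e1]

theorem exists_psiU_ne {ψ : AddChar k ℂ} (hψ : ψ ≠ 1) {n : G2 k} {γ δ : k → G2 k} {c : k}
    (hc : c ≠ 1) (hγ : ∀ r, ∃ h, psiU ψ ⟨γ r, h⟩ = ψ r)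
    (hδ : ∀ r, ∃ h, psiU ψ ⟨δ r, h⟩ = ψ (c * r)) (H : ∀ r, SemiconjBy n (γ r) (δ r)) :
    ∃ a b : U k, n * a = b * n ∧ psiU ψ a ≠ psiU ψ b := by
  obtain ⟨r, hr⟩ := exists_apply_ne_apply_mul hψ hc
  obtain ⟨h1, e1⟩ := hγ r
  obtain ⟨h2, e2⟩ := hδ r
  exact ⟨⟨_, h1⟩, ⟨_, h2⟩, H r, by rwa [e1, e2]⟩

theorem theta_long (a : kˣ) (b : kˣ) (h : (a : k) = -b) :
    theta (nA k * nB k * nA k * nB k * nA k * tor a b) =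
      nA k * nB k * nA k * nB k * nA k * tor a b := by
  obtain rfl : a = -b := Units.ext h
  refine theta_eq (G2.ext_act fun x => ?_)
  ext i
  fin_cases i <;> simp [act_mul, act_tor, act_nA, act_nB] <;> field_simp

theorem theta_short (a b : kˣ) (h : (b : k) = -1) :
    theta (nB k * nA k * nB k * nA k * nB k * tor a b) =
      nB k * nA k * nB k * nA k * nB k * tor a b := by
  obtain rfl : b = -1 := Units.ext h
  refine theta_eq (G2.ext_act fun x => ?_)
  ext i
  fin_cases i <;> simp [act_mul, act_tor, act_nA, act_nB]

theorem theta_longest (a b : kˣ) :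
    theta (nA k * nB k * nA k * nB k * nA k * nB k * tor a b) =
      nA k * nB k * nA k * nB k * nA k * nB k * tor a b := by
  refine theta_eq (G2.ext_act fun x => ?_)
  ext i
  fin_cases i <;> simp [act_mul, act_tor, act_nA, act_nB] <;> field_simp

theorem tor_one : tor 1 1 = (1 : G2 k) := by
  refine G2.ext_act fun x => ?_
  ext i
  fin_cases i <;> simp [act_tor, act_one]

theorem exists_psiU_ne_of_eq_one {ψ : AddChar k ℂ} (hψ : ψ ≠ 1) {n : G2 k} {γ : k → G2 k}
    (δ : k → G2 k) (hγ : ∀ r, ∃ h, psiU ψ ⟨γ r, h⟩ = ψ r)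
    (hδ : ∀ r, ∃ h, psiU ψ ⟨δ r, h⟩ = 1) (H : ∀ r, SemiconjBy n (γ r) (δ r)) :
    ∃ a b : U k, n * a = b * n ∧ psiU ψ a ≠ psiU ψ b :=
  exists_psiU_ne hψ zero_ne_one hγ
    (fun r => by simpa only [zero_mul, AddChar.map_zero_eq_one] using hδ r) H

/-- A representative that carries a simple root subgroup to a positive root subgroup which is not
simple is killed, since the character is nontrivial on the first and trivial on the second. Four
kinds remain. For `w * e = 1` and for the two words of length five, a simple root is carried to
itself up to sign, and the representative is killed unless the torus part satisfies `a = b = 1`,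
respectively `a = -b` or `b = -1`; in these cases it is fixed by `theta`. The longest word is always
fixed. -/
theorem theta_or_kill {ψ : AddChar k ℂ} (hψ : ψ ≠ 1) {w e : G2 k} (hw : w ∈ weylReps k)
    (he : e = 1 ∨ e = nB k) (a b : kˣ) :
    theta (w * e * tor a b) = w * e * tor a b ∨
      ∃ x y : U k, w * e * tor a b * x = y * (w * e * tor a b) ∧ psiU ψ x ≠ psiU ψ y := by
  have hA : ∀ r, ∃ h, psiU ψ ⟨xA r, h⟩ = ψ r := fun r => ⟨xA_mem_U r, psiU_xA ψ r _⟩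
  have hB : ∀ r, ∃ h, psiU ψ ⟨xB r, h⟩ = ψ r := fun r => ⟨xB_mem_U r, psiU_xB ψ r _⟩
  have hAB : ∀ r, ∃ h, psiU ψ ⟨xAB r, h⟩ = 1 := fun r => ⟨xAB_mem_U r, psiU_xAB ψ r _⟩
  have h2AB : ∀ r, ∃ h, psiU ψ ⟨x2AB r, h⟩ = 1 := fun r => ⟨x2AB_mem_U r, psiU_x2AB ψ r _⟩
  have h3AB : ∀ r, ∃ h, psiU ψ ⟨x3AB r, h⟩ = 1 := fun r => ⟨x3AB_mem_U r, psiU_x3AB ψ r _⟩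
  have h3A2B : ∀ r, ∃ h, psiU ψ ⟨x3A2B r, h⟩ = 1 := fun r => ⟨x3A2B_mem_U r, psiU_x3A2B ψ r _⟩
  simp only [weylReps, List.mem_cons, List.not_mem_nil, or_false] at hw
  rcases he with rfl | rfl
  · rw [mul_one]
    have killB : ∀ δ : k → G2 k, (∀ r, ∃ h, psiU ψ ⟨δ r, h⟩ = 1) →
        (∀ r, SemiconjBy w (xB r) (δ r)) → _ := fun δ hδ H =>
      exists_psiU_ne_of_eq_one hψ (n := w * tor a b) (fun r => δ (a * (b⁻¹ : kˣ) * r)) hB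
        (fun r => hδ _) fun r => (H _).mul_left (tor_xB a b r)
    rcases hw with rfl | rfl | rfl | rfl | rfl | rfl
    · rw [one_mul]
      by_cases hb : (b : k) = 1
      · obtain rfl : b = 1 := Units.ext hb
        by_cases ha : (a : k) = 1
        · obtain rfl : a = 1 := Units.ext ha
          exact .inl (by rw [tor_one, theta_one])
        · exact .inr (exists_psiU_ne hψ (c := a) ha hB (fun r => hB _)
            (fun r => by simpa using tor_xB a 1 r))
      · exact .inr (exists_psiU_ne hψ (c := b) hb hA (fun r => hA _) (fun r => tor_xA a b r))
    · exact .inr (killB _ h3AB nA_xB)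
    · exact .inr (killB (fun r => x3A2B (-r)) (fun r => h3A2B (-r)) nBnA_xB)
    · exact .inr (killB _ h3A2B nAnBnA_xB)
    · exact .inr (killB (fun r => x3AB (-r)) (fun r => h3AB (-r)) nBnAnBnA_xB)
    · by_cases h : (a : k) = -b
      · exact .inl (theta_long a b h)
      · refine .inr (exists_psiU_ne hψ (c := -(a * (b⁻¹ : kˣ)))
          (δ := fun r => xB (-(a * (b⁻¹ : kˣ)) * r)) ?_ hB
          (fun r => hB (-(a * (b⁻¹ : kˣ)) * r)) fun r => ?_)
        · intro h'
          refine h ?_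
          have hb := b.mul_inv
          linear_combination -b.val * h' - a.val * hb
        · have := (nAnBnAnBnA_xB (a * (b⁻¹ : kˣ) * r)).mul_left (tor_xB a b r)
          rwa [← neg_mul] at this
  · have killA : ∀ δ : k → G2 k, (∀ r, ∃ h, psiU ψ ⟨δ r, h⟩ = 1) →
        (∀ r, SemiconjBy (w * nB k) (xA r) (δ r)) → _ := fun δ hδ H =>
      exists_psiU_ne_of_eq_one hψ (n := w * nB k * tor a b) (fun r => δ (b * r)) hA
        (fun r => hδ _) fun r => (H _).mul_left (tor_xA a b r)
    rcases hw with rfl | rfl | rfl | rfl | rfl | rfl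
    · exact .inr (killA _ hAB fun r => (SemiconjBy.one_left _).mul_left (nB_xA r))
    · exact .inr (killA (fun r => x2AB (-r)) (fun r => h2AB (-r)) nAnB_xA)
    · exact .inr (killA _ h2AB nBnAnB_xA)
    · exact .inr (killA (fun r => xAB (-r)) (fun r => hAB (-r)) nAnBnAnB_xA)
    · by_cases h : (b : k) = -1
      · exact .inl (theta_short a b h)
      · refine .inr (exists_psiU_ne hψ (c := -b) (δ := fun r => xA (-b * r)) (fun h' => h ?_) hA (fun r => hA (-b * r)) fun r => ?_)
        · rw [← h', neg_neg]
        · have := (nBnAnBnAnB_xA (b * r)).mul_left (tor_xA a b r)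
          rwa [← neg_mul] at this
    · exact .inl (theta_longest a b)

instance [Finite k] : Finite (SO7 k) := Subtype.finite

instance [Finite k] : Finite (G2 k) := Subtype.finite

/-- Uniqueness of Whittaker functionals for `G₂(k)`. -/
theorem IsWhittaker.unique [Finite k] {X : Type*} [AddCommGroup X] [Module ℂ X]
    {ρ : Representation ℂ (G2 k) X} (hρ : ρ.IsIrreducible) {ψ : AddChar k ℂ} (hψ : ψ ≠ 1)
    {l l' : X →ₗ[ℂ] ℂ} (hl : IsWhittaker ρ ψ l) (hl' : IsWhittaker ρ ψ l') (h0 : l ≠ 0) :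
    ∃ c : ℂ, l' = c • l := by
  have := Fintype.ofFinite (U k)
  let f : U k → U k := fun u => ⟨theta u.val, (theta_mem_U ψ u.2).1⟩
  have hf : Function.Involutive f := fun u => Subtype.ext (theta_theta u.val)
  refine exists_eq_smul_of_anti (ι := (U k).subtype) (χ := psiU ψ) hρ theta_mul
    (σ := hf.toPerm f) (fun s => rfl) (fun s => (theta_mem_U ψ s.2).2) ?_ hl hl' h0
  intro g
  obtain ⟨u, hu, u', hu', w, hw, e, he, a, b, rfl⟩ := bruhat g
  exact ⟨⟨u, hu⟩, ⟨u', hu'⟩, _, rfl, theta_or_kill hψ hw he a b⟩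

end WhittakerUniqueness

/-! ### Whittaker functionals of `GL₂(k)` -/

section GL2Uniqueness

variable {k : Type u} [Field k]

theorem glStar_val (a : GL (Fin 2) k) :
    (glStar a).val = antidiag2 k * a⁻¹.valᵀ * antidiag2 k := rfl

theorem glStar_mul (a b : GL (Fin 2) k) : glStar (a * b) = glStar a * glStar b := by
  refine Units.ext ?_
  rw [Units.val_mul, glStar_val, glStar_val, glStar_val, _root_.mul_inv_rev, Units.val_mul,
    transpose_mul]
  calc _ = antidiag2 k * a⁻¹.valᵀ * 1 * b⁻¹.valᵀ * antidiag2 k := by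
        simp only [Matrix.mul_assoc, Matrix.one_mul]
    _ = _ := by rw [← antidiag2_mul_self]; simp only [Matrix.mul_assoc]

theorem glStar_one : glStar (1 : GL (Fin 2) k) = 1 := by
  refine Units.ext ?_
  simp [glStar_val, antidiag2_mul_self]

theorem glStar_inv_val (a : GL (Fin 2) k) :
    (glStar a⁻¹).val = !![a.val 1 1, a.val 0 1; a.val 1 0, a.val 0 0] := by
  rw [glStar_val, inv_inv]
  ext i j
  fin_cases i <;> fin_cases j <;>
  simp [antidiag2, Matrix.mul_apply, Fin.sum_univ_two, Matrix.vecMul, dotProduct]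

theorem nGL2_add (x y : k) : nGL2 (x + y) = nGL2 x * nGL2 y := by
  refine gl2_ext ?_ ?_ ?_ ?_ <;> simp [nGL2_val, add_comm]

theorem nGL2_zero : nGL2 (0 : k) = 1 := by
  refine gl2_ext ?_ ?_ ?_ ?_ <;> simp [nGL2_val]

variable (k) in
/-- The upper triangular unipotent subgroup of `GL₂(k)`. -/
def nGL2Hom : Multiplicative k →* GL (Fin 2) k where
  toFun x := nGL2 x.toAdd
  map_one' := nGL2_zero
  map_mul' _ _ := nGL2_add _ _

/-- Uniqueness of Whittaker functionals for `GL₂(k)`. -/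
theorem IsWhittakerGL2.unique [Finite k] {Y : Type*} [AddCommGroup Y] [Module ℂ Y]
    {τ : Representation ℂ (GL (Fin 2) k) Y} (hτ : τ.IsIrreducible) {ψ : AddChar k ℂ} (hψ : ψ ≠ 1)
    {l l' : Y →ₗ[ℂ] ℂ} (hl : IsWhittakerGL2 τ ψ l) (hl' : IsWhittakerGL2 τ ψ l') (h0 : l ≠ 0) :
    ∃ c : ℂ, l' = c • l := by
  have := Fintype.ofFinite k
  have : Finite (GL (Fin 2) k) := inferInstance
  -- Here `θ` is `a ↦ J ᵗa J`. It fixes `N` and the antidiagonal matrices pointwise and exchanges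
  -- the two entries `p`, `w` of a diagonal matrix; if these differ, the matrix scales `N` by `p / w
  -- ≠ 1` and is killed.
  refine exists_eq_smul_of_anti (ι := nGL2Hom k) (χ := ψ.toMonoidHom) hτ
    (θ := fun a => glStar a⁻¹) (fun g h => ?_) (σ := Equiv.refl _) (fun s => ?_) (fun s => rfl) ?_
    (fun s v => hl _ v) (fun s v => hl' _ v) h0
  · rw [_root_.mul_inv_rev, glStar_mul]
  · refine Units.ext ?_
    change (glStar (nGL2 _)⁻¹).val = (nGL2 _).val
    rw [glStar_inv_val, nGL2_val]
    simp
    rfl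
  · intro g
    rcases gl2_bruhat g with ⟨p, w, y, h⟩ | ⟨x, s, b, y, h⟩
    · refine ⟨1, .ofAdd y, gl2 (p : k) 0 0 w (by simp), by rw [h, map_one, one_mul]; rfl, ?_⟩
      by_cases hpw : (p : k) = w
      · left
        refine Units.ext ?_
        rw [glStar_inv_val, gl2_val]
        simp [hpw]
      · right
        have hw : (w : k) ≠ 0 := w.ne_zero
        obtain ⟨r, hr⟩ := exists_apply_ne_apply_mul hψ (c := p / w)
          (by rwa [ne_eq, div_eq_one_iff_eq hw])
        refine ⟨.ofAdd r, .ofAdd (p / w * r), ?_, hr⟩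
        change _ * nGL2 r = nGL2 (p / w * r) * _
        refine gl2_ext ?_ ?_ ?_ ?_ <;> simp [gl2_val, nGL2_val]
        field_simp
    · refine ⟨.ofAdd x, .ofAdd y, gl2 0 1 1 0 (by simp) * gl2 (s : k) 0 0 b (by simp), ?_, ?_⟩
      · rw [h, ← mul_assoc]; rfl
      · left
        refine Units.ext ?_
        rw [glStar_inv_val, Units.val_mul, gl2_val, gl2_val]
        ext i j
        fin_cases i <;> fin_cases j <;> simp

end GL2Uniqueness

/-! ### Characters of the unipotent radical `V` -/

section CharactersOfV

variable {k : Type u} [Field k] [NeZero (2 : k)]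

/-- The coordinate of an element of `V` along the root `α`. -/
def coordA (g : G2 k) : k := -act g.val ![1, 0, 0, 0, 0, 0, 0] 4

/-- The coordinate of an element of `V` along the root `α+β`. -/
def coordAB (g : G2 k) : k := act g.val ![0, 1, 0, 0, 0, 0, 0] 4

/-- `V` acts on `⟨e₁⁺, e₂⁺, e₃⁻⟩` by adding multiples of `e₃⁻`, and only `x_α` and `x_{α+β}`
contribute. So the two coordinates are additive on `V`, and where both vanish the element fixes
`e₁⁺` and `e₂⁺`. -/
theorem act_V {g : G2 k} (hg : g ∈ V k) (x y z : k) : act g.val ![x, y, 0, 0, z, 0, 0] =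
    ![x, y, 0, 0, z - coordA g * x + coordAB g * y, 0, 0] := by
  obtain ⟨m, n, h⟩ : ∃ m n : k, ∀ x y z : k, act g.val ![x, y, 0, 0, z, 0, 0] =
      ![x, y, 0, 0, z - m * x + n * y, 0, 0] := by
    induction hg using Subgroup.closure_induction with
    | mem g hg =>
      rcases hg with (((⟨r, rfl⟩ | ⟨r, rfl⟩) | ⟨r, rfl⟩) | ⟨r, rfl⟩) | ⟨r, rfl⟩
      · exact ⟨r, 0, fun x y z => by simp [act_xA]⟩
      · exact ⟨0, r, fun x y z => by simp [act_xAB]⟩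
      · exact ⟨0, 0, fun x y z => by simp [act_x2AB]⟩
      · exact ⟨0, 0, fun x y z => by simp [act_x3AB]⟩
      · exact ⟨0, 0, fun x y z => by simp [act_x3A2B]⟩
    | one => exact ⟨0, 0, fun x y z => by simp [act_one]⟩
    | mul g h _ _ hg hh =>
      obtain ⟨m, n, hg⟩ := hg
      obtain ⟨m', n', hh⟩ := hh
      refine ⟨m + m', n + n', fun x y z => ?_⟩
      rw [Subgroup.coe_mul, act_mul, hh, hg]
      ring_nf
    | inv g _ hg =>
      obtain ⟨m, n, hg⟩ := hg
      refine ⟨-m, -n, fun x y z => act_injective g.val ?_⟩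
      rw [Subgroup.coe_inv, act_act_inv, hg]
      ring_nf
  have h1 : coordA g = m := by rw [coordA, h]; simp
  have h2 : coordAB g = n := by rw [coordAB, h]; simp
  rw [h1, h2, h]

theorem mem_V_of_act {g : G2 k} {m n : k}
    (h0 : act g.val ![1, 0, 0, 0, 0, 0, 0] = ![1, 0, 0, 0, m, 0, 0])
    (h1 : act g.val ![0, 1, 0, 0, 0, 0, 0] = ![0, 1, 0, 0, n, 0, 0]) :
    g ∈ V k ∧ coordA g = -m ∧ coordAB g = n := by
  refine ⟨?_, by simp [coordA, h0], by simp [coordAB, h1]⟩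
  obtain ⟨h, v, hv, rfl⟩ := parabolic_decomp h0 h1
  have : gl2 1 0 0 1 h = 1 := by refine gl2_ext ?_ ?_ ?_ ?_ <;> simp [gl2_val]
  rwa [this, levi_one, one_mul]

theorem coordA_mul {g h : G2 k} (hg : g ∈ V k) (hh : h ∈ V k) :
    coordA (g * h) = coordA g + coordA h := by
  conv_lhs => rw [coordA, Subgroup.coe_mul, act_mul, act_V hh, act_V hg]
  simp

theorem coordAB_mul {g h : G2 k} (hg : g ∈ V k) (hh : h ∈ V k) :
    coordAB (g * h) = coordAB g + coordAB h := by
  conv_lhs => rw [coordAB, Subgroup.coe_mul, act_mul, act_V hh, act_V hg]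
  simp [add_comm]

/-- The Levi subgroup acts on the characters of `V`. -/
theorem levi_conj_V (a : GL (Fin 2) k) {g : G2 k} (hg : g ∈ V k) :
    (levi a)⁻¹ * g * levi a ∈ V k ∧
    coordA ((levi a)⁻¹ * g * levi a) =
      (a.val.det)⁻¹ * (a.val 0 0 * coordA g - a.val 1 0 * coordAB g) ∧
    coordAB ((levi a)⁻¹ * g * levi a) =
      (a.val.det)⁻¹ * (-(a.val 0 1 * coordA g) + a.val 1 1 * coordAB g) := by
  have hd := GL2_det_mul_inv a
  have := mem_V_of_act (g := (levi a)⁻¹ * g * levi a)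
    (m := (a.val.det)⁻¹ * (-(a.val 0 0 * coordA g) + a.val 1 0 * coordAB g))
    (n := (a.val.det)⁻¹ * (-(a.val 0 1 * coordA g) + a.val 1 1 * coordAB g)) ?_ ?_
  · refine ⟨this.1, ?_, this.2.2⟩
    rw [this.2.1]
    ring
  all_goals
    refine act_injective (levi a).val ?_
    rw [Subgroup.coe_mul, Subgroup.coe_mul, act_mul, act_mul, Subgroup.coe_inv, act_act_inv,
      act_levi, act_levi]
    simp only [cons_val, mul_zero, mul_one, add_zero, zero_add, sub_zero]
    rw [act_V hg, ← mul_assoc, hd]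
    ring_nf

/-- A character of `V`. -/
def chiV (ψ : AddChar k ℂ) (s t : k) : V k →* ℂ where
  toFun v := ψ (s * coordA v.val + t * coordAB v.val)
  map_one' := by
    have h1 : coordA (1 : G2 k) = 0 := by simp [coordA, act_one]
    have h2 : coordAB (1 : G2 k) = 0 := by simp [coordAB, act_one]
    rw [OneMemClass.coe_one, h1, h2, mul_zero, mul_zero, add_zero, AddChar.map_zero_eq_one]
  map_mul' v w := by
    rw [← AddChar.map_add_eq_mul, Subgroup.coe_mul, coordA_mul v.2 w.2, coordAB_mul v.2 w.2]
    ring_nf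

theorem chiV_apply (ψ : AddChar k ℂ) (s t : k) (v : V k) :
    chiV ψ s t v = ψ (s * coordA v.val + t * coordAB v.val) := rfl

theorem coord_gen : (∀ r : k, coordA (xA r) = r) ∧ (∀ r : k, coordA (xAB r) = 0) ∧
    (∀ r : k, coordA (x2AB r) = 0) ∧ (∀ r : k, coordA (x3AB r) = 0) ∧
    (∀ r : k, coordA (x3A2B r) = 0) := by
  refine ⟨?_, ?_, ?_, ?_, ?_⟩ <;> intro r <;>
  simp [coordA, act_xA, act_xAB, act_x2AB, act_x3AB, act_x3A2B]

theorem coordA_one : coordA (1 : G2 k) = 0 := by simp [coordA, act_one]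

theorem psiU_of_mem_V (ψ : AddChar k ℂ) {g : G2 k} (hg : g ∈ V k) :
    psiU ψ ⟨g, V_le_U hg⟩ = ψ (coordA g) := by
  obtain ⟨hA, hAB, h2AB, h3AB, h3A2B⟩ := coord_gen (k := k)
  have h0 := AddChar.map_zero_eq_one ψ
  induction hg using Subgroup.closure_induction with
  | mem g hg =>
    rcases hg with (((⟨r, rfl⟩ | ⟨r, rfl⟩) | ⟨r, rfl⟩) | ⟨r, rfl⟩) | ⟨r, rfl⟩
    · exact (psiU_xA ψ r _).trans (by rw [hA])
    · exact (psiU_xAB ψ r _).trans (by rw [hAB, h0])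
    · exact (psiU_x2AB ψ r _).trans (by rw [h2AB, h0])
    · exact (psiU_x3AB ψ r _).trans (by rw [h3AB, h0])
    · exact (psiU_x3A2B ψ r _).trans (by rw [h3A2B, h0])
  | one => exact (map_one (psiU ψ)).trans (by rw [coordA_one, h0])
  | mul g h hg hh ihg ihh =>
    have hg' : g ∈ V k := hg
    have hh' : h ∈ V k := hh
    refine (psiU_mul ψ (V_le_U hg') (V_le_U hh') _).trans ?_
    rw [coordA_mul hg' hh', AddChar.map_add_eq_mul]
    exact congrArg₂ (· * ·) ihg ihh
  | inv g hg ih =>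
    have hg' : g ∈ V k := hg
    refine (psiU_inv ψ (V_le_U hg') _).trans ((congrArg _ ih).trans ?_)
    rw [← AddChar.map_neg_eq_inv]
    congr 1
    have := coordA_mul hg' (inv_mem hg')
    rw [mul_inv_cancel, coordA_one] at this
    linear_combination this

end CharactersOfV

/-! ### Expansion of functionals along Whittaker functionals -/

section Expansion

variable {k : Type u} [Field k] [NeZero (2 : k)]
variable {X : Type*} [AddCommGroup X] [Module ℂ X] {ρ : Representation ℂ (G2 k) X}

/-- An invariant functional factors through the Jacquet module. -/
theorem IsCuspidal.eq_zero_of_invariant (hρ : IsCuspidal ρ) {N : Subgroup (G2 k)}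
    (hN : N = V k ∨ N = V' k ∨ N = U k) {φ : X →ₗ[ℂ] ℂ} (hφ : ∀ n ∈ N, ∀ x, φ (ρ n x) = φ x) :
    φ = 0 := by
  have := hρ N hN
  have h : ∀ n : N, φ ∘ₗ (ρ.comp N.subtype) n = φ := fun n => LinearMap.ext fun x => hφ n n.2 x
  refine LinearMap.ext fun x => ?_
  rw [← Representation.Coinvariants.lift_mk (ρ.comp N.subtype) φ h,
    Subsingleton.elim (Representation.Coinvariants.mk (ρ.comp N.subtype) x) 0, map_zero,
    LinearMap.zero_apply]

/-- A functional invariant under the pointwise stabilizer of the plane `⟨e₁⁺, e₂⁺⟩`. -/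
def FixInvariant (ρ : Representation ℂ (G2 k) X) (φ : X →ₗ[ℂ] ℂ) : Prop :=
  ∀ z : G2 k, act z.val ![1, 0, 0, 0, 0, 0, 0] = ![1, 0, 0, 0, 0, 0, 0] →
    act z.val ![0, 1, 0, 0, 0, 0, 0] = ![0, 1, 0, 0, 0, 0, 0] → ∀ x, φ (ρ z x) = φ x

variable [Finite k]

instance (N : Subgroup (G2 k)) : Fintype N := Fintype.ofFinite _

/-- Fourier inversion on `V`, modulo the pointwise stabilizer of the plane `⟨e₁⁺, e₂⁺⟩`. -/
theorem FixInvariant.exists_chiV {φ : X →ₗ[ℂ] ℂ} (hφ : FixInvariant ρ φ) (h0 : φ ≠ 0)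
    {ψ : AddChar k ℂ} (hψ : ψ ≠ 1) :
    ∃ s t, φ ∘ₗ isotypicSum (V k).subtype (chiV ψ s t) ρ ≠ 0 := by
  classical
  have := Fintype.ofFinite k
  by_contra! H
  refine h0 (LinearMap.ext fun x => ?_)
  have hprim : ψ.IsPrimitive := AddChar.IsPrimitive.of_ne_one hψ
  have hq : (Fintype.card k : ℂ) ≠ 0 := Nat.cast_ne_zero.2 Fintype.card_ne_zero
  -- By orthogonality only the `v` with both coordinates zero survive. They fix `e₁⁺` and `e₂⁺`, so
  -- `φ` does not see them, and the double sum is a nonzero multiple of `φ x`.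
  have key : ∑ s : k, ∑ t : k, φ (isotypicSum (V k).subtype (chiV ψ s t) ρ x) =
      ∑ v : V k, if coordA v.val = 0 ∧ coordAB v.val = 0 then
        (Fintype.card k : ℂ) ^ 2 * φ x else 0 := by
    simp only [isotypicSum, LinearMap.sum_apply, LinearMap.smul_apply, map_sum, map_smul,
      smul_eq_mul]
    rw [Finset.sum_congr rfl fun s _ => Finset.sum_comm, Finset.sum_comm]
    refine Finset.sum_congr rfl fun v _ => ?_
    have e1 : ∀ s t, (chiV ψ s t v)⁻¹ = ψ (s * -coordA v.val) * ψ (t * -coordAB v.val) := by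
      intro s t
      rw [chiV_apply, ← AddChar.map_neg_eq_inv, ← AddChar.map_add_eq_mul]
      ring_nf
    simp only [e1, ← Finset.sum_mul, ← Finset.mul_sum, AddChar.sum_mulShift _ hprim, neg_eq_zero]
    by_cases hA : coordA v.val = 0 <;> by_cases hAB : coordAB v.val = 0 <;> simp [hA, hAB]
    have f0 := act_V v.2 1 0 0
    have f1 := act_V v.2 0 1 0
    rw [hA, hAB] at f0 f1
    rw [hφ v.val (by simpa using f0) (by simpa using f1)]
    ring
  have hz : ∑ s : k, ∑ t : k, φ (isotypicSum (V k).subtype (chiV ψ s t) ρ x) = 0 :=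
    Finset.sum_eq_zero fun s _ => Finset.sum_eq_zero fun t _ => LinearMap.congr_fun (H s t) x
  rw [hz, ← Finset.sum_filter, Finset.sum_const, nsmul_eq_mul] at key
  have hne : ((Finset.univ.filter fun v : V k =>
      coordA v.val = 0 ∧ coordAB v.val = 0).card : ℂ) ≠ 0 := by
    refine Nat.cast_ne_zero.2 (Finset.card_ne_zero.2 ⟨1, ?_⟩)
    simp [coordA, coordAB, act_one]
  simpa [hne, hq] using key.symm

/-- Conjugation by the Levi subgroup on the isotypic projections for `V`. -/
theorem isotypicSum_mul_levi (a : GL (Fin 2) k) (ψ : AddChar k ℂ) {s t s' t' : k}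
    (h : ∀ v ∈ V k, s' * coordA ((levi a)⁻¹ * v * levi a) +
      t' * coordAB ((levi a)⁻¹ * v * levi a) = s * coordA v + t * coordAB v) :
    isotypicSum (V k).subtype (chiV ψ s t) ρ * ρ (levi a) =
      ρ (levi a) * isotypicSum (V k).subtype (chiV ψ s' t') ρ := by
  let e : V k ≃ V k :=
    { toFun := fun v => ⟨(levi a)⁻¹ * v.val * levi a, (levi_conj_V a v.2).1⟩
      invFun := fun v => ⟨levi a * v.val * (levi a)⁻¹, by
        have := (levi_conj_V a⁻¹ v.2).1
        rwa [levi_inv, inv_inv] at this⟩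
      left_inv := fun v => Subtype.ext (by simp only; group)
      right_inv := fun v => Subtype.ext (by simp only; group) }
  rw [isotypicSum, isotypicSum, Finset.sum_mul, Finset.mul_sum]
  refine Fintype.sum_equiv e _ _ fun v => ?_
  have h1 : chiV ψ s' t' (e v) = chiV ψ s t v := congrArg ψ (h v.val v.2)
  rw [h1, smul_mul_assoc, mul_smul_comm, ← map_mul, ← map_mul]
  congr 2
  change v.val * levi a = levi a * ((levi a)⁻¹ * v.val * levi a)
  group

end Expansion

/-! ### Whittaker components of functionals on cuspidal representations -/

section WhittakerExpansion

variable {k : Type u} [Field k] [NeZero (2 : k)]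

variable (k) in
/-- The root subgroup of `β`. -/
def xBHom : Multiplicative k →* G2 k where
  toFun x := xB x.toAdd
  map_one' := by rw [toAdd_one, ← levi_nGL2, nGL2_zero, levi_one]
  map_mul' x y := by rw [toAdd_mul, ← levi_nGL2, nGL2_add, levi_mul, levi_nGL2, levi_nGL2]

theorem xBHom_apply (x : Multiplicative k) : xBHom k x = xB x.toAdd := rfl

variable {X : Type*} [AddCommGroup X] [Module ℂ X] {ρ : Representation ℂ (G2 k) X}

theorem isWhittaker_of {ψ : AddChar k ℂ} {l : X →ₗ[ℂ] ℂ}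
    (hV : ∀ g ∈ V k, ∀ x, l (ρ g x) = ψ (coordA g) * l x)
    (hB : ∀ r x, l (ρ (xB r) x) = ψ r * l x) : IsWhittaker ρ ψ l := by
  have hV' : ∀ g (hg : g ∈ V k) (h : g ∈ U k), ∀ x, l (ρ g x) = psiU ψ ⟨g, h⟩ * l x := by
    intro g hg h x
    rw [hV g hg, ← psiU_of_mem_V ψ hg]
  have key : ∀ g (hg : g ∈ U k), ∀ x, l (ρ g x) = psiU ψ ⟨g, hg⟩ * l x := by
    intro g hg
    induction hg using Subgroup.closure_induction with
    | mem g hg =>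
      rcases hg with ((((⟨r, rfl⟩ | ⟨r, rfl⟩) | ⟨r, rfl⟩) | ⟨r, rfl⟩) | ⟨r, rfl⟩) | ⟨r, rfl⟩
      · exact hV' _ (Subgroup.subset_closure (by simp)) _
      · exact fun x => (hB r x).trans (congrArg (· * l x) (psiU_xB ψ r _).symm)
      all_goals exact hV' _ (Subgroup.subset_closure (by simp)) _
    | one =>
      intro x
      refine Eq.trans ?_ (congrArg (· * l x) (map_one (psiU ψ)).symm)
      simp
    | mul g h hg hh ihg ihh =>
      intro x
      refine Eq.trans ?_ (congrArg (· * l x) (psiU_mul ψ hg hh (mul_mem hg hh)).symm)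
      rw [map_mul, Module.End.mul_apply, ihg, ihh, mul_assoc]
    | inv g hg ih =>
      intro x
      refine Eq.trans ?_ (congrArg (· * l x) (psiU_inv ψ hg (inv_mem hg)).symm)
      have h := ih (ρ g⁻¹ x)
      rw [← Module.End.mul_apply, ← map_mul, mul_inv_cancel, map_one, Module.End.one_apply] at h
      rw [h, inv_mul_cancel_left₀ (character_ne_zero _)]
  exact fun u => key u.val u.2

variable [Finite k]

variable (ρ) in
/-- The projection, up to a scalar, to the `ψ_U`-isotypic part. -/
def whittakerSum (ψ : AddChar k ℂ) : X →ₗ[ℂ] X := isotypicSum (U k).subtype (psiU ψ) ρ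

/-- The additive character `x ↦ ψ(t x)`, as a multiplicative character. -/
def shiftChar (ψ : AddChar k ℂ) (t : k) : Multiplicative k →* ℂ := (ψ.mulShift t).toMonoidHom

theorem shiftChar_apply (ψ : AddChar k ℂ) (t : k) (x : Multiplicative k) :
    shiftChar ψ t x = ψ (t * x.toAdd) := rfl

instance : Fintype (Multiplicative k) := Fintype.ofFinite _

theorem exists_shiftChar {φ : X →ₗ[ℂ] ℂ} (h0 : φ ≠ 0) {ψ : AddChar k ℂ} (hψ : ψ ≠ 1) :
    ∃ t, φ ∘ₗ isotypicSum (xBHom k) (shiftChar ψ t) ρ ≠ 0 := by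
  classical
  have := Fintype.ofFinite k
  by_contra! H
  refine h0 (LinearMap.ext fun x => ?_)
  have hprim : ψ.IsPrimitive := AddChar.IsPrimitive.of_ne_one hψ
  have hq : (Fintype.card k : ℂ) ≠ 0 := Nat.cast_ne_zero.2 Fintype.card_ne_zero
  have key : ∑ t : k, φ (isotypicSum (xBHom k) (shiftChar ψ t) ρ x) =
      ∑ c : Multiplicative k, if c = 1 then (Fintype.card k : ℂ) * φ x else 0 := by
    simp only [isotypicSum, LinearMap.sum_apply, LinearMap.smul_apply, map_sum, map_smul,
      smul_eq_mul]
    rw [Finset.sum_comm]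
    refine Finset.sum_congr rfl fun c _ => ?_
    have e1 : ∀ t, (shiftChar ψ t c)⁻¹ = ψ (t * -c.toAdd) := by
      intro t
      rw [shiftChar_apply, ← AddChar.map_neg_eq_inv]
      ring_nf
    simp only [e1, ← Finset.sum_mul, AddChar.sum_mulShift _ hprim, neg_eq_zero, toAdd_eq_zero]
    by_cases hc : c = 1 <;> simp [hc]
  have hz : ∑ t : k, φ (isotypicSum (xBHom k) (shiftChar ψ t) ρ x) = 0 :=
    Finset.sum_eq_zero fun t _ => LinearMap.congr_fun (H t) x
  rw [hz, Finset.sum_ite_eq' Finset.univ, if_pos (Finset.mem_univ _)] at key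
  simpa [hq] using key.symm

/-- Conjugation by `x_β` does not change the coordinate of `V` along `α`, so the character with
parameters `(1, 0)` is fixed, and a second Fourier expansion along `β` is possible. -/
theorem chiV_mul_xB (ψ : AddChar k ℂ) (r : k) :
    isotypicSum (V k).subtype (chiV ψ 1 0) ρ * ρ (xB r) =
      ρ (xB r) * isotypicSum (V k).subtype (chiV ψ 1 0) ρ := by
  rw [← levi_nGL2]
  refine isotypicSum_mul_levi _ ψ fun v hv => ?_
  rw [(levi_conj_V _ hv).2.1, nGL2_val]
  simp

theorem chiV_mul_isotypicSum (ψ : AddChar k ℂ) (t : k) :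
    isotypicSum (V k).subtype (chiV ψ 1 0) ρ * isotypicSum (xBHom k) (shiftChar ψ t) ρ =
      isotypicSum (xBHom k) (shiftChar ψ t) ρ * isotypicSum (V k).subtype (chiV ψ 1 0) ρ := by
  conv_lhs => enter [2]; rw [isotypicSum]
  conv_rhs => enter [1]; rw [isotypicSum]
  rw [Finset.mul_sum, Finset.sum_mul]
  refine Finset.sum_congr rfl fun c _ => ?_
  rw [mul_smul_comm, smul_mul_assoc, xBHom_apply, chiV_mul_xB]

/-- `tor t⁻¹ 1` scales the root subgroup of `β` by `t⁻¹` and centralizes that of `α`; it normalizes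
the character on the first without disturbing the character of `V` (`chiV_mul_tor`). -/
theorem shiftChar_mul_tor (ψ : AddChar k ℂ) (t : kˣ) :
    isotypicSum (xBHom k) (shiftChar ψ t) ρ * ρ (tor t⁻¹ 1) =
      ρ (tor t⁻¹ 1) * isotypicSum (xBHom k) (shiftChar ψ 1) ρ := by
  let e : Multiplicative k ≃ Multiplicative k :=
    { toFun := fun c => .ofAdd (t * c.toAdd)
      invFun := fun c => .ofAdd ((t⁻¹ : kˣ) * c.toAdd)
      left_inv := fun c => by simp
      right_inv := fun c => by simp }
  rw [isotypicSum, isotypicSum, Finset.sum_mul, Finset.mul_sum]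
  refine Fintype.sum_equiv e _ _ fun c => ?_
  have h1 : shiftChar ψ 1 (e c) = shiftChar ψ t c := by
    rw [shiftChar_apply, shiftChar_apply, one_mul]
    rfl
  have h2 := (tor_xB t⁻¹ 1 (t * c.toAdd)).eq
  rw [h1, smul_mul_assoc, mul_smul_comm, ← map_mul, ← map_mul]
  congr 2
  rw [xBHom_apply, xBHom_apply]
  refine Eq.trans ?_ h2.symm
  simp

theorem chiV_mul_tor (ψ : AddChar k ℂ) (t : kˣ) :
    isotypicSum (V k).subtype (chiV ψ 1 0) ρ * ρ (tor t⁻¹ 1) =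
      ρ (tor t⁻¹ 1) * isotypicSum (V k).subtype (chiV ψ 1 0) ρ := by
  refine isotypicSum_mul_levi _ ψ fun v hv => ?_
  rw [(levi_conj_V _ hv).2.1, gl2_val]
  simp

theorem comp_rho_ne_zero {φ : X →ₗ[ℂ] ℂ} (hφ : φ ≠ 0) (g : G2 k) : φ ∘ₗ ρ g ≠ 0 := by
  intro h
  refine hφ (LinearMap.ext fun x => ?_)
  have := LinearMap.congr_fun h (ρ g⁻¹ x)
  rw [LinearMap.comp_apply, ← Module.End.mul_apply, ← map_mul, mul_inv_cancel, map_one] at this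
  exact this

/-- A nonzero functional on a cuspidal representation which is invariant under the pointwise
stabilizer of `⟨e₁⁺, e₂⁺⟩` has a translate by the Levi subgroup with a nonzero Whittaker
component. -/
theorem FixInvariant.exists_whittakerSum (hρ : IsCuspidal ρ) {φ : X →ₗ[ℂ] ℂ}
    (hφ : FixInvariant ρ φ) (h0 : φ ≠ 0) {ψ : AddChar k ℂ} (hψ : ψ ≠ 1) :
    ∃ a, φ ∘ₗ ρ (levi a) ∘ₗ whittakerSum ρ ψ ≠ 0 := by
  obtain ⟨s, t, hst⟩ := hφ.exists_chiV h0 hψ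
  -- Cuspidality along `V` excludes the trivial character.
  have hst0 : ¬ (s = 0 ∧ t = 0) := by
    rintro ⟨rfl, rfl⟩
    refine hst (hρ.eq_zero_of_invariant (.inl rfl) fun v hv x => ?_)
    have := LinearMap.congr_fun (isotypicSum_mul (ι := (V k).subtype) (χ := chiV ψ 0 0) (ρ := ρ)
      ⟨v, hv⟩) x
    rw [chiV_apply, zero_mul, zero_mul, add_zero, AddChar.map_zero_eq_one, one_smul] at this
    exact congrArg φ this
  -- The Levi subgroup is transitive on nontrivial pairs: by `levi_conj_V`, a matrix of determinant
  -- `1` with first column `(s, -t)` relates `(s, t)` to `(1, 0)`.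
  obtain ⟨a, ha⟩ : ∃ a, isotypicSum (V k).subtype (chiV ψ s t) ρ * ρ (levi a) =
      ρ (levi a) * isotypicSum (V k).subtype (chiV ψ 1 0) ρ := by
    by_cases hs : s = 0
    · have ht : t ≠ 0 := fun ht => hst0 ⟨hs, ht⟩
      refine ⟨gl2 0 t⁻¹ (-t) 0 (by simp [ht]), isotypicSum_mul_levi _ ψ fun v hv => ?_⟩
      rw [(levi_conj_V _ hv).2.1, gl2_val]
      simp [hs, ht]
    · refine ⟨gl2 s 0 (-t) s⁻¹ (by simp [hs]), isotypicSum_mul_levi _ ψ fun v hv => ?_⟩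
      rw [(levi_conj_V _ hv).2.1, gl2_val]
      simp [hs]
  set E := isotypicSum (V k).subtype (chiV ψ 1 0) ρ with hE
  set F : k → X →ₗ[ℂ] X := fun t => isotypicSum (xBHom k) (shiftChar ψ t) ρ with hF
  have h1 : (φ ∘ₗ ρ (levi a)) ∘ₗ E ≠ 0 := by
    have := comp_rho_ne_zero (ρ := ρ) hst (levi a)
    rwa [LinearMap.comp_assoc, ← Module.End.mul_eq_comp, ha, Module.End.mul_eq_comp,
      ← LinearMap.comp_assoc] at this
  obtain ⟨u, hu⟩ := exists_shiftChar (ρ := ρ) h1 hψ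
  have hEF : ∀ t, E * F t = F t * E := chiV_mul_isotypicSum ψ
  have hEV : ∀ v (hv : v ∈ V k), E * ρ v = ψ (coordA v) • E := fun v hv => by
    have := isotypicSum_mul (ι := (V k).subtype) (χ := chiV ψ 1 0) (ρ := ρ) ⟨v, hv⟩
    rwa [chiV_apply, one_mul, zero_mul, add_zero] at this
  have hFB : ∀ t r, F t * ρ (xB r) = ψ (t * r) • F t := fun t r =>
    isotypicSum_mul (ι := xBHom k) (χ := shiftChar ψ t) (ρ := ρ) (.ofAdd r)
  have hEFV : ∀ t, ∀ v ∈ V k, E * F t * ρ v = ψ (coordA v) • (E * F t) := fun t v hv => by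
    rw [hEF, mul_assoc, hEV v hv, mul_smul_comm]
  have hEFB : ∀ t r, E * F t * ρ (xB r) = ψ (t * r) • (E * F t) := fun t r => by
    rw [mul_assoc, hFB, mul_smul_comm]
  -- For `u = 0` the functional would be invariant under `x_β` and under the elements of `V` with
  -- coordinate `0` along `α`, hence under `V'`, contrary to cuspidality.
  have hu0 : u ≠ 0 := by
    rintro rfl
    refine hu (hρ.eq_zero_of_invariant (.inr (.inl rfl)) fun v hv => ?_)
    have hV : ∀ v ∈ V k, coordA v = 0 → ∀ x, ((φ ∘ₗ ρ (levi a)) ∘ₗ E) (F 0 (ρ v x)) =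
        ((φ ∘ₗ ρ (levi a)) ∘ₗ E) (F 0 x) := by
      intro v hv hv0 x
      have := LinearMap.congr_fun (hEFV 0 v hv) x
      rw [hv0, AddChar.map_zero_eq_one, one_smul] at this
      exact congrArg (φ ∘ₗ ρ (levi a)) this
    obtain ⟨hA, hAB, h2AB, h3AB, h3A2B⟩ := coord_gen (k := k)
    induction hv using Subgroup.closure_induction with
    | mem v hv =>
      rcases hv with (((⟨r, rfl⟩ | ⟨r, rfl⟩) | ⟨r, rfl⟩) | ⟨r, rfl⟩) | ⟨r, rfl⟩
      · intro x
        have := LinearMap.congr_fun (hEFB 0 r) x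
        rw [zero_mul, AddChar.map_zero_eq_one, one_smul] at this
        exact congrArg (φ ∘ₗ ρ (levi a)) this
      · exact hV _ (Subgroup.subset_closure (by simp)) (hAB r)
      · exact hV _ (Subgroup.subset_closure (by simp)) (h2AB r)
      · exact hV _ (Subgroup.subset_closure (by simp)) (h3AB r)
      · exact hV _ (Subgroup.subset_closure (by simp)) (h3A2B r)
    | one => intro x; simp
    | mul v w _ _ hv hw => intro x; rw [map_mul, Module.End.mul_apply, hv, hw]
    | inv v _ hv =>
      intro x
      rw [← hv (ρ v⁻¹ x), ← Module.End.mul_apply, ← map_mul, mul_inv_cancel, map_one]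
      rfl
  obtain ⟨u, rfl⟩ : ∃ u' : kˣ, u = u' := ⟨Units.mk0 u hu0, rfl⟩
  set φ' := φ ∘ₗ ρ (levi a) ∘ₗ ρ (tor u⁻¹ 1) with hφ'
  have h2 : φ' ∘ₗ (E * F 1) ≠ 0 := by
    have := comp_rho_ne_zero (ρ := ρ) hu (tor u⁻¹ 1)
    have e : (E * F u) * ρ (tor u⁻¹ 1) = ρ (tor u⁻¹ 1) * (E * F 1) := by
      rw [mul_assoc, shiftChar_mul_tor, ← mul_assoc, chiV_mul_tor, mul_assoc]
    intro h
    refine this (LinearMap.ext fun x => ?_)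
    exact (congrArg (φ ∘ₗ ρ (levi a)) (LinearMap.congr_fun e x)).trans (LinearMap.congr_fun h x)
  have hW : IsWhittaker ρ ψ (φ' ∘ₗ (E * F 1)) := isWhittaker_of
    (fun v hv x => by
      have := congrArg φ' (LinearMap.congr_fun (hEFV 1 v hv) x)
      rwa [LinearMap.smul_apply, map_smul] at this)
    (fun r x => by
      have := congrArg φ' (LinearMap.congr_fun (hEFB 1 r) x)
      rwa [LinearMap.smul_apply, map_smul, one_mul] at this)
  refine ⟨a * gl2 ((u⁻¹ : kˣ) : k) 0 0 (1 : kˣ) (by simp), fun h => h2 (LinearMap.ext fun x => ?_)⟩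
  have hρW : ∀ g (hg : g ∈ U k), ρ g * whittakerSum ρ ψ = psiU ψ ⟨g, hg⟩ • whittakerSum ρ ψ :=
    fun g hg => mul_isotypicSum (ι := (U k).subtype) (χ := psiU ψ) (ρ := ρ) ⟨g, hg⟩
  have hFW : F 1 * whittakerSum ρ ψ = (Fintype.card (Multiplicative k) : ℂ) • whittakerSum ρ ψ := by
    rw [hF]
    simp only
    rw [isotypicSum, Finset.sum_mul]
    have : ∀ c : Multiplicative k, (shiftChar ψ 1 c)⁻¹ • ρ (xBHom k c) * whittakerSum ρ ψ =
        whittakerSum ρ ψ := fun c => by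
      rw [smul_mul_assoc, xBHom_apply, hρW _ (xB_mem_U _), psiU_xB, smul_smul, shiftChar_apply,
        one_mul, inv_mul_cancel₀, one_smul]
      rw [← psiU_xB ψ _ (xB_mem_U _)]
      exact character_ne_zero _
    rw [Finset.sum_congr rfl fun c _ => this c, Finset.sum_const, Finset.card_univ,
      Nat.cast_smul_eq_nsmul]
  have hEW : E * whittakerSum ρ ψ = (Fintype.card (V k) : ℂ) • whittakerSum ρ ψ := by
    rw [hE, isotypicSum, Finset.sum_mul]
    have : ∀ v : V k, (chiV ψ 1 0 v)⁻¹ • ρ ((V k).subtype v) * whittakerSum ρ ψ =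
        whittakerSum ρ ψ := fun v => by
      rw [smul_mul_assoc, Subgroup.subtype_apply, hρW _ (V_le_U v.2), psiU_of_mem_V ψ v.2, smul_smul]
      have e : chiV ψ 1 0 v = ψ (coordA v.val) := by rw [chiV_apply]; simp
      rw [← e, inv_mul_cancel₀ (character_ne_zero _), one_smul]
    rw [Finset.sum_congr rfl fun c _ => this c, Finset.sum_const, Finset.card_univ,
      Nat.cast_smul_eq_nsmul]
  -- The Whittaker functional `φ' ∘ (E * F 1)` is evaluated at the projection of `x` in two ways. It
  -- equals `|U|` times its value at `x`; and since `E` and `F 1` act on the projection by scalars,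
  -- it is a multiple of the value of `φ'` there, which is zero by assumption.
  have e1 := apply_isotypicSum (ι := (U k).subtype) (χ := psiU ψ) (ρ := ρ) hW x
  have e2 : (φ' ∘ₗ (E * F 1)) (whittakerSum ρ ψ x) = (Fintype.card (Multiplicative k) : ℂ) *
      ((Fintype.card (V k) : ℂ) * φ' (whittakerSum ρ ψ x)) := by
    have f1 := LinearMap.congr_fun hFW x
    have f2 := LinearMap.congr_fun hEW x
    simp only [Module.End.mul_apply, LinearMap.smul_apply] at f1 f2
    rw [LinearMap.comp_apply, Module.End.mul_apply, f1, map_smul, map_smul, f2, map_smul,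
      smul_eq_mul, smul_eq_mul]
  have e3 : φ' (whittakerSum ρ ψ x) = 0 := by
    have := LinearMap.congr_fun h x
    rwa [levi_mul, map_mul] at this
  change (φ' ∘ₗ (E * F 1)) (whittakerSum ρ ψ x) = _ at e1
  rw [e2, e3, mul_zero, mul_zero] at e1
  exact (mul_eq_zero.1 e1.symm).resolve_left (Nat.cast_ne_zero.2 Fintype.card_ne_zero)

end WhittakerExpansion

/-! ### The parabolic subgroup of `SO₇(k)` and sections -/

section Sections

variable {k : Type u} [Field k]

theorem Ptilde_mul {p q : SO7 k} (hp : p ∈ Ptilde k) (hq : q ∈ Ptilde k) : p * q ∈ Ptilde k := by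
  change BlockTriangular (SO7.mat (p * q)) blk
  rw [SO7.mat_mul]
  exact BlockTriangular.mul hp hq

theorem SO7.mat_mul_inv (p : SO7 k) : SO7.mat p * SO7.mat p⁻¹ = 1 := by
  rw [← SO7.mat_mul, mul_inv_cancel, SO7.mat_one]

theorem Ptilde_inv {p : SO7 k} (hp : p ∈ Ptilde k) : p⁻¹ ∈ Ptilde k := by
  change BlockTriangular (SO7.mat p⁻¹) blk
  have h := SO7.mat_mul_inv p
  have : Invertible (SO7.mat p) := invertibleOfRightInverse _ _ h
  have hb := blockTriangular_inv_of_blockTriangular (show BlockTriangular (SO7.mat p) blk from hp)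
  rwa [inv_eq_right_inv h] at hb

theorem Ptilde_one : (1 : SO7 k) ∈ Ptilde k := by
  change BlockTriangular (SO7.mat 1) blk
  rw [SO7.mat_one]
  exact blockTriangular_one

variable (k) in
/-- `Ptilde` as a subgroup. -/
def PtildeSub : Subgroup (SO7 k) where
  carrier := Ptilde k
  mul_mem' := Ptilde_mul
  one_mem' := Ptilde_one
  inv_mem' := Ptilde_inv

/-- Only the right factor has to be block triangular: its first two columns vanish below the upper
left block. -/
theorem gl2Block_mul (p : SO7 k) {q : SO7 k} (hq : q ∈ Ptilde k) :
    gl2Block (p * q) = gl2Block p * gl2Block q := by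
  have h : ∀ i j : Fin 7, blk j < blk i → SO7.mat q i j = 0 := fun i j => hq (i := i) (j := j)
  ext i j
  rw [gl2Block, SO7.mat_mul, Matrix.mul_apply, submatrix_apply, Matrix.mul_apply, Fin.sum_univ_seven,
    Fin.sum_univ_two]
  fin_cases j <;>
  simp [gl2Block, h 2 0 (by decide), h 3 0 (by decide), h 4 0 (by decide), h 5 0 (by decide),
    h 6 0 (by decide), h 2 1 (by decide), h 3 1 (by decide), h 4 1 (by decide), h 5 1 (by decide),
    h 6 1 (by decide)]

theorem gl2Block_one : gl2Block (1 : SO7 k) = 1 := by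
  rw [gl2Block, SO7.mat_one]
  ext i j
  fin_cases i <;> fin_cases j
  exacts [one_apply_eq (0 : Fin 7), one_apply_ne (by decide : (0 : Fin 7) ≠ 1),
    one_apply_ne (by decide : (1 : Fin 7) ≠ 0), one_apply_eq (1 : Fin 7)]

/-- The `GL₂(k)`-part, as a homomorphism. -/
def glPart : PtildeSub k →* GL (Fin 2) k where
  toFun p :=
    { val := gl2Block p.val
      inv := gl2Block p.val⁻¹
      val_inv := by rw [← gl2Block_mul _ (Ptilde_inv p.2), mul_inv_cancel, gl2Block_one]
      inv_val := by rw [← gl2Block_mul _ p.2, inv_mul_cancel, gl2Block_one] }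
  map_one' := Units.ext gl2Block_one
  map_mul' p q := Units.ext (gl2Block_mul p.val q.2)

theorem glPart_val (p : PtildeSub k) : (glPart p).val = gl2Block p.val := rfl

variable {Y : Type*} [AddCommGroup Y] [Module ℂ Y] {τ : Representation ℂ (GL (Fin 2) k) Y}

open Classical in
variable (τ) in
/-- The section supported on `Ptilde g` with value `y` at `g`. -/
def basicSection (g : SO7 k) (y : Y) : SO7 k → Y := fun x =>
  if h : x * g⁻¹ ∈ PtildeSub k then τ (glPart ⟨x * g⁻¹, h⟩) y else 0

theorem basicSection_of_mem {g x : SO7 k} {y : Y} {p : SO7 k} (hp : p ∈ PtildeSub k)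
    (h : x = p * g) : basicSection τ g y x = τ (glPart ⟨p, hp⟩) y := by
  subst h
  have : (p * g) * g⁻¹ = p := by group
  rw [basicSection, dif_pos (by rwa [this])]
  simp only [this]

theorem basicSection_of_notMem {g x : SO7 k} {y : Y} (h : x * g⁻¹ ∉ PtildeSub k) :
    basicSection τ g y x = 0 := dif_neg h

theorem isSection_iff {ξ : SO7 k → Y} :
    IsSection τ ξ ↔ ∀ (p : PtildeSub k) g, ξ (p.val * g) = τ (glPart p) (ξ g) := by
  refine ⟨fun h p g => h p.val p.2 _ rfl g, fun h p hp x hx g => ?_⟩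
  rw [h ⟨p, hp⟩, show x = glPart ⟨p, hp⟩ from Units.ext hx.symm]

theorem basicSection_mul_right (g h : SO7 k) (y : Y) :
    (fun x => basicSection τ g y (x * h⁻¹)) = basicSection τ (g * h) y := by
  funext x
  by_cases hx : x * h⁻¹ * g⁻¹ ∈ PtildeSub k
  · rw [basicSection_of_mem hx (by group), basicSection_of_mem hx (by group)]
  · rw [basicSection_of_notMem hx, basicSection_of_notMem]
    rwa [_root_.mul_inv_rev, ← mul_assoc]

/-- Changing the representative of `P̃ g` only changes the vector by `τ`. With
`basicSection_mul_right`, invariant forms need only be studied for one `g` in each double coset. -/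
theorem basicSection_mul_left (p : PtildeSub k) (g : SO7 k) (y : Y) :
    basicSection τ (p.val * g) y = basicSection τ g (τ (glPart p⁻¹) y) := by
  funext x
  by_cases hx : x * g⁻¹ ∈ PtildeSub k
  · rw [basicSection_of_mem (g := g) hx (by group),
      basicSection_of_mem (g := p.val * g) (p := x * g⁻¹ * (p⁻¹ : PtildeSub k).val)
        (mul_mem hx (p⁻¹ : PtildeSub k).2) (by rw [Subgroup.coe_inv]; group),
      ← Module.End.mul_apply, ← map_mul, ← map_mul]
    rfl
  · rw [basicSection_of_notMem hx, basicSection_of_notMem]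
    rwa [_root_.mul_inv_rev, ← mul_assoc, (PtildeSub k).mul_mem_cancel_right (inv_mem p.2)]

instance [Finite k] : Fintype (SO7 k) := Fintype.ofFinite _

/-- Every section is a combination of the basic ones. -/
theorem IsSection.card_smul [Finite k] {ξ : SO7 k → Y} (hξ : IsSection τ ξ) :
    (Nat.card (PtildeSub k) : ℂ) • ξ = ∑ g, basicSection τ g (ξ g) := by
  classical
  rw [isSection_iff] at hξ
  funext x
  rw [Finset.sum_apply, Pi.smul_apply]
  -- Each `g` in the coset `P̃ x` contributes `ξ x`, and there are `|P̃|` of them.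
  have : ∀ g, basicSection τ g (ξ g) x = if x * g⁻¹ ∈ PtildeSub k then ξ x else 0 := by
    intro g
    split_ifs with h
    · rw [basicSection_of_mem h (by group), ← hξ]
      congr 1
      simp only
      group
    · exact basicSection_of_notMem h
  rw [Finset.sum_congr rfl fun g _ => this g, ← Finset.sum_filter, Finset.sum_const,
    ← Nat.cast_smul_eq_nsmul ℂ]
  congr 2
  rw [← Fintype.card_subtype, ← Nat.card_eq_fintype_card]
  refine Nat.card_congr ((Equiv.inv (SO7 k)).trans (Equiv.mulLeft x) |>.subtypeEquiv
    fun g => ?_).symm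
  rfl

end Sections

/-! ### The orbits of `G₂(k)` on isotropic planes -/

section Orbits

variable {k : Type u} [Field k]

/-- An isometry preserving `⟨e₁⁺, e₂⁺⟩` also preserves its orthogonal complement, given by the
vanishing of the last two coordinates. This accounts for all the zero blocks of `P̃`. -/
theorem mem_PtildeSub_of_act {p : SO7 k} {a b c d : k}
    (h0 : act p ![1, 0, 0, 0, 0, 0, 0] = ![a, c, 0, 0, 0, 0, 0])
    (h1 : act p ![0, 1, 0, 0, 0, 0, 0] = ![b, d, 0, 0, 0, 0, 0]) :
    p ∈ PtildeSub k ∧ gl2Block p = !![a, b; c, d] := by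
  have s0 : (Pi.single 0 1 : Fin 7 → k) = ![1, 0, 0, 0, 0, 0, 0] := by
    ext i; fin_cases i <;> simp
  have s1 : (Pi.single 1 1 : Fin 7 → k) = ![0, 1, 0, 0, 0, 0, 0] := by
    ext i; fin_cases i <;> simp
  have hlin : ∀ x y : k, act p ![x, y, 0, 0, 0, 0, 0] =
      ![a * x + b * y, c * x + d * y, 0, 0, 0, 0, 0] := by
    intro x y
    have : ![x, y, 0, 0, 0, 0, 0] = x • ![1, 0, 0, 0, 0, 0, 0] +
      y • (![0, 1, 0, 0, 0, 0, 0] : Fin 7 → k) := by simp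
    rw [this, act_add, act_smul, act_smul, h0, h1]
    simp [mul_comm]
  have hinj : ∀ x y : k, a * x + b * y = 0 → c * x + d * y = 0 → x = 0 ∧ y = 0 := by
    intro x y e1 e2
    have h := hlin x y
    rw [e1, e2] at h
    have h5 : (![x, y, 0, 0, 0, 0, 0] : Fin 7 → k) = 0 := by
      refine act_injective p ?_
      rw [h, act_zero]
      simp
    exact ⟨by simpa using congrFun h5 0, by simpa using congrFun h5 1⟩
  have hd : a * d - b * c ≠ 0 := by
    intro h
    have e1 := hinj d (-c) (by linear_combination h) (by ring)
    have e2 := hinj b (-a) (by ring) (by linear_combination -h)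
    have e3 := hinj 1 0 (by linear_combination -e2.2) (by linear_combination -e1.2)
    exact one_ne_zero e3.1
  refine ⟨?_, ?_⟩
  · have key : ∀ x : Fin 7 → k, x 5 = 0 → x 6 = 0 → act p x 5 = 0 ∧ act p x 6 = 0 := by
      intro x h5 h6
      have e0 := bil_act p x ![1, 0, 0, 0, 0, 0, 0]
      have e1 := bil_act p x ![0, 1, 0, 0, 0, 0, 0]
      rw [h0] at e0
      rw [h1] at e1
      simp [bil, h5, h6] at e0 e1
      exact ⟨mul_left_cancel₀ hd (by linear_combination a * e1 - b * e0),
        mul_left_cancel₀ hd (by linear_combination d * e0 - c * e1)⟩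
    change BlockTriangular (SO7.mat p) blk
    intro i j hij
    rw [mat_apply]
    fin_cases j
    · change act p (Pi.single 0 1) i = 0
      rw [s0, h0]
      fin_cases i <;> simp [blk] at hij ⊢
    · change act p (Pi.single 1 1) i = 0
      rw [s1, h1]
      fin_cases i <;> simp [blk] at hij ⊢
    · fin_cases i <;> simp [blk] at hij ⊢
      exacts [(key _ (by simp) (by simp)).1, (key _ (by simp) (by simp)).2]
    · fin_cases i <;> simp [blk] at hij ⊢
      exacts [(key _ (by simp) (by simp)).1, (key _ (by simp) (by simp)).2]
    · fin_cases i <;> simp [blk] at hij ⊢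
      exacts [(key _ (by simp) (by simp)).1, (key _ (by simp) (by simp)).2]
    · fin_cases i <;> simp [blk] at hij
    · fin_cases i <;> simp [blk] at hij
  · ext i j
    rw [gl2Block, submatrix_apply, mat_apply]
    fin_cases j
    · change act p (Pi.single 0 1) _ = _
      rw [s0, h0]
      fin_cases i <;> simp
    · change act p (Pi.single 1 1) _ = _
      rw [s1, h1]
      fin_cases i <;> simp

theorem mem_PtildeSub_of_fix {p : SO7 k}
    (h0 : act p ![1, 0, 0, 0, 0, 0, 0] = ![1, 0, 0, 0, 0, 0, 0])
    (h1 : act p ![0, 1, 0, 0, 0, 0, 0] = ![0, 1, 0, 0, 0, 0, 0]) :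
    ∃ h : p ∈ PtildeSub k, glPart ⟨p, h⟩ = 1 := by
  obtain ⟨h, e⟩ := mem_PtildeSub_of_act h0 h1
  refine ⟨h, Units.ext ?_⟩
  rw [glPart_val, e]
  ext i j
  fin_cases i <;> fin_cases j <;> simp

theorem act_of_glPart_eq_one {p : SO7 k} (h : p ∈ PtildeSub k) (e : glPart ⟨p, h⟩ = 1) :
    act p ![1, 0, 0, 0, 0, 0, 0] = ![1, 0, 0, 0, 0, 0, 0] ∧
    act p ![0, 1, 0, 0, 0, 0, 0] = ![0, 1, 0, 0, 0, 0, 0] := by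
  have hp : ∀ i j : Fin 7, blk j < blk i → SO7.mat p i j = 0 := fun i j hij => h hij
  have hb : gl2Block p = 1 := congrArg Units.val e
  have h2 : ∀ i j : Fin 2, SO7.mat p (![0, 1] i) (![0, 1] j) = (1 : Matrix (Fin 2) (Fin 2) k) i j :=
    fun i j => congrFun (congrFun hb i) j
  have s0 : (![1, 0, 0, 0, 0, 0, 0] : Fin 7 → k) = Pi.single 0 1 := by
    ext i; fin_cases i <;> simp
  have s1 : (![0, 1, 0, 0, 0, 0, 0] : Fin 7 → k) = Pi.single 1 1 := by
    ext i; fin_cases i <;> simp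
  constructor
  · ext i
    conv_lhs => rw [s0, ← mat_apply]
    fin_cases i
    exacts [h2 0 0, h2 1 0, hp 2 0 (by decide), hp 3 0 (by decide), hp 4 0 (by decide),
      hp 5 0 (by decide), hp 6 0 (by decide)]
  · ext i
    conv_lhs => rw [s1, ← mat_apply]
    fin_cases i
    exacts [h2 0 1, h2 1 1, hp 2 1 (by decide), hp 3 1 (by decide), hp 4 1 (by decide),
      hp 5 1 (by decide), hp 6 1 (by decide)]

variable [NeZero (2 : k)]

theorem levi_mem_PtildeSub (a : GL (Fin 2) k) :
    ∃ h : (levi a).val ∈ PtildeSub k, glPart ⟨(levi a).val, h⟩ = a := by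
  obtain ⟨h, e⟩ := mem_PtildeSub_of_act (p := (levi a).val) (a := a.val 0 0) (b := a.val 0 1)
    (c := a.val 1 0) (d := a.val 1 1) (by rw [act_levi]; simp) (by rw [act_levi]; simp)
  refine ⟨h, Units.ext ?_⟩
  rw [glPart_val, e]
  ext i j
  fin_cases i <;> fin_cases j <;> rfl

/-- Pairs spanning an isotropic plane in the open orbit, with the first vector in standard form,
are carried by `G₂(k)` into `⟨e₁⁺, e₂⁺⟩`. -/
theorem exists_open_orbit {c : k} {y : Fin 7 → k} (hiso : bil y y = 0) (h2 : y 2 = 0)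
    (h6 : y 6 ≠ 0) : ∃ h : G2 k, ∃ a b a' b' : k,
      act h.val ![0, 0, 0, 0, c, 0, 0] = ![a, b, 0, 0, 0, 0, 0] ∧
      act h.val y = ![a', b', 0, 0, 0, 0, 0] := by
  obtain ⟨z, hz⟩ : ∃ z, act (x2AB (-(y 1 / y 6)) * xAB (-(y 3 / y 6)) * xB (y 5 / y 6)).val y = z :=
    ⟨_, rfl⟩
  have hzz : bil z z = 0 := by rw [← hz, bil_act, hiso]
  have hz' := hz
  simp only [Subgroup.coe_mul, act_mul, act_xB, act_xAB, act_x2AB, cons_val] at hz'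
  have z2 : z 2 = 0 := by rw [← hz']; simp [h2]
  have z6 : z 6 = y 6 := by rw [← hz']; simp
  have z5 : z 5 = 0 := by rw [← hz']; simp [h2, h6]
  have z3 : z 3 = 0 := by rw [← hz']; simp [h2, h6]
  have z1 : z 1 = 0 := by rw [← hz']; simp [h6]
  have z0 : z 0 = 0 := by
    refine mul_left_cancel₀ (mul_ne_zero (NeZero.ne (2 : k)) h6) ?_
    simp only [bil, z2, z6, z5, z3, z1] at hzz
    linear_combination hzz
  -- After the root elements the plane is `⟨e₃⁻, e₁⁻⟩`, which `nA * nB` carries to `⟨e₁⁺, e₂⁺⟩`.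
  refine ⟨nA k * nB k * (x2AB (-(y 1 / y 6)) * xAB (-(y 3 / y 6)) * xB (y 5 / y 6)), -c, 0,
    -z 4, y 6, ?_, ?_⟩
  · simp [act_mul, act_nA, act_nB, act_x2AB, act_xAB, act_xB]
  · rw [Subgroup.coe_mul, act_mul, hz, vec7_eta z, z0, z1, z2, z3, z5, z6]
    simp [act_mul, act_nA, act_nB]

/-- The two orbits of `G₂(k)` on isotropic planes. -/
theorem SO7.open_or_closed (g : SO7 k) :
    (∃ p : PtildeSub k, ∃ h : G2 k, g = p.val * h.val) ∨
    ∃ (g' : SO7 k) (h : G2 k), g = g' * h.val ∧ ∃ a b c d : k,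
      act g'⁻¹ ![1, 0, 0, 0, 0, 0, 0] = ![a, 0, 0, 0, b, 0, 0] ∧
      act g'⁻¹ ![0, 1, 0, 0, 0, 0, 0] = ![c, 0, 0, 0, d, 0, 0] := by
  have h2' : (2 : k) ≠ 0 := NeZero.ne _
  -- The first vector of the plane is moved to `c e₃⁻`, all isotropic lines being in one orbit. The
  -- second, `y`, is orthogonal to it, which means `y 2 = 0`.
  obtain ⟨u, -, w, -, c, hc⟩ := reachable_of_isotropic (v := act g⁻¹ ![1, 0, 0, 0, 0, 0, 0])
    (by rw [bil_act]; simp [bil])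
  obtain ⟨h, hh⟩ : ∃ h : G2 k, h = w⁻¹ * u := ⟨_, rfl⟩
  have e0 : act (h.val * g⁻¹) ![1, 0, 0, 0, 0, 0, 0] = ![0, 0, 0, 0, c, 0, 0] := by
    rw [hh, act_mul, Subgroup.coe_mul, act_mul, hc, Subgroup.coe_inv, act_inv_act]
  obtain ⟨y, hy⟩ : ∃ y, act (h.val * g⁻¹) ![0, 1, 0, 0, 0, 0, 0] = y := ⟨_, rfl⟩
  have hiso : bil y y = 0 := by rw [← hy, bil_act]; simp [bil]
  have hc0 : c ≠ 0 := by
    rintro rfl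
    have h5 : (![1, 0, 0, 0, 0, 0, 0] : Fin 7 → k) = 0 := by
      refine act_injective (h.val * g⁻¹) ?_
      rw [e0, act_zero]
      simp
    simpa using congrFun h5 0
  have y2 : y 2 = 0 := by
    have := bil_act (h.val * g⁻¹) ![1, 0, 0, 0, 0, 0, 0] ![0, 1, 0, 0, 0, 0, 0]
    rw [e0, hy] at this
    simpa [bil, hc0] using this
  have hopen : ∀ (h₁ : G2 k) (a b a' b' : k),
      act h₁.val ![0, 0, 0, 0, c, 0, 0] = ![a, b, 0, 0, 0, 0, 0] →
      act h₁.val y = ![a', b', 0, 0, 0, 0, 0] →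
      ∃ p : PtildeSub k, ∃ h : G2 k, g = p.val * h.val := by
    intro h₁ a b a' b' i0 i1
    obtain ⟨hm, -⟩ := mem_PtildeSub_of_act (p := h₁.val * (h.val * g⁻¹))
      (by rw [act_mul, e0, i0]) (by rw [act_mul, hy, i1])
    refine ⟨⟨_, inv_mem hm⟩, h₁ * h, ?_⟩
    rw [Subgroup.coe_mul]
    group
  -- The orbits are told apart by the product of `e₃⁻` and `y`: it is nonzero exactly if `y 5` or `y
  -- 6` is nonzero. The element `nB` exchanges these two cases.
  by_cases y6 : y 6 = 0
  swap
  · obtain ⟨h₁, a, b, a', b', i0, i1⟩ := exists_open_orbit (c := c) hiso y2 y6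
    exact .inl (hopen h₁ a b a' b' i0 i1)
  by_cases y5 : y 5 = 0
  swap
  · obtain ⟨h₁, a, b, a', b', i0, i1⟩ := exists_open_orbit (c := -c) (y := act (nB k).val y)
      (by rw [bil_act, hiso]) (by simp [act_nB, y2]) (by simpa [act_nB] using y5)
    refine .inl (hopen (h₁ * nB k) a b a' b' ?_ ?_)
    · rw [Subgroup.coe_mul, act_mul, ← i0, act_nB]
      simp
    · rw [Subgroup.coe_mul, act_mul, i1]
  have y3 : y 3 = 0 := by simpa [bil, y2, y6, y5, h2'] using hiso
  have hclosed : ∀ (h₁ : G2 k) (a b a' b' : k),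
      act h₁.val ![0, 0, 0, 0, c, 0, 0] = ![a, 0, 0, 0, b, 0, 0] →
      act h₁.val y = ![a', 0, 0, 0, b', 0, 0] →
      ∃ (g' : SO7 k) (h : G2 k), g = g' * h.val ∧ ∃ a b c d : k,
      act g'⁻¹ ![1, 0, 0, 0, 0, 0, 0] = ![a, 0, 0, 0, b, 0, 0] ∧
      act g'⁻¹ ![0, 1, 0, 0, 0, 0, 0] = ![c, 0, 0, 0, d, 0, 0] := by
    intro h₁ a b a' b' i0 i1
    refine ⟨(h₁.val * (h.val * g⁻¹))⁻¹, h₁ * h, by rw [Subgroup.coe_mul]; group, a, b, a', b', ?_, ?_⟩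
    · rw [inv_inv, act_mul, e0, i0]
    · rw [inv_inv, act_mul, hy, i1]
  right
  have hy' : y = ![y 0, y 1, 0, 0, y 4, 0, 0] := by
    conv_lhs => rw [vec7_eta y, y2, y3, y5, y6]
  -- Now `y` lies in `⟨e₁⁺, e₂⁺, e₃⁻⟩`, and `nB` with `x_β` moves its component in `⟨e₁⁺, e₂⁺⟩` to
  -- the line of `e₁⁺`.
  by_cases y1 : y 1 = 0
  · refine hclosed 1 0 c (y 0) (y 4) ?_ ?_
    · rw [OneMemClass.coe_one, act_one]
    · rw [OneMemClass.coe_one, act_one, hy', y1]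
      simp
  · refine hclosed (nB k * xB (-(y 0 / y 1))) 0 (-c) (y 1) (-y 4) ?_ ?_
    · simp [act_mul, act_xB, act_nB]
    · rw [hy']
      simp [act_mul, act_xB, act_nB, y1]

end Orbits

/-! ### Vanishing of invariant forms -/

section Vanishing

variable {k : Type u} [Field k]
variable {X : Type*} [AddCommGroup X] [Module ℂ X] {ρ : Representation ℂ (G2 k) X}
variable {Y : Type*} [AddCommGroup Y] [Module ℂ Y] {τ : Representation ℂ (GL (Fin 2) k) Y}

/-- The group `G₂(k)` leaves a bilinear form invariant. -/
def IsInvariantForm (ρ : Representation ℂ (G2 k) X) (D : X →ₗ[ℂ] (SO7 k → Y) →ₗ[ℂ] ℂ) : Prop :=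
  ∀ (h : G2 k) v ξ, D (ρ h v) ξ = D v fun x => ξ (x * h.val⁻¹)

theorem IsInvariantForm.apply_basicSection {D : X →ₗ[ℂ] (SO7 k → Y) →ₗ[ℂ] ℂ}
    (hD : IsInvariantForm ρ D) (h : G2 k) (v : X) (g : SO7 k) (y : Y) :
    D (ρ h v) (basicSection τ g y) = D v (basicSection τ (g * h.val) y) := by
  rw [hD, basicSection_mul_right]

variable [NeZero (2 : k)] [Finite k]

/-- Sections are combinations of basic ones. Over the open orbit, invariance reduces to the coset of
`1`, where the functional in `v` would otherwise have a nonzero Whittaker component after a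
translation by the Levi subgroup; that translation only changes `y`, so `h0` applies. The closed
orbit contributes nothing by cuspidality. -/
theorem IsInvariantForm.eq_zero {D : X →ₗ[ℂ] (SO7 k → Y) →ₗ[ℂ] ℂ} (hD : IsInvariantForm ρ D)
    (hρ : IsCuspidal ρ) {ψ : AddChar k ℂ} (hψ : ψ ≠ 1)
    (h0 : ∀ v y, D (whittakerSum ρ ψ v) (basicSection τ 1 y) = 0) (v : X) {ξ : SO7 k → Y}
    (hξ : IsSection τ ξ) : D v ξ = 0 := by
  have hone : ∀ v y, D v (basicSection τ 1 y) = 0 := by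
    intro v y
    have hfix : FixInvariant ρ (D.flip (basicSection τ 1 y)) := by
      intro z hz0 hz1 x
      obtain ⟨hz, e⟩ := mem_PtildeSub_of_fix hz0 hz1
      rw [LinearMap.flip_apply, LinearMap.flip_apply, hD.apply_basicSection, one_mul]
      have := basicSection_mul_left (τ := τ) ⟨z.val, hz⟩ 1 y
      rw [map_inv, e, inv_one, map_one, mul_one] at this
      rw [this]
      rfl
    by_contra hne
    obtain ⟨a, ha⟩ := hfix.exists_whittakerSum hρ
      (fun h => hne (LinearMap.congr_fun h v)) hψ
    refine ha (LinearMap.ext fun x => ?_)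
    obtain ⟨hm, e⟩ := levi_mem_PtildeSub a
    have := basicSection_mul_left (τ := τ) ⟨(levi a).val, hm⟩ 1 y
    rw [mul_one] at this
    rw [LinearMap.comp_apply, LinearMap.comp_apply, LinearMap.flip_apply, hD.apply_basicSection, one_mul,
      this, h0]
    rfl
  have hall : ∀ g y v, D v (basicSection τ g y) = 0 := by
    intro g y v
    rcases SO7.open_or_closed g with ⟨p, h, rfl⟩ | ⟨g', h, rfl, a, b, c, d, i0, i1⟩
    · rw [basicSection_mul_left, ← one_mul h.val, ← hD.apply_basicSection, hone]
    · rw [← hD.apply_basicSection]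
      -- `V'` fixes `⟨e₁⁺, e₃⁻⟩` pointwise, so its conjugate by `g'` lies in `P̃` with trivial
      -- `GL₂(k)`-part.
      have hinv : D.flip (basicSection τ g' y) = 0 := by
        refine hρ.eq_zero_of_invariant (.inr (.inl rfl)) fun n hn x => ?_
        have hn' : ∀ s t : k, act n.val ![s, 0, 0, 0, t, 0, 0] = ![s, 0, 0, 0, t, 0, 0] := by
          induction hn using Subgroup.closure_induction with
          | mem n hn =>
            intro s t
            rcases hn with (((⟨r, rfl⟩ | ⟨r, rfl⟩) | ⟨r, rfl⟩) | ⟨r, rfl⟩) | ⟨r, rfl⟩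
            · simp [act_xB]
            · simp [act_xAB]
            · simp [act_x2AB]
            · simp [act_x3AB]
            · simp [act_x3A2B]
          | one => intro s t; rw [OneMemClass.coe_one, act_one]
          | mul n m _ _ hn hm => intro s t; rw [Subgroup.coe_mul, act_mul, hm, hn]
          | inv n _ hn =>
            intro s t
            refine act_injective n.val ?_
            rw [Subgroup.coe_inv, act_act_inv, hn]
        obtain ⟨hm, e⟩ := mem_PtildeSub_of_fix (p := g' * n.val * g'⁻¹)
          (by rw [act_mul, i0, act_mul, hn', ← i0, act_act_inv])
          (by rw [act_mul, i1, act_mul, hn', ← i1, act_act_inv])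
        have := basicSection_mul_left (τ := τ) ⟨_, hm⟩ g' y
        rw [map_inv, e, inv_one, map_one, inv_mul_cancel_right] at this
        rw [LinearMap.flip_apply, LinearMap.flip_apply, hD.apply_basicSection, this]
        rfl
      exact LinearMap.congr_fun hinv _
  have hsum := congrArg (D v) hξ.card_smul
  rw [map_smul, map_sum, Finset.sum_eq_zero fun g _ => hall g _ v] at hsum
  exact (smul_eq_zero.1 hsum).resolve_left (Nat.cast_ne_zero.2 Nat.card_pos.ne')

end Vanishing

/-! ### The intertwining operator and the zeta sum -/

section Intertwine

variable {k : Type u} [Field k]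

/-- The block diagonal part of an element of `Ptilde`. -/
def leviPart : PtildeSub k →* Matrix (Fin 7) (Fin 7) k where
  toFun p := of fun i j => if blk i = blk j then SO7.mat p.val i j else 0
  map_one' := by
    ext i j
    rw [OneMemClass.coe_one, SO7.mat_one, of_apply]
    split_ifs with h
    · rfl
    · rw [one_apply_ne]
      rintro rfl
      exact h rfl
  map_mul' p q := by
    ext i j
    rw [Subgroup.coe_mul, SO7.mat_mul, of_apply, Matrix.mul_apply, Matrix.mul_apply]
    have hp : ∀ i j : Fin 7, blk j < blk i → SO7.mat p.val i j = 0 := fun i j h => p.2 h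
    have hq : ∀ i j : Fin 7, blk j < blk i → SO7.mat q.val i j = 0 := fun i j h => q.2 h
    split_ifs with h
    · refine Finset.sum_congr rfl fun l _ => ?_
      rw [of_apply, of_apply]
      rcases lt_trichotomy (blk i) (blk l) with hl | hl | hl
      · rw [hq l j (h ▸ hl), if_neg hl.ne, mul_zero, zero_mul]
      · rw [if_pos hl, if_pos (hl.symm.trans h)]
      · rw [hp i l hl, if_neg hl.ne', zero_mul, zero_mul]
    · refine (Finset.sum_eq_zero fun l _ => ?_).symm
      rw [of_apply, of_apply]
      by_cases hl : blk i = blk l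
      · rw [if_neg fun h' => h (hl.trans h'), mul_zero]
      · rw [if_neg hl, zero_mul]

theorem leviPart_apply (p : PtildeSub k) (i j : Fin 7) :
    leviPart p i j = if blk i = blk j then SO7.mat p.val i j else 0 := rfl

theorem mem_Utilde_iff {u : SO7 k} :
    u ∈ Utilde k ↔ ∃ h : u ∈ PtildeSub k, leviPart ⟨u, h⟩ = 1 := by
  refine ⟨fun h => ⟨h.1, ?_⟩, fun ⟨h, e⟩ => ⟨h, fun i j hij => ?_⟩⟩
  · ext i j
    rw [leviPart_apply]
    split_ifs with hij
    · exact h.2 i j hij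
    · rw [one_apply_ne]
      rintro rfl
      exact hij rfl
  · rw [← e, leviPart_apply, if_pos hij]

variable {Y : Type*} [AddCommGroup Y] [Module ℂ Y] {τ : Representation ℂ (GL (Fin 2) k) Y}

variable [Finite k]

instance : Fintype (Utilde k) := Fintype.ofFinite _

/-- The sum `∑_u ξ(w₂ u g)` over the unipotent radical of `Ptilde`. -/
def sumUtilde (ξ : SO7 k → Y) (g : SO7 k) : Y := ∑ u : Utilde k, ξ (w2 * u.val * g)

/-- Substitute `u ↦ m⁻¹ u p`, which preserves `Ũ` because `p` and `m` have the same block diagonal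
part, and move `m` across `w₂`. The two are kept apart because `x_{2α+β}(r)` is not block diagonal.
-/
theorem IsSection.sumUtilde_mul {ξ : SO7 k → Y} (hξ : IsSection τ ξ) {p m q : PtildeSub k}
    (hpm : leviPart p = leviPart m) (hq : q.val * w2 = w2 * m.val) (g : SO7 k) :
    sumUtilde ξ (p.val * g) = τ (glPart q) (sumUtilde ξ g) := by
  rw [isSection_iff] at hξ
  have hmem : ∀ a b : PtildeSub k, leviPart (a * b) = 1 → ∀ u ∈ Utilde k,
      a.val * u * b.val ∈ Utilde k := by
    intro a b hab u hu
    obtain ⟨h, e⟩ := mem_Utilde_iff.1 hu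
    refine mem_Utilde_iff.2 ⟨mul_mem (mul_mem a.2 h) b.2, ?_⟩
    refine Eq.trans (b := leviPart (a * ⟨u, h⟩ * b)) rfl ?_
    rw [map_mul, map_mul, e, mul_one, ← map_mul, hab]
  have h1 : leviPart (m⁻¹ * p) = 1 := by
    rw [map_mul, hpm, ← map_mul, inv_mul_cancel, map_one]
  have h2 : leviPart (m * p⁻¹) = 1 := by
    rw [map_mul, ← hpm, ← map_mul, mul_inv_cancel, map_one]
  let e : Utilde k ≃ Utilde k :=
    { toFun := fun u => ⟨_, hmem _ _ h1 u u.2⟩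
      invFun := fun u => ⟨_, hmem _ _ h2 u u.2⟩
      left_inv := fun u => Subtype.ext (by simp only [Subgroup.coe_inv]; group)
      right_inv := fun u => Subtype.ext (by simp only [Subgroup.coe_inv]; group) }
  rw [sumUtilde, sumUtilde, map_sum]
  refine Fintype.sum_equiv e _ _ fun u => ?_
  rw [← hξ]
  congr 1
  change w2 * u.val * (p.val * g) = q.val * (w2 * (m⁻¹.val * u.val * p.val) * g)
  calc w2 * u.val * (p.val * g) = (w2 * m.val) * (m⁻¹.val * u.val * p.val) * g := by
        rw [Subgroup.coe_inv]; group
    _ = _ := by rw [← hq]; group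

theorem IsSection.sumUtilde_of_mem {ξ : SO7 k → Y} (hξ : IsSection τ ξ) {u : SO7 k}
    (hu : u ∈ Utilde k) (g : SO7 k) : sumUtilde ξ (u * g) = sumUtilde ξ g := by
  obtain ⟨h, e⟩ := mem_Utilde_iff.1 hu
  have key := hξ.sumUtilde_mul (p := ⟨_, h⟩) (m := 1) (q := 1) (by rw [e, map_one])
    (by simp) g
  rwa [map_one, map_one, Module.End.one_apply] at key

end Intertwine

/-! ### Behaviour of the intertwined sections under `U_H` -/

section IntertwineUH

variable {k : Type u} [Field k]

/-- The block diagonal part of `x_{2α+β}(r)`. -/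
def leviMat2AB (r : k) : Matrix (Fin 7) (Fin 7) k :=
  !![1, 0, 0, 0, 0, 0, 0;
     0, 1, 0, 0, 0, 0, 0;
     0, 0, 1, 0, 0, 0, 0;
     0, 0, -r, 1, 0, 0, 0;
     0, 0, r ^ 2, -2 * r, 1, 0, 0;
     0, 0, 0, 0, 0, 1, 0;
     0, 0, 0, 0, 0, 0, 1]

/-- The conjugate of `leviMat2AB r` by `w₂`. -/
def leviMat2AB' (r : k) : Matrix (Fin 7) (Fin 7) k :=
  !![1, 0, 0, 0, 0, 0, 0;
     0, 1, 0, 0, 0, 0, 0;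
     0, 0, 1, -2 * r, r ^ 2, 0, 0;
     0, 0, 0, 1, -r, 0, 0;
     0, 0, 0, 0, 1, 0, 0;
     0, 0, 0, 0, 0, 1, 0;
     0, 0, 0, 0, 0, 0, 1]

theorem mulVec_leviMat2AB (r : k) (x : Fin 7 → k) : leviMat2AB r *ᵥ x =
    ![x 0, x 1, x 2, x 3 - r * x 2, x 4 + r ^ 2 * x 2 - 2 * r * x 3, x 5, x 6] := by
  ext i
  fin_cases i <;> simp [leviMat2AB, Matrix.mulVec, dotProduct, Fin.sum_univ_succ] <;> ring

theorem mulVec_leviMat2AB' (r : k) (x : Fin 7 → k) : leviMat2AB' r *ᵥ x =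
    ![x 0, x 1, x 2 - 2 * r * x 3 + r ^ 2 * x 4, x 3 - r * x 4, x 4, x 5, x 6] := by
  ext i
  fin_cases i <;> simp [leviMat2AB', Matrix.mulVec, dotProduct, Fin.sum_univ_succ] <;> ring

/-- The block diagonal part of `x_{2α+β}(r)`, in `SO₇(k)`. -/
def levi2AB (r : k) : SO7 k := SO7.mk (leviMat2AB r)
  (form_of fun x y => by simp only [formQ_apply, mulVec_leviMat2AB]; simp; ring)
  (IsUnip.det fun i j => by fin_cases i <;> fin_cases j <;> simp [leviMat2AB, rootOrd])

/-- The conjugate of `levi2AB r` by `w₂`. -/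
def levi2AB' (r : k) : SO7 k := SO7.mk (leviMat2AB' r)
  (form_of fun x y => by simp only [formQ_apply, mulVec_leviMat2AB']; simp; ring)
  (by rw [det_of_isUpperTriangular (fun i j h => by
        fin_cases i <;> fin_cases j <;> simp [leviMat2AB'] at h ⊢)]
      simp [leviMat2AB', Fin.prod_univ_succ])

theorem act_w2 (x : Fin 7 → k) :
    act w2 x = ![-x 5, -x 6, -x 4, -x 3, -x 2, -x 0, -x 1] := mulVec_matW2 x

variable {Y : Type*} [AddCommGroup Y] [Module ℂ Y] {τ : Representation ℂ (GL (Fin 2) k) Y}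

/-- The reason for the twist by `d₁`: `w₂` carries `x_β(r)` to `x_β(-r)`, and `d₁` restores the
sign, so that the intertwined function is again `ψ⁻¹`-equivariant. -/
theorem d1_mul_nGL2 (r : k) : d1 * nGL2 (-r) = nGL2 r * d1 := by
  refine gl2_ext ?_ ?_ ?_ ?_ <;> simp [nGL2_val, d1, GeneralLinearGroup.mkOfDetNeZero]

variable [NeZero (2 : k)]

theorem mem_PtildeSub_xB (r : k) :
    ∃ h : (xB r).val ∈ PtildeSub k, glPart ⟨(xB r).val, h⟩ = nGL2 r := by
  rw [← levi_nGL2]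
  exact levi_mem_PtildeSub _

theorem x3AB_mem_Utilde (r : k) : (x3AB r).val ∈ Utilde k := by
  refine ⟨fun i j => ?_, fun i j => ?_⟩
  · change _ → mat3AB r i j = 0
    fin_cases i <;> fin_cases j <;> simp [mat3AB, blk]
  · change _ → mat3AB r i j = _
    fin_cases i <;> fin_cases j <;> simp [mat3AB, blk]

theorem x3A2B_mem_Utilde (r : k) : (x3A2B r).val ∈ Utilde k := by
  refine ⟨fun i j => ?_, fun i j => ?_⟩
  · change _ → mat3A2B r i j = 0
    fin_cases i <;> fin_cases j <;> simp [mat3A2B, blk]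
  · change _ → mat3A2B r i j = _
    fin_cases i <;> fin_cases j <;> simp [mat3A2B, blk]

variable [Finite k]

theorem IsSection.sumUtilde_xB {ξ : SO7 k → Y} (hξ : IsSection τ ξ) (r : k) (g : SO7 k) :
    sumUtilde ξ ((xB r).val * g) = τ (nGL2 (-r)) (sumUtilde ξ g) := by
  obtain ⟨h, -⟩ := mem_PtildeSub_xB r
  obtain ⟨h', e⟩ := mem_PtildeSub_xB (-r)
  rw [← e]
  refine hξ.sumUtilde_mul (p := ⟨_, h⟩) (m := ⟨_, h⟩) rfl (SO7.ext_act fun x => ?_) g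
  rw [act_mul, act_mul, act_w2, act_xB, act_xB, act_w2]
  simp
  constructor <;> ring

/-- The block diagonal part of `x_{2α+β}(r)` lies in the factor `SO₃(k)`, and its conjugate by `w₂`
has trivial `GL₂(k)`-part. -/
theorem IsSection.sumUtilde_x2AB {ξ : SO7 k → Y} (hξ : IsSection τ ξ) (r : k) (g : SO7 k) :
    sumUtilde ξ ((x2AB r).val * g) = sumUtilde ξ g := by
  have h : (x2AB r).val ∈ PtildeSub k := by
    change BlockTriangular (mat2AB r) blk
    intro i j
    fin_cases i <;> fin_cases j <;> simp [mat2AB, blk]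
  have h1 : levi2AB r ∈ PtildeSub k := by
    change BlockTriangular (leviMat2AB r) blk
    intro i j
    fin_cases i <;> fin_cases j <;> simp [leviMat2AB, blk]
  obtain ⟨h2, e⟩ := mem_PtildeSub_of_fix (p := levi2AB' r)
    ((mulVec_leviMat2AB' r _).trans (by simp)) ((mulVec_leviMat2AB' r _).trans (by simp))
  have key := hξ.sumUtilde_mul (p := ⟨_, h⟩) (m := ⟨_, h1⟩) (q := ⟨_, h2⟩) ?_
    (SO7.ext_act fun x => ?_) g
  · rwa [e, map_one, Module.End.one_apply] at key
  · ext i j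
    rw [leviPart_apply, leviPart_apply]
    change ite _ (mat2AB r i j) _ = ite _ (leviMat2AB r i j) _
    fin_cases i <;> fin_cases j <;> simp [mat2AB, leviMat2AB, blk]
  · rw [act_mul, act_mul, act_w2, act_w2]
    refine (mulVec_leviMat2AB' r _).trans (Eq.trans ?_
      (congrArg (fun x : Fin 7 → k => ![-x 5, -x 6, -x 4, -x 3, -x 2, -x 0, -x 1])
        (mulVec_leviMat2AB r x)).symm)
    simp
    constructor <;> ring

end IntertwineUH

/-! ### The zeta sums as invariant forms -/

section Pairing

variable {k : Type u} [Field k]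
variable {X : Type*} [AddCommGroup X] [Module ℂ X] {ρ : Representation ℂ (G2 k) X}
variable {Y : Type*} [AddCommGroup Y] [Module ℂ Y] {τ : Representation ℂ (GL (Fin 2) k) Y}

theorem basicSection_add (g : SO7 k) (y y' : Y) :
    basicSection τ g (y + y') = basicSection τ g y + basicSection τ g y' := by
  funext x
  by_cases h : x * g⁻¹ ∈ PtildeSub k
  · simp only [basicSection, dif_pos h, Pi.add_apply, map_add]
  · simp only [basicSection, dif_neg h, Pi.add_apply, add_zero]

theorem basicSection_smul (g : SO7 k) (c : ℂ) (y : Y) :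
    basicSection τ g (c • y) = c • basicSection τ g y := by
  funext x
  by_cases h : x * g⁻¹ ∈ PtildeSub k
  · simp only [basicSection, dif_pos h, Pi.smul_apply, map_smul]
  · simp only [basicSection, dif_neg h, Pi.smul_apply, smul_zero]

/-- Evaluation of a functional on the values of a function. -/
def evalForm (Λ : Y →ₗ[ℂ] ℂ) : (SO7 k → Y) →ₗ[ℂ] (SO7 k → ℂ) := Λ.compLeft (SO7 k)

theorem evalForm_apply (Λ : Y →ₗ[ℂ] ℂ) (ξ : SO7 k → Y) (g : SO7 k) :
    evalForm Λ ξ g = Λ (ξ g) := rfl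

variable [Finite k]

instance : Fintype (G2 k) := Fintype.ofFinite _

variable (ρ) in
/-- The form `∑_g l(ρ(g) v) Φ(ξ)(g)`, the sum over `G₂(k)`. -/
def pairing (l : X →ₗ[ℂ] ℂ) (Φ : (SO7 k → Y) →ₗ[ℂ] (SO7 k → ℂ)) :
    X →ₗ[ℂ] (SO7 k → Y) →ₗ[ℂ] ℂ :=
  LinearMap.mk₂ ℂ (fun v ξ => ∑ g : G2 k, l (ρ g v) * Φ ξ g.val)
    (fun v v' ξ => by simp only [map_add, add_mul, Finset.sum_add_distrib])
    (fun c v ξ => by simp only [map_smul, smul_eq_mul, mul_assoc, Finset.mul_sum])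
    (fun v ξ ξ' => by simp only [map_add, Pi.add_apply, mul_add, Finset.sum_add_distrib])
    (fun c v ξ => by
      simp only [map_smul, Pi.smul_apply, smul_eq_mul, mul_left_comm _ c, Finset.mul_sum])

theorem pairing_apply (l : X →ₗ[ℂ] ℂ) (Φ : (SO7 k → Y) →ₗ[ℂ] (SO7 k → ℂ)) (v : X)
    (ξ : SO7 k → Y) : pairing ρ l Φ v ξ = ∑ g : G2 k, l (ρ g v) * Φ ξ g.val := rfl

theorem isInvariantForm_pairing (l : X →ₗ[ℂ] ℂ) {Φ : (SO7 k → Y) →ₗ[ℂ] (SO7 k → ℂ)}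
    (hΦ : ∀ (h : SO7 k) ξ g, Φ (fun x => ξ (x * h⁻¹)) g = Φ ξ (g * h⁻¹)) :
    IsInvariantForm ρ (pairing ρ l Φ) := by
  intro h v ξ
  rw [pairing_apply, pairing_apply]
  refine Fintype.sum_equiv (Equiv.mulRight h) _ _ fun g => ?_
  rw [hΦ, Equiv.coe_mulRight, map_mul, Module.End.mul_apply, Subgroup.coe_mul,
    mul_inv_cancel_right]

/-- Evaluation of a functional on the sums over the unipotent radical of `Ptilde`. -/
def intertwineForm (Λ : Y →ₗ[ℂ] ℂ) : (SO7 k → Y) →ₗ[ℂ] (SO7 k → ℂ) where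
  toFun ξ g := Λ (sumUtilde ξ g)
  map_add' ξ ξ' := funext fun g => by
    simp only [sumUtilde, Pi.add_apply, Finset.sum_add_distrib, map_add]
  map_smul' c ξ := funext fun g => by
    simp only [sumUtilde, Pi.smul_apply, ← Finset.smul_sum, map_smul, RingHom.id_apply]

theorem intertwineForm_apply (Λ : Y →ₗ[ℂ] ℂ) (ξ : SO7 k → Y) (g : SO7 k) :
    intertwineForm Λ ξ g = Λ (sumUtilde ξ g) := rfl

theorem isInvariantForm_evalForm (l : X →ₗ[ℂ] ℂ) (Λ : Y →ₗ[ℂ] ℂ) :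
    IsInvariantForm ρ (pairing ρ l (evalForm Λ)) :=
  isInvariantForm_pairing l fun _ _ _ => rfl

theorem isInvariantForm_intertwineForm (l : X →ₗ[ℂ] ℂ) (Λ : Y →ₗ[ℂ] ℂ) :
    IsInvariantForm ρ (pairing ρ l (intertwineForm Λ)) :=
  isInvariantForm_pairing l fun h ξ g => by
    simp only [intertwineForm_apply, sumUtilde, mul_assoc]

theorem intertwine_apply_one (τ : Representation ℂ (GL (Fin 2) k) Y) (Λ : Y →ₗ[ℂ] ℂ)
    (ξ : SO7 k → Y) (g : SO7 k) : intertwine (fun h a => Λ (τ a (ξ h))) g 1 =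
      intertwineForm (Λ ∘ₗ τ d1) ξ g := by
  rw [intertwine, finsum_eq_sum_of_fintype, glStar_one, mul_one, intertwineForm_apply, sumUtilde,
    map_sum]
  rfl

variable [NeZero (2 : k)]

/-- The zeta sum as a sum over the whole group. -/
theorem sum_eq_card_mul_zeta {W : G2 k → ℂ} {f : SO7 k → GL (Fin 2) k → ℂ}
    (h : ∀ u ∈ UH k, ∀ g, W (u * g) * f (u * g).val 1 = W g * f g.val 1) :
    ∑ g, W g * f g.val 1 = Nat.card (UH k) * zeta W f := by
  classical
  have : Fintype (Quotient (QuotientGroup.rightRel (UH k))) := Fintype.ofFinite _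
  have hbij : Function.Bijective fun p : UH k × Quotient (QuotientGroup.rightRel (UH k)) =>
      p.1.val * p.2.out := by
    constructor
    · rintro ⟨u, c⟩ ⟨u', c'⟩ e
      have hc : c = c' := by
        rw [← Quotient.out_eq c, ← Quotient.out_eq c']
        refine Quotient.sound (QuotientGroup.rightRel_apply.2 ?_)
        have : c'.out * c.out⁻¹ = u'.val⁻¹ * u.val := by
          rw [mul_inv_eq_iff_eq_mul, mul_assoc, eq_inv_mul_iff_mul_eq]
          exact e.symm
        rw [this]
        exact mul_mem (inv_mem u'.2) u.2
      subst hc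
      exact Prod.ext (Subtype.ext (mul_right_cancel e)) rfl
    · intro g
      have hg := QuotientGroup.rightRel_apply.1
        (Quotient.exact (Quotient.out_eq (Quotient.mk (QuotientGroup.rightRel (UH k)) g)))
      exact ⟨(⟨_, hg⟩, _), inv_mul_cancel_right _ _⟩
  rw [zeta, finsum_eq_sum_of_fintype, ← (Equiv.ofBijective _ hbij).sum_comp,
    Fintype.sum_prod_type, Nat.card_eq_fintype_card, ← nsmul_eq_mul]
  rw [← Finset.card_univ, ← Finset.sum_const]
  refine Finset.sum_congr rfl fun u _ => Finset.sum_congr rfl fun c _ => h u.val u.2 _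

/-- The counterpart of `zeta_term_invariant` for the intertwined function, checked on the generators
of `U_H`; it makes `sum_eq_card_mul_zeta` applicable. -/
theorem intertwineForm_mul {ψ : AddChar k ℂ} {l : X →ₗ[ℂ] ℂ} (hl : IsWhittaker ρ ψ l)
    {Λ : Y →ₗ[ℂ] ℂ} (hΛ : IsWhittakerGL2 τ ψ⁻¹ Λ) {ξ : SO7 k → Y} (hξ : IsSection τ ξ) (v : X)
    {u : G2 k} (hu : u ∈ UH k) (g : G2 k) :
    l (ρ (u * g) v) * intertwineForm (Λ ∘ₗ τ d1) ξ (u * g).val =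
      l (ρ g v) * intertwineForm (Λ ∘ₗ τ d1) ξ g.val := by
  have triv : ∀ (x : G2 k) (hx : x ∈ U k), psiU ψ ⟨x, hx⟩ = 1 →
      (∀ g, sumUtilde ξ (x.val * g) = sumUtilde ξ g) → ∀ g : G2 k,
      l (ρ (x * g) v) * intertwineForm (Λ ∘ₗ τ d1) ξ (x * g).val =
      l (ρ g v) * intertwineForm (Λ ∘ₗ τ d1) ξ g.val := by
    intro x hx h1 h2 g
    have e1 := hl ⟨x, hx⟩ (ρ g v)
    rw [map_mul, Module.End.mul_apply, e1, h1, one_mul, Subgroup.coe_mul, intertwineForm_apply, h2,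
      intertwineForm_apply]
  induction hu using Subgroup.closure_induction generalizing g with
  | mem x hx =>
    rcases hx with ((⟨r, rfl⟩ | ⟨r, rfl⟩) | ⟨r, rfl⟩) | ⟨r, rfl⟩
    · have e1 := hl ⟨xB r, xB_mem_U r⟩ (ρ g v)
      have e3 := hΛ r (τ d1 (sumUtilde ξ g.val))
      rw [map_mul, Module.End.mul_apply, e1, psiU_xB, Subgroup.coe_mul, intertwineForm_apply,
        hξ.sumUtilde_xB, LinearMap.comp_apply, ← Module.End.mul_apply, ← map_mul, d1_mul_nGL2,
        map_mul, Module.End.mul_apply, e3, intertwineForm_apply, LinearMap.comp_apply]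
      have : ψ r * ψ⁻¹ r = 1 := by
        rw [AddChar.inv_apply, ← AddChar.map_add_eq_mul]; simp
      linear_combination (l (ρ g v) * Λ (τ d1 (sumUtilde ξ g.val))) * this
    · exact triv _ (x2AB_mem_U r) (psiU_x2AB _ _ _) (hξ.sumUtilde_x2AB r) g
    · exact triv _ (x3AB_mem_U r) (psiU_x3AB _ _ _) (hξ.sumUtilde_of_mem (x3AB_mem_Utilde r)) g
    · exact triv _ (x3A2B_mem_U r) (psiU_x3A2B _ _ _)
        (hξ.sumUtilde_of_mem (x3A2B_mem_Utilde r)) g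
  | one => simp
  | mul x y _ _ hx hy => rw [mul_assoc, hx, hy]
  | inv x _ hx => rw [← hx (x⁻¹ * g), mul_inv_cancel_left]

end Pairing

/-! ### Multiplicity one -/

section MultiplicityOne

variable {k : Type u} [Field k] [NeZero (2 : k)] [Finite k]
variable {X : Type*} [AddCommGroup X] [Module ℂ X] {ρ : Representation ℂ (G2 k) X}
variable {Y : Type*} [AddCommGroup Y] [Module ℂ Y] {τ : Representation ℂ (GL (Fin 2) k) Y}
variable {ψ : AddChar k ℂ}

theorem apply_whittakerSum_of_mem {u : G2 k} (hu : u ∈ U k) (v : X) :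
    ρ u (whittakerSum ρ ψ v) = psiU ψ ⟨u, hu⟩ • whittakerSum ρ ψ v :=
  LinearMap.congr_fun (mul_isotypicSum (ι := (U k).subtype) (χ := psiU ψ) (ρ := ρ) ⟨u, hu⟩) v

theorem IsWhittaker.apply_whittakerSum {l : X →ₗ[ℂ] ℂ} (hl : IsWhittaker ρ ψ l) (v : X) :
    l (whittakerSum ρ ψ v) = Fintype.card (U k) * l v :=
  apply_isotypicSum (ι := (U k).subtype) hl v

/-- Invariant forms on the closed cell, composed with the Whittaker projection, are multiples of
the product of the Whittaker functionals. -/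
theorem IsInvariantForm.exists_eq_mul {D : X →ₗ[ℂ] (SO7 k → Y) →ₗ[ℂ] ℂ}
    (hD : IsInvariantForm ρ D) (hψ : ψ ≠ 1) (hρ : ρ.IsIrreducible) (hτ : τ.IsIrreducible)
    {l : X →ₗ[ℂ] ℂ} (hl : IsWhittaker ρ ψ l) (hl0 : l ≠ 0)
    {Λ : Y →ₗ[ℂ] ℂ} (hΛ : IsWhittakerGL2 τ ψ⁻¹ Λ) (hΛ0 : Λ ≠ 0) :
    ∃ c : ℂ, ∀ v y, D (whittakerSum ρ ψ v) (basicSection τ 1 y) = c * (l v * Λ y) := by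
  have hv : ∀ y, ∃ c : ℂ, ∀ v, D (whittakerSum ρ ψ v) (basicSection τ 1 y) = c * l v := by
    intro y
    have hW : IsWhittaker ρ ψ (D.flip (basicSection τ 1 y) ∘ₗ whittakerSum ρ ψ) := fun u v =>
      (congrArg (D.flip (basicSection τ 1 y)) (LinearMap.congr_fun
        (isotypicSum_mul (ι := (U k).subtype) (χ := psiU ψ) (ρ := ρ) u) v)).trans (map_smul _ _ _)
    obtain ⟨c, hc⟩ := hl.unique hρ hψ hW hl0
    exact ⟨c, fun v => LinearMap.congr_fun hc v⟩
  obtain ⟨v₀, hv₀⟩ : ∃ v, l v ≠ 0 := by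
    by_contra! h
    exact hl0 (LinearMap.ext h)
  -- In `y` the form is a Whittaker functional for `ψ⁻¹`: acting by `nGL2 x` on `y` amounts to
  -- acting by `x_β(-x)` on the projection of `v₀`, which multiplies it by `ψ(-x)`.
  let Λ' : Y →ₗ[ℂ] ℂ :=
    { toFun := fun y => D (whittakerSum ρ ψ v₀) (basicSection τ 1 y)
      map_add' := fun y y' => by rw [basicSection_add, map_add]
      map_smul' := fun c y => by rw [basicSection_smul, map_smul]; rfl }
  have hΛ' : IsWhittakerGL2 τ ψ⁻¹ Λ' := by
    intro x y
    obtain ⟨h, e⟩ := mem_PtildeSub_xB (-x)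
    have e1 := basicSection_mul_left (τ := τ) ⟨_, h⟩ 1 y
    have e2 : (nGL2 (-x))⁻¹ = nGL2 x := by
      rw [inv_eq_iff_mul_eq_one, ← nGL2_add, neg_add_cancel, nGL2_zero]
    rw [map_inv, e, e2, mul_one] at e1
    have e4 := hD.apply_basicSection (τ := τ) (xB (-x)) (whittakerSum ρ ψ v₀) 1 y
    rw [one_mul] at e4
    change D _ (basicSection τ 1 (τ (nGL2 x) y)) = _ * D _ (basicSection τ 1 y)
    rw [← e1, ← e4, AddChar.inv_apply, ← psiU_xB ψ (-x) (xB_mem_U _),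
      apply_whittakerSum_of_mem (xB_mem_U _), map_smul]
    rfl
  obtain ⟨b, hb⟩ := hΛ.unique hτ (inv_ne_one.2 hψ) hΛ' hΛ0
  refine ⟨b / l v₀, fun v y => ?_⟩
  obtain ⟨c, hc⟩ := hv y
  have e : c * l v₀ = b * Λ y := (hc v₀).symm.trans (LinearMap.congr_fun hb y)
  rw [hc]
  rw [div_mul_eq_mul_div, eq_div_iff hv₀]
  linear_combination l v * e

theorem IsWhittaker.apply_whittakerSum_eq_zero {l : X →ₗ[ℂ] ℂ} (hl : IsWhittaker ρ ψ l)
    {g u u' : G2 k} (hu : u ∈ U k) (hu' : u' ∈ U k) (h : u * g = g * u')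
    (hne : psiU ψ ⟨u, hu⟩ ≠ psiU ψ ⟨u', hu'⟩) (v : X) : l (ρ g (whittakerSum ρ ψ v)) = 0 := by
  have e1 := hl ⟨u, hu⟩ (ρ g (whittakerSum ρ ψ v))
  rw [← Module.End.mul_apply, ← map_mul, h, map_mul, Module.End.mul_apply,
    apply_whittakerSum_of_mem hu', map_smul, map_smul, smul_eq_mul] at e1
  by_contra h0
  exact hne (mul_right_cancel₀ h0 e1).symm

/-- The Whittaker projection is killed by a Whittaker functional after a translation by the Levi
subgroup, except by its upper triangular unipotent elements. -/
theorem IsWhittaker.apply_levi_eq_zero {l : X →ₗ[ℂ] ℂ} (hl : IsWhittaker ρ ψ l) (hψ : ψ ≠ 1)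
    {a : GL (Fin 2) k} (ha : ∀ x, a ≠ nGL2 x) (v : X) :
    l (ρ (levi a) (whittakerSum ρ ψ v)) = 0 := by
  have hd := GL2_det_mul_inv a
  have kill : ∀ u ∈ V k, ψ (coordA u) ≠
      ψ ((a.val.det)⁻¹ * (a.val 0 0 * coordA u - a.val 1 0 * coordAB u)) →
      l (ρ (levi a) (whittakerSum ρ ψ v)) = 0 := by
    intro u hu hne
    obtain ⟨h1, h2, -⟩ := levi_conj_V a hu
    refine hl.apply_whittakerSum_eq_zero (u := u) (V_le_U hu) (V_le_U h1) (by group) ?_ v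
    rwa [psiU_of_mem_V ψ hu, psiU_of_mem_V ψ h1, h2]
  obtain ⟨hA, hAB, -⟩ := coord_gen (k := k)
  have hABA : ∀ r : k, coordAB (xA r) = 0 := fun r => by simp [coordAB, act_xA]
  have hABAB : ∀ r : k, coordAB (xAB r) = r := fun r => by simp [coordAB, act_xAB]
  -- If `a₁₀ ≠ 0`, conjugation gives a suitable `x_{α+β}` the coordinate `r` along `α`. If `a₁₀ = 0`
  -- and `a₁₁ ≠ 1`, it scales the root `α` by `a₁₁⁻¹`. If moreover `a₁₁ = 1`, then `a₀₀ ≠ 1`, and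
  -- `β` is scaled.
  by_cases h10 : a.val 1 0 = 0
  swap
  · obtain ⟨r, hr⟩ := exists_apply_ne_apply_mul hψ (zero_ne_one (α := k))
    refine kill _ (Subgroup.subset_closure (by simp) : xAB (-(a.val.det * (a.val 1 0)⁻¹ * r)) ∈ V k)
      fun h => hr ?_
    rw [hAB, hABAB, show (a.val.det)⁻¹ * (a.val 0 0 * 0 - a.val 1 0 *
      -(a.val.det * (a.val 1 0)⁻¹ * r)) = (a.val.det * (a.val.det)⁻¹) *
      (a.val 1 0 * (a.val 1 0)⁻¹) * r by ring, hd, mul_inv_cancel₀ h10, one_mul, one_mul] at h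
    rw [zero_mul, h]
  have hdet : a.val.det = a.val 0 0 * a.val 1 1 := by rw [det_fin_two, h10, mul_zero, sub_zero]
  by_cases h11 : a.val 1 1 = 1
  swap
  · obtain ⟨r, hr⟩ := exists_apply_ne_apply_mul hψ (c := (a.val.det)⁻¹ * a.val 0 0) fun h => h11 (by
      have h00 : a.val 0 0 ≠ 0 := fun h' => by simp [h'] at h
      refine mul_left_cancel₀ h00 ?_
      linear_combination -hdet - a.val.det * h + a.val 0 0 * hd)
    refine kill _ (Subgroup.subset_closure (by simp) : xA r ∈ V k) ?_
    rwa [hA, hABA, mul_zero, sub_zero, ← mul_assoc]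
  have h00 : a.val 0 0 ≠ 1 := fun h => ha (a.val 0 1) (gl2_ext (by rw [h, nGL2_val]; rfl)
    (by rw [nGL2_val]; rfl) (by rw [h10, nGL2_val]; rfl) (by rw [h11, nGL2_val]; rfl))
  obtain ⟨r, hr⟩ := exists_apply_ne_apply_mul hψ h00
  refine hl.apply_whittakerSum_eq_zero (u := xB (a.val 0 0 * r)) (xB_mem_U _) (xB_mem_U r) ?_ ?_ v
  · rw [← levi_nGL2, ← levi_nGL2, ← levi_mul, ← levi_mul]
    congr 1
    refine gl2_ext ?_ ?_ ?_ ?_ <;> simp [nGL2_val, h10, h11, Matrix.mul_apply, Fin.sum_univ_two]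
    ring
  · rw [psiU_xB, psiU_xB]
    exact hr.symm

/-- `g` and `levi a` differ by an element fixing `e₁⁺` and `e₂⁺`. It lies in `V` with coordinate `0`
along `α`, so it acts trivially on the Whittaker projection. -/
theorem apply_whittakerSum_of_glPart {g : G2 k} (h : g.val ∈ PtildeSub k) {a : GL (Fin 2) k}
    (ha : glPart ⟨g.val, h⟩ = a) (v : X) :
    ρ g (whittakerSum ρ ψ v) = ρ (levi a) (whittakerSum ρ ψ v) := by
  obtain ⟨ha', e⟩ := levi_mem_PtildeSub a
  have hz : ((levi a)⁻¹ * g).val ∈ PtildeSub k := mul_mem (inv_mem ha') h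
  have ez : glPart ⟨_, hz⟩ = 1 := by
    have hm : (⟨_, hz⟩ : PtildeSub k) = ⟨(levi a).val, ha'⟩⁻¹ * ⟨g.val, h⟩ := Subtype.ext (by
      rw [Subgroup.coe_mul, Subgroup.coe_mul, Subgroup.coe_inv, Subgroup.coe_inv])
    rw [hm, map_mul, map_inv, e, ha, inv_mul_cancel]
  obtain ⟨f0, f1⟩ := act_of_glPart_eq_one hz ez
  obtain ⟨hV, hc, -⟩ := mem_V_of_act (m := 0) (n := 0) f0 f1
  have e2 := apply_whittakerSum_of_mem (ρ := ρ) (ψ := ψ) (V_le_U hV) v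
  rw [psiU_of_mem_V ψ hV, hc, neg_zero, AddChar.map_zero_eq_one, one_smul] at e2
  conv_rhs => rw [← e2]
  rw [← Module.End.mul_apply (ρ (levi a)), ← map_mul, mul_inv_cancel_left]

/-- The value of the zeta sum on the closed cell. -/
theorem IsWhittaker.exists_pairing_eq {l : X →ₗ[ℂ] ℂ} (hl : IsWhittaker ρ ψ l) (hψ : ψ ≠ 1)
    {Λ : Y →ₗ[ℂ] ℂ} (hΛ : IsWhittakerGL2 τ ψ⁻¹ Λ) :
    ∃ c : ℂ, c ≠ 0 ∧ ∀ v y, pairing ρ l (evalForm Λ) (whittakerSum ρ ψ v) (basicSection τ 1 y) =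
      c * (l v * Λ y) := by
  classical
  -- The section vanishes outside `P̃`, and the Whittaker projection is killed unless the
  -- `GL₂(k)`-part lies in `N`. On `S` the factors `ψ` and `ψ⁻¹` cancel, so all terms are equal and
  -- the constant `|S| |U|` is not zero.
  let S : Finset (G2 k) := Finset.univ.filter fun g =>
    ∃ (h : g.val ∈ PtildeSub k) (x : k), glPart ⟨g.val, h⟩ = nGL2 x
  have hS : S.Nonempty := ⟨1, Finset.mem_filter.2 ⟨Finset.mem_univ _, one_mem _, 0, by
    rw [nGL2_zero]; exact map_one _⟩⟩
  refine ⟨S.card * Fintype.card (U k), mul_ne_zero (Nat.cast_ne_zero.2 hS.card_ne_zero)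
    (Nat.cast_ne_zero.2 Fintype.card_ne_zero), fun v y => ?_⟩
  rw [pairing_apply, ← Finset.sum_subset (Finset.subset_univ S)]
  · rw [mul_assoc, ← nsmul_eq_mul, ← Finset.sum_const]
    refine Finset.sum_congr rfl fun g hg => ?_
    obtain ⟨h, x, e⟩ := (Finset.mem_filter.1 hg).2
    rw [apply_whittakerSum_of_glPart h e, levi_nGL2, hl ⟨xB x, xB_mem_U x⟩, psiU_xB, evalForm_apply,
      basicSection_of_mem h (mul_one _).symm, e, hΛ]
    have : ψ x * ψ⁻¹ x = 1 := by
      rw [AddChar.inv_apply, ← AddChar.map_add_eq_mul]; simp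
    rw [hl.apply_whittakerSum]
    linear_combination (Fintype.card (U k) * l v * Λ y) * this
  · intro g _ hg
    by_cases h : g.val ∈ PtildeSub k
    · rw [apply_whittakerSum_of_glPart h rfl, hl.apply_levi_eq_zero hψ, zero_mul]
      exact fun x hx => hg (Finset.mem_filter.2 ⟨Finset.mem_univ _, h, x, hx⟩)
    · rw [evalForm_apply, basicSection_of_notMem, map_zero, mul_zero]
      rwa [inv_one, mul_one]

end MultiplicityOne

end G2GL2

end

/-! ### The functional equation -/

open G2GL2 in
theorem mainTheorem4 {k : Type*} [Field k] [Finite k] [NeZero (2 : k)]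
    (ψ : AddChar k ℂ) (hψ : ψ ≠ 1)
    {X : Type*} [AddCommGroup X] [Module ℂ X] (ρ : Representation ℂ (G2GL2.G2 k) X)
    (hρ : ρ.IsIrreducible) (hρ_gen : G2GL2.IsGeneric ρ ψ) (hρ_cusp : G2GL2.IsCuspidal ρ)
    {Y : Type*} [AddCommGroup Y] [Module ℂ Y] (τ : Representation ℂ (GL (Fin 2) k) Y)
    (hτ : τ.IsIrreducible) (hτ_gen : G2GL2.IsGenericGL2 τ ψ⁻¹) :
    ∃ γ : ℂ, ∀ W ∈ G2GL2.whittakerModel ρ ψ, ∀ f ∈ G2GL2.inducedWhittaker τ ψ⁻¹,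
      G2GL2.zeta W (G2GL2.intertwine f) = γ * G2GL2.zeta W f := by
  obtain ⟨l, hl0, hl⟩ := hρ_gen
  obtain ⟨Λ, hΛ0, hΛ⟩ := hτ_gen
  obtain ⟨c₁, hc₁, h₁⟩ := hl.exists_pairing_eq (τ := τ) hψ hΛ
  obtain ⟨c₂, h₂⟩ := (isInvariantForm_intertwineForm (ρ := ρ) l (Λ ∘ₗ τ d1)).exists_eq_mul hψ hρ hτ
    hl hl0 hΛ hΛ0
  -- The quotient `c₂ / c₁` makes the difference of the two forms vanish on the Whittaker projection
  -- over the coset of `1`, hence on all sections.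
  have key : ∀ v {ξ : SO7 k → Y}, IsSection τ ξ → pairing ρ l (intertwineForm (Λ ∘ₗ τ d1)) v ξ =
      c₂ / c₁ * pairing ρ l (evalForm Λ) v ξ := by
    intro v ξ hξ
    have hD : IsInvariantForm ρ (pairing ρ l (intertwineForm (Λ ∘ₗ τ d1)) -
        (c₂ / c₁) • pairing ρ l (evalForm Λ)) := by
      intro h v ξ
      simp only [LinearMap.sub_apply, LinearMap.smul_apply]
      rw [isInvariantForm_intertwineForm, isInvariantForm_evalForm]
    refine sub_eq_zero.1 (hD.eq_zero hρ_cusp hψ (fun v y => ?_) v hξ)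
    simp only [LinearMap.sub_apply, LinearMap.smul_apply, smul_eq_mul]
    rw [h₁, h₂, ← mul_assoc (c₂ / c₁), div_mul_cancel₀ _ hc₁, sub_self]
  refine ⟨c₂ / c₁, ?_⟩
  rintro W hW f hf
  have hzeta := sum_eq_card_mul_zeta (W := W) (f := f) fun u hu g => zeta_term_invariant hW hf hu g
  obtain ⟨l', -, hl', v, rfl⟩ := hW
  obtain ⟨Λ', -, hΛ', ξ, hξ, rfl⟩ := hf
  have hzeta' := sum_eq_card_mul_zeta (W := fun g => l' (ρ g v))
    (f := intertwine fun g a => Λ' (τ a (ξ g))) fun u hu g => by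
      simp only [intertwine_apply_one]
      exact intertwineForm_mul hl' hΛ' hξ v hu g
  -- The functionals defining `W` and `f` are multiples of `l` and `Λ`, and both sides scale by `a *
  -- b`; so the constant is the same for all `W` and `f`.
  obtain ⟨a, rfl⟩ := hl.unique hρ hψ hl' hl0
  obtain ⟨b, rfl⟩ := hΛ.unique hτ (inv_ne_one.2 hψ) hΛ' hΛ0
  have hcard : (Nat.card (UH k) : ℂ) ≠ 0 := Nat.cast_ne_zero.2 Nat.card_pos.ne'
  refine mul_left_cancel₀ hcard ?_
  rw [mul_left_comm, ← hzeta, ← hzeta']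
  have e1 : ∑ g : G2 k, (a • l) (ρ g v) * (b • Λ) (τ 1 (ξ g.val)) =
      a * b * pairing ρ l (evalForm Λ) v ξ := by
    rw [pairing_apply, Finset.mul_sum]
    refine Finset.sum_congr rfl fun g _ => ?_
    simp only [evalForm_apply, LinearMap.smul_apply, smul_eq_mul, map_one, Module.End.one_apply]
    ring
  have e2 : ∑ g : G2 k, (a • l) (ρ g v) * intertwine (fun g x => (b • Λ) (τ x (ξ g))) g.val 1 =
      a * b * pairing ρ l (intertwineForm (Λ ∘ₗ τ d1)) v ξ := by
    rw [pairing_apply, Finset.mul_sum]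
    refine Finset.sum_congr rfl fun g _ => ?_
    rw [intertwine_apply_one]
    simp only [intertwineForm_apply, LinearMap.comp_apply, LinearMap.smul_apply, smul_eq_mul]
    ring
  rw [e1, e2, key v hξ]
  ring
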